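/- All Lie algebras are real. A graded CR algebra is a $\mathbb Z$-graded Lie algebra $\mathfrak g=\bigoplus_p\mathfrak g_p$ with a linear map $J$ on $\mathfrak g_{-1}$ such that $J^2=-\mathrm{Id}$, $[JX,JY]=[X,Y]$ for $X,Y\in\mathfrak g_{-1}$, and $[A,JX]=J[A,X]$ for $A\in\mathfrak g_0$, $X\in\mathfrak g_{-1}$. A graded module $\mathfrak l$ over a graded Lie algebra $\mathfrak s$ is transitive if $[\mathfrak s_{-1},Y]\ne0$ for $0\ne Y\in\mathfrak l_p$, $p\ge0$; nondegenerate if $[\mathfrak s_{-1},Y]\neq 0$ for $0\ne Y\in\mathfrak l_{-1}$; fundamental if $\mathfrak l_{p-1}=[\mathfrak s_{-1},\mathfrak l_p]$ for $p<0$. A graded Lie algebra has one of these properties if its adjoint module does. A graded CR $\mathfrak s$-module is a graded $\mathfrak s$-module $\mathfrak l$ with a complex structure $J$ on $\mathfrak l_{-1}$ making the Abelian extension $\mathfrak s\oplus\mathfrak l$ (with $[\mathfrak l,\mathfrak l]=0$) a graded CR algebra. A Levi–Tanaka algebra is a transitive, fundamental, nondegenerate graded CR algebra $\mathfrak g$ such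 that, with $\mathfrak m=\bigoplus_{p<0}\mathfrak g_p$, every degree $0$ derivation of $\mathfrak m$ commuting with $J$ is the restriction of $\mathrm{ad}(A)$ for some $A\in\mathfrak g_0$, and, for $p>0$, every degree $p$ derivation $\mathfrak m\to\bigoplus_{q<p}\mathfrak g_q$ is the restriction of $\mathrm{ad}(A)$ for some $A\in\mathfrak g_p$. If $\mathfrak l$ is a transitive graded CR $\mathfrak s$-module with $\mathfrak s\oplus\mathfrak l$ fundamental and nondegenerate, the Levi–Tanaka extension of $\mathfrak s$ by $\mathfrak l$ is the Levi–Tanaka algebra $\mathfrak g$ (unique up to isomorphism) which contains $\mathfrak s\oplus\mathfrak l$ and has the same part of negative degree, with the same $J$. It is proper if it contains no nonzero semisimple ideal. **Theorem.** Let $\mathfrak s$ be a finite dimensional transitive semisimple graded CR algebra and $\mathfrak l$ a finite dimensional irreducible nondegenerate graded CR $\mathfrak s$-module. Let $\mathfrak g$ be the Levi–Tanaka extension of $\mathfrak s$ by $\mathfrak l$ and assume that $\mathfrak g$ is proper. Then $\mathfrak g$ is finite dimensional, $\mathfrak s\oplus\mathfrak l$ embeds in $\mathfrak g$, there is an element $\pi\in\mathfrak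 g_0$ such that $[\pi,X+Y]=Y$ for all $X\in\mathfrak s$, $Y\in\mathfrak l$, and, with $\mathfrak r$ the radical of $\mathfrak g$: (i) if $\mathfrak l$ is of real type ($\mathrm{End}_{\mathfrak s}(\mathfrak l)\simeq\mathbb R$), then $\mathfrak s$ is a Levi subalgebra of $\mathfrak g$, $\mathfrak r=\mathfrak l\oplus\mathbb R\pi$, and $\mathfrak g=\mathfrak s\oplus(\mathfrak l\oplus\mathbb R\pi)$; (ii) if $\mathfrak l$ is of complex type ($\mathrm{End}_{\mathfrak s}(\mathfrak l)\simeq\mathbb C$), then $\mathfrak s$ is a Levi subalgebra of $\mathfrak g$, $\mathfrak r=\mathfrak l\oplus\mathbb C\pi$, and $\mathfrak g=\mathfrak s\oplus(\mathfrak l\oplus\mathbb C\pi)$, where $\mathbb C\pi\subset\mathfrak g_0$ is a real two-dimensional subspace whose elements $z\pi$, $z\in\mathbb C\simeq\mathrm{End}_{\mathfrak s}(\mathfrak l)$, satisfy $[z\pi,X+Y]=zY$ for $X\in\mathfrak s$, $Y\in\mathfrak l$; (iii) if $\mathfrak l$ is of quaternionic type ($\mathrm{End}_{\mathfrak s}(\mathfrak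 l)\simeq\mathbb H$), then $\mathfrak r=\mathfrak l\oplus\mathbb R\pi$ and $\mathfrak g=(\mathfrak s\oplus\mathfrak a)\oplus(\mathfrak l\oplus\mathbb R\pi)$, where $\mathfrak L=\mathfrak s\oplus\mathfrak a$ is a Levi subalgebra, the direct sum of $\mathfrak s$ and of a simple ideal $\mathfrak a$ of $\mathfrak L$ with $[\mathfrak s,\mathfrak a]=0$, $\mathfrak a\subset\mathfrak g_0$ and $\mathfrak a\simeq\mathfrak{su}(2)$. In each case the decomposition is a CR Levi–Malcev decomposition, i.e. the Levi subalgebra and the radical are graded subspaces whose parts of degree $-1$ are $J$-invariant; $\mathfrak l$ is the maximal nilpotent ideal of $\mathfrak r$; and $\mathbb R\pi$ (resp. $\mathbb C\pi$) is a maximal Abelian subalgebra of $\mathfrak r$ among those consisting of elements $X$ with $\mathrm{ad}_{\mathfrak g}(X)$ semisimple. -/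

import Mathlib

namespace LeviTanaka

section Graded

variable {s : Type*} [LieRing s] [LieAlgebra ℝ s]
variable {l : Type*} [AddCommGroup l] [Module ℝ l] [LieRingModule s l] [LieModule ℝ s l]

/-- A graded module is transitive when no nonzero element of degree `p ≥ 0` is annihilated by
`s_{-1}`. Here `S` and `L` are the gradations of the Lie algebra `s` and of the module `l`. -/
def IsTransitive (S : ℤ → Submodule ℝ s) (L : ℤ → Submodule ℝ l) : Prop :=
  ∀ p : ℤ, 0 ≤ p → ∀ Y ∈ L p, (∀ X ∈ S (-1), ⁅X, Y⁆ = 0) → Y = 0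

/-- A graded module is nondegenerate when no nonzero element of degree `-1` is annihilated by
`s_{-1}`. -/
def IsNondegenerate (S : ℤ → Submodule ℝ s) (L : ℤ → Submodule ℝ l) : Prop :=
  ∀ Y ∈ L (-1), (∀ X ∈ S (-1), ⁅X, Y⁆ = 0) → Y = 0

/-- A graded module is fundamental when `l_{p-1} = [s_{-1}, l_p]` for all `p < 0`. -/
def IsFundamental (S : ℤ → Submodule ℝ s) (L : ℤ → Submodule ℝ l) : Prop :=
  ∀ p : ℤ, p < 0 → L (p - 1) = Submodule.span ℝ {Z | ∃ X ∈ S (-1), ∃ Y ∈ L p, ⁅X, Y⁆ = Z}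

end Graded

/-- The structure of a graded CR algebra on a real Lie algebra: a `ℤ`-gradation together with a
complex structure `J` on the piece of degree `-1` such that `[JX, JY] = [X, Y]` for `X, Y` of degree
`-1`, and `[A, JX] = J[A, X]` for `A` of degree `0` and `X` of degree `-1`. -/
structure GradedCRAlgebra (g : Type*) [LieRing g] [LieAlgebra ℝ g] where
  /-- The homogeneous pieces. -/
  gr : ℤ → Submodule ℝ g
  isInternal : DirectSum.IsInternal gr
  lie_mem : ∀ {p q : ℤ} {X Y : g}, X ∈ gr p → Y ∈ gr q → ⁅X, Y⁆ ∈ gr (p + q)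
  /-- The partial complex structure. -/
  J : gr (-1) →ₗ[ℝ] gr (-1)
  J_sq : ∀ X, J (J X) = -X
  J_lie : ∀ X Y : gr (-1), ⁅(J X : g), (J Y : g)⁆ = ⁅(X : g), (Y : g)⁆
  lie_J : ∀ A ∈ gr 0, ∀ X Z : gr (-1), (Z : g) = ⁅A, (X : g)⁆ → (J Z : g) = ⁅A, (J X : g)⁆

namespace GradedCRAlgebra

variable {g : Type*} [LieRing g] [LieAlgebra ℝ g] (G : GradedCRAlgebra g)

/-- Transitivity of a graded Lie algebra: transitivity of its adjoint module. -/
def Transitive : Prop := IsTransitive G.gr G.gr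

/-- Nondegeneracy of a graded Lie algebra: nondegeneracy of its adjoint module. -/
def Nondegenerate : Prop := IsNondegenerate G.gr G.gr

/-- A graded Lie algebra is fundamental when its adjoint module is. -/
def Fundamental : Prop := IsFundamental G.gr G.gr

/-- `D` restricts on the negative part of `g` to a homogeneous derivation of degree `p` with values
in `g`. Only the values of `D` on the pieces of negative degree are constrained (or ever used), so
this describes the linear maps defined on the negative part. For `p ≥ 0` such a map automatically
takes values in the sum of the `g_q` with `q < p`. -/
def IsNegDerivation (p : ℤ) (D : g →ₗ[ℝ] g) : Prop :=
  (∀ q < 0, ∀ X ∈ G.gr q, D X ∈ G.gr (p + q)) ∧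
  ∀ q < 0, ∀ r < 0, ∀ X ∈ G.gr q, ∀ Y ∈ G.gr r, D ⁅X, Y⁆ = ⁅D X, Y⁆ + ⁅X, D Y⁆

/-- A Levi–Tanaka algebra: the maximal transitive CR prolongation of its fundamental nondegenerate
negative part `m`. Maximality says that `g_0` realizes every degree `0` derivation of `m` commuting
with `J`, and that for `p > 0` the piece `g_p` realizes every degree `p` derivation of `m` into the
sum of the `g_q` with `q < p`. By transitivity the realizing element is unique, so that `g_p` is the
space of these derivations. -/
structure IsLeviTanaka : Prop where
  transitive : G.Transitive
  fundamental : G.Fundamental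
  nondegenerate : G.Nondegenerate
  realize_zero : ∀ D : g →ₗ[ℝ] g, G.IsNegDerivation 0 D →
    (∀ X Z : G.gr (-1), (Z : g) = D X → (G.J Z : g) = D (G.J X)) →
    ∃ A ∈ G.gr 0, ∀ q < 0, ∀ X ∈ G.gr q, ⁅A, X⁆ = D X
  realize_pos : ∀ p : ℤ, 0 < p → ∀ D : g →ₗ[ℝ] g, G.IsNegDerivation p D →
    ∃ A ∈ G.gr p, ∀ q < 0, ∀ X ∈ G.gr q, ⁅A, X⁆ = D X

/-- A linear subspace is graded CR when it is the sum of its homogeneous parts and its part of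
degree `-1` is stable under `J`. -/
def IsCRSubspace (W : Submodule ℝ g) : Prop :=
  (W = ⨆ p : ℤ, W ⊓ G.gr p) ∧ ∀ X : G.gr (-1), (X : g) ∈ W → (G.J X : g) ∈ W

end GradedCRAlgebra

/-! ### Abelian extensions -/

/-- The space `s ⊕ l`, carrying the Lie algebra structure of the Abelian extension of `s` by `l`. -/
def AbelianExt (s l : Type*) : Type _ := s × l

namespace AbelianExt

set_option linter.unusedSectionVars false

section Module

variable {s : Type*} [AddCommGroup s] [Module ℝ s] {l : Type*} [AddCommGroup l] [Module ℝ l]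

instance : AddCommGroup (AbelianExt s l) := inferInstanceAs (AddCommGroup (s × l))

instance : Module ℝ (AbelianExt s l) := inferInstanceAs (Module ℝ (s × l))

/-- The inclusion of `s` in `s ⊕ l`. -/
def inl : s →ₗ[ℝ] AbelianExt s l := LinearMap.inl ℝ s l

/-- The inclusion of `l` in `s ⊕ l`. -/
def inr : l →ₗ[ℝ] AbelianExt s l := LinearMap.inr ℝ s l

/-- The subspace `S ⊕ L` of `s ⊕ l`. -/
def sub (S : Submodule ℝ s) (L : Submodule ℝ l) : Submodule ℝ (AbelianExt s l) := S.prod L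

end Module

variable {s : Type*} [LieRing s] [LieAlgebra ℝ s]
variable {l : Type*} [AddCommGroup l] [Module ℝ l] [LieRingModule s l] [LieModule ℝ s l]

instance : Bracket (AbelianExt s l) (AbelianExt s l) :=
  ⟨fun x y => (⁅x.1, y.1⁆, ⁅x.1, y.2⁆ - ⁅y.1, x.2⁆)⟩

@[simp] theorem lie_fst (x y : AbelianExt s l) : ⁅x, y⁆.1 = ⁅x.1, y.1⁆ := rfl

@[simp] theorem lie_snd (x y : AbelianExt s l) : ⁅x, y⁆.2 = ⁅x.1, y.2⁆ - ⁅y.1, x.2⁆ := rfl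

@[simp] theorem add_fst (x y : AbelianExt s l) : (x + y).1 = x.1 + y.1 := rfl

@[simp] theorem add_snd (x y : AbelianExt s l) : (x + y).2 = x.2 + y.2 := rfl

@[simp] theorem zero_fst : (0 : AbelianExt s l).1 = 0 := rfl

@[simp] theorem zero_snd : (0 : AbelianExt s l).2 = 0 := rfl

@[simp] theorem smul_fst (t : ℝ) (x : AbelianExt s l) : (t • x).1 = t • x.1 := rfl

@[simp] theorem smul_snd (t : ℝ) (x : AbelianExt s l) : (t • x).2 = t • x.2 := rfl

instance : LieRing (AbelianExt s l) where
  add_lie x y z := Prod.ext (by simp) (by simp; abel)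
  lie_add x y z := Prod.ext (by simp) (by simp; abel)
  lie_self x := Prod.ext (by simp) (by simp)
  leibniz_lie x y z := Prod.ext (by simp) (by simp; abel)

instance : LieAlgebra ℝ (AbelianExt s l) where
  lie_smul t x y := Prod.ext (by simp) (by simp [smul_sub])

end AbelianExt

/-- The structure of a graded CR module on a module `l` over the graded CR algebra `s`: a gradation
of `l` and a complex structure on `l_{-1}` that make `s ⊕ l` a graded CR algebra (see
`GradedCRModule.ext`). -/
structure GradedCRModule {s : Type*} [LieRing s] [LieAlgebra ℝ s] (S : GradedCRAlgebra s)
    (l : Type*) [AddCommGroup l] [Module ℝ l] [LieRingModule s l] [LieModule ℝ s l] where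
  /-- The homogeneous pieces. -/
  gr : ℤ → Submodule ℝ l
  isInternal : DirectSum.IsInternal gr
  lie_mem : ∀ {p q : ℤ} {X : s} {Y : l}, X ∈ S.gr p → Y ∈ gr q → ⁅X, Y⁆ ∈ gr (p + q)
  /-- The partial complex structure. -/
  J : gr (-1) →ₗ[ℝ] gr (-1)
  J_sq : ∀ Y, J (J Y) = -Y
  J_lie : ∀ (X : S.gr (-1)) (Y : gr (-1)), ⁅(S.J X : s), (J Y : l)⁆ = ⁅(X : s), (Y : l)⁆
  lie_J : ∀ A ∈ S.gr 0, ∀ Y Z : gr (-1), (Z : l) = ⁅A, (Y : l)⁆ → (J Z : l) = ⁅A, (J Y : l)⁆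
  lie_J' : ∀ B ∈ gr 0, ∀ (X : S.gr (-1)) (Z : gr (-1)),
    (Z : l) = ⁅(X : s), B⁆ → (J Z : l) = ⁅(S.J X : s), B⁆

namespace GradedCRModule

variable {s : Type*} [LieRing s] [LieAlgebra ℝ s] {S : GradedCRAlgebra s}
variable {l : Type*} [AddCommGroup l] [Module ℝ l] [LieRingModule s l] [LieModule ℝ s l]
variable (M : GradedCRModule S l)

theorem prod_isInternal : DirectSum.IsInternal fun p => AbelianExt.sub (S.gr p) (M.gr p) := by
  rw [DirectSum.isInternal_submodule_iff_iSupIndep_and_iSup_eq_top]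
  obtain ⟨hS, hS'⟩ :=
    (DirectSum.isInternal_submodule_iff_iSupIndep_and_iSup_eq_top _).1 S.isInternal
  obtain ⟨hM, hM'⟩ :=
    (DirectSum.isInternal_submodule_iff_iSupIndep_and_iSup_eq_top _).1 M.isInternal
  constructor
  · rw [iSupIndep_def] at hS hM ⊢
    intro p
    rw [Submodule.disjoint_def]
    intro x hx hx'
    have h₁ : (⨆ (q : ℤ) (_ : q ≠ p), AbelianExt.sub (S.gr q) (M.gr q)) ≤
        AbelianExt.sub (⨆ (q : ℤ) (_ : q ≠ p), S.gr q) (⨆ (q : ℤ) (_ : q ≠ p), M.gr q) :=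
      iSup₂_le fun q hq => Submodule.prod_mono
        (le_iSup₂_of_le q hq le_rfl) (le_iSup₂_of_le q hq le_rfl)
    exact Prod.ext ((Submodule.disjoint_def.1 (hS p)) _ hx.1 (h₁ hx').1)
      ((Submodule.disjoint_def.1 (hM p)) _ hx.2 (h₁ hx').2)
  · have h₁ : (⊤ : Submodule ℝ s) ≤
        (⨆ p, AbelianExt.sub (S.gr p) (M.gr p)).comap AbelianExt.inl := by
      rw [← hS']
      exact iSup_le fun p X hX =>
        Submodule.mem_iSup_of_mem p (show X ∈ S.gr p ∧ (0 : l) ∈ M.gr p from ⟨hX, zero_mem _⟩)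
    have h₂ : (⊤ : Submodule ℝ l) ≤
        (⨆ p, AbelianExt.sub (S.gr p) (M.gr p)).comap AbelianExt.inr := by
      rw [← hM']
      exact iSup_le fun p Y hY =>
        Submodule.mem_iSup_of_mem p (show (0 : s) ∈ S.gr p ∧ Y ∈ M.gr p from ⟨zero_mem _, hY⟩)
    refine eq_top_iff.2 fun x _ => ?_
    have hx : x = AbelianExt.inl x.1 + AbelianExt.inr x.2 :=
      Prod.ext (add_zero x.1).symm (zero_add x.2).symm
    rw [hx]
    exact add_mem (h₁ (Submodule.mem_top (x := x.1))) (h₂ (Submodule.mem_top (x := x.2)))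

/-- The graded CR algebra structure of the Abelian extension `s ⊕ l`. -/
def ext : GradedCRAlgebra (AbelianExt s l) where
  gr p := AbelianExt.sub (S.gr p) (M.gr p)
  isInternal := M.prod_isInternal
  lie_mem {p q X Y} hX hY := by
    refine ⟨S.lie_mem hX.1 hY.1, sub_mem (M.lie_mem hX.1 hY.2) ?_⟩
    rw [add_comm]
    exact M.lie_mem hY.1 hX.2
  J :=
    { toFun := fun X => ⟨((S.J ⟨X.1.1, X.2.1⟩ : s), (M.J ⟨X.1.2, X.2.2⟩ : l)),
        (S.J ⟨X.1.1, X.2.1⟩).2, (M.J ⟨X.1.2, X.2.2⟩).2⟩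
      map_add' := fun X Y => Subtype.ext <| Prod.ext
        (congrArg Subtype.val (S.J.map_add ⟨X.1.1, X.2.1⟩ ⟨Y.1.1, Y.2.1⟩))
        (congrArg Subtype.val (M.J.map_add ⟨X.1.2, X.2.2⟩ ⟨Y.1.2, Y.2.2⟩))
      map_smul' := fun t X => Subtype.ext <| Prod.ext
        (congrArg Subtype.val (S.J.map_smul t ⟨X.1.1, X.2.1⟩))
        (congrArg Subtype.val (M.J.map_smul t ⟨X.1.2, X.2.2⟩)) }
  J_sq X := Subtype.ext <| Prod.ext
    (congrArg Subtype.val (S.J_sq ⟨X.1.1, X.2.1⟩)) (congrArg Subtype.val (M.J_sq ⟨X.1.2, X.2.2⟩))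
  J_lie X Y := Prod.ext (S.J_lie ⟨X.1.1, X.2.1⟩ ⟨Y.1.1, Y.2.1⟩)
    (congrArg₂ (· - ·) (M.J_lie ⟨X.1.1, X.2.1⟩ ⟨Y.1.2, Y.2.2⟩)
      (M.J_lie ⟨Y.1.1, Y.2.1⟩ ⟨X.1.2, X.2.2⟩))
  lie_J A hA X Z h := by
    have hA₁ : A.1 ∈ S.gr 0 := hA.1
    have hA₂ : A.2 ∈ M.gr 0 := hA.2
    have hm : ⁅A.1, X.1.2⁆ ∈ M.gr (-1) := by simpa using M.lie_mem hA₁ X.2.2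
    have hm' : ⁅X.1.1, A.2⁆ ∈ M.gr (-1) := by simpa using M.lie_mem X.2.1 hA₂
    refine Prod.ext (S.lie_J A.1 hA₁ ⟨X.1.1, X.2.1⟩ ⟨Z.1.1, Z.2.1⟩ (congrArg Prod.fst h)) ?_
    have hZ : (⟨Z.1.2, Z.2.2⟩ : M.gr (-1)) = ⟨_, hm⟩ - ⟨_, hm'⟩ :=
      Subtype.ext (congrArg Prod.snd h)
    have h₁ := M.lie_J A.1 hA₁ ⟨X.1.2, X.2.2⟩ ⟨_, hm⟩ rfl
    have h₂ := M.lie_J' A.2 hA₂ ⟨X.1.1, X.2.1⟩ ⟨_, hm'⟩ rfl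
    change ((M.J ⟨Z.1.2, Z.2.2⟩ : M.gr (-1)) : l) = _
    rw [hZ, map_sub, AddSubgroupClass.coe_sub, h₁, h₂]
    rfl

end GradedCRModule

/-- `g`, with the graded homomorphism `ι : s ⊕ l → g`, is the Levi–Tanaka extension of `s` by `l`:
the module `l` is transitive, `s ⊕ l` is fundamental and nondegenerate, and `g` is a Levi–Tanaka
algebra which contains `s ⊕ l` through `ι` and has the same negative part, with the same `J`. -/
structure IsLeviTanakaExtension {s : Type*} [LieRing s] [LieAlgebra ℝ s] {S : GradedCRAlgebra s}
    {l : Type*} [AddCommGroup l] [Module ℝ l] [LieRingModule s l] [LieModule ℝ s l]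
    (M : GradedCRModule S l) {g : Type*} [LieRing g] [LieAlgebra ℝ g] (G : GradedCRAlgebra g)
    (ι : AbelianExt s l →ₗ⁅ℝ⁆ g) : Prop where
  transitive : IsTransitive S.gr M.gr
  fundamental : M.ext.Fundamental
  nondegenerate : M.ext.Nondegenerate
  leviTanaka : G.IsLeviTanaka
  map_mem : ∀ p : ℤ, ∀ X ∈ M.ext.gr p, ι X ∈ G.gr p
  bijOn_neg : ∀ p < 0, Set.BijOn ι (M.ext.gr p) (G.gr p)
  map_J : ∀ (X : M.ext.gr (-1)) (Z : G.gr (-1)), (Z : g) = ι X → (G.J Z : g) = ι (M.ext.J X)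

/-- A Lie algebra is proper when it contains no nonzero semisimple ideal. -/
def IsProper (g : Type*) [LieRing g] [LieAlgebra ℝ g] : Prop :=
  ∀ I : LieIdeal ℝ g, LieAlgebra.IsSemisimple ℝ I → I = ⊥

/-! ### Types of representations -/

section Types

variable (s : Type*) [LieRing s] [LieAlgebra ℝ s]
variable (l : Type*) [AddCommGroup l] [Module ℝ l] [LieRingModule s l] [LieModule ℝ s l]

/-- The algebra of `s`-endomorphisms of `l`. -/
def commutant : Subalgebra ℝ (Module.End ℝ l) :=
  Subalgebra.centralizer ℝ (Set.range (LieModule.toEnd ℝ s l))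

/-- The `s`-endomorphisms of `l` are the real scalars. -/
def IsRealType : Prop := Nonempty (commutant s l ≃ₐ[ℝ] ℝ)

/-- The `s`-endomorphisms of `l` form an algebra isomorphic to the quaternions. -/
def IsQuaternionicType : Prop := Nonempty (commutant s l ≃ₐ[ℝ] Quaternion ℝ)

end Types

section su2

attribute [local instance 100] LieRing.ofAssociativeRing

/-- The real Lie algebra `su(2)` of traceless skew-Hermitian complex `2 × 2` matrices. -/
def su2 : LieSubalgebra ℝ (Matrix (Fin 2) (Fin 2) ℂ) where
  carrier := {A | A.conjTranspose = -A ∧ A.trace = 0}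
  zero_mem' := by simp
  add_mem' := by
    rintro A B ⟨hA, hA'⟩ ⟨hB, hB'⟩
    exact ⟨by rw [Matrix.conjTranspose_add, hA, hB, neg_add], by rw [Matrix.trace_add, hA', hB',
      add_zero]⟩
  smul_mem' := by
    rintro t A ⟨hA, hA'⟩
    exact ⟨by rw [Matrix.conjTranspose_smul, hA]; simp, by rw [Matrix.trace_smul, hA', smul_zero]⟩
  lie_mem' := by
    rintro A B ⟨hA, -⟩ ⟨hB, -⟩
    refine ⟨?_, ?_⟩
    · rw [Ring.lie_def, Matrix.conjTranspose_sub, Matrix.conjTranspose_mul,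
        Matrix.conjTranspose_mul, hA, hB]
      simp
    · rw [Ring.lie_def, Matrix.trace_sub, Matrix.trace_mul_comm, sub_self]

end su2

/-! ### Levi–Malcev decompositions -/

/-- An Abelian subspace of the radical all of whose elements are semisimple, that is, have a
semisimple adjoint endomorphism. -/
def IsRadicalTorus {g : Type*} [LieRing g] [LieAlgebra ℝ g] (T : Submodule ℝ g) : Prop :=
  T ≤ (LieAlgebra.radical ℝ g).toSubmodule ∧ (∀ X ∈ T, ∀ Y ∈ T, ⁅X, Y⁆ = 0) ∧
  ∀ X ∈ T, (LieAlgebra.ad ℝ g X).IsSemisimple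

/-- `g = L ⊕ (N ⊕ T)` is a graded CR Levi–Malcev decomposition: `L` is a Levi subalgebra, `N ⊕ T` is
the radical, both are graded CR, `N` is the largest nilpotent ideal of the radical, and `T` is a
maximal Abelian subalgebra of semisimple elements of the radical. -/
structure IsCRLeviMalcev {g : Type*} [LieRing g] [LieAlgebra ℝ g] (G : GradedCRAlgebra g)
    (L : LieSubalgebra ℝ g) (N T : Submodule ℝ g) : Prop where
  semisimple : LieAlgebra.IsSemisimple ℝ L
  isCompl : IsCompl L.toSubmodule (LieAlgebra.radical ℝ g).toSubmodule
  isCR_levi : G.IsCRSubspace L.toSubmodule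
  isCR_radical : G.IsCRSubspace (LieAlgebra.radical ℝ g).toSubmodule
  disjoint : Disjoint N T
  sup_eq : N ⊔ T = (LieAlgebra.radical ℝ g).toSubmodule
  nilradical : ∃ I : LieIdeal ℝ (LieAlgebra.radical ℝ g),
    IsGreatest {K : LieIdeal ℝ (LieAlgebra.radical ℝ g) | LieRing.IsNilpotent K} I ∧
    I.toSubmodule.map (LieAlgebra.radical ℝ g).toSubmodule.subtype = N
  torus : Maximal IsRadicalTorus T

end LeviTanaka

/-!
The proof realizes the algebra `C` of endomorphisms of the `s`-module `l` inside `g_0` and shows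
that `g = s ⊕ C ⊕ l`; everything else is read off from the structure of the division algebra `C`.

*Finite dimension.* Let `X` have degree `-1`. By the CR identities, the operators dual to
`ad X ± i ad JX` square to zero on the complex functionals of degree `-2`
(`GradedCRAlgebra.coadOp_sq_eq_zero`). These operators generate the finite-dimensional Lie algebra
of operators dual to the complexified negative part `m`. If a Lie algebra of operators is finite
dimensional and generated by elements acting nilpotently on it, then a vector killed by powers of
the generators lies in a finite-dimensional stable subspace (`exists_finiteDimensional_stable`):
conjugating by exponentials yields a basis of locally nilpotent elements, and ordered monomials in
that basis span the module. Thus the functionals of degree `-2` generate, under `m`, a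
finite-dimensional space of functionals, which vanishes in all large degrees. Since `g` is
transitive and nondegenerate, this space detects every element of degree at least `-2`, so `g` is
bounded above (`GradedCRAlgebra.finiteDimensional_of_negative`).

*The endomorphisms of `l`.* The gradation of the semisimple algebra `s` is defined by an element `E`
of degree `0` (`GradedCRAlgebra.exists_gradingElement`). The difference between the degree and `E`
on `l` commutes with `s`; it is a real scalar, because composing `ad E` with an equivariant complex
structure gives trace zero (`GradedCRModule.exists_shift`). Hence the endomorphisms of the
`s`-module `l` preserve the degree, and by nondegeneracy they commute with `J`. Extended by zero on
`s`, they are derivations of `m`, so the maximality of `g` provides a map `j : C → g_0`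
(`IsLeviTanakaExtension.exists_commutantMap`). The element `π` is `j 1`, and the degree operator of
`g` is the adjoint of a combination of `E` and `π`.

*The decomposition.* As `g` is proper, Cartan's criterion gives a nonzero Abelian ideal. It is
graded, because the degree operator is inner; it meets `m` by transitivity, and therefore contains
the irreducible module `l` (`IsLeviTanakaExtension.modMap_mem_abelian_ideal`). It follows that
`ad π` is idempotent with image `l`. By Weyl's theorem (`exists_equivariant_projection`), `s ⊕ l`
has an `s`-stable graded complement on which `π` acts trivially. This complement lives in degrees
`p ≥ 0`, where the degree is the action of `E`; since `E` has trace zero on it, it is contained in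
`g_0`. So `s` acts trivially on it, and its elements act on `l` through `C`
(`IsLeviTanakaExtension.exists_decomposition`).

*The three types.* Let `T` be a subspace of the center of `C` containing `1`, and `K` a complement
of `T` such that `s ⊕ K` is a semisimple subalgebra. Then `l ⊕ T` is the radical, `s ⊕ K` is a Levi
subalgebra, `l` is the nilradical by Schur's lemma, and `T` is a maximal torus of the radical
(`IsCommutantExtension.isCRLeviMalcev`). In the real and complex cases `K = 0` and `T = C`. In the
quaternionic case `T = ℝ` and `K` consists of the purely imaginary quaternions, a copy of `su(2)`.
-/

/-! ### Locally nilpotent operators and finite-dimensional cyclic modules -/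

namespace LeviTanaka

section LocallyNilpotent

open Polynomial

variable {K : Type*} [Field K] {Q : Type*} [AddCommGroup Q] [Module K Q]

/-- The operator `a` is locally nilpotent on the subspace `U`: each vector of `U` is killed by some
power of `a`. -/
def IsLocNilpotentOn (U : Submodule K Q) (a : Module.End K Q) : Prop :=
  ∀ q ∈ U, ∃ n : ℕ, (a ^ n) q = 0

/-- A polynomial family of operators whose value at every scalar lies in `W` has all its
coefficients in `W`. -/
theorem coeff_mem_of_eval_mem [CharZero K] {A : Type*} [Ring A] [Algebra K A]
    (W : Submodule K A) (f : A[X]) (h : ∀ t : K, f.eval (algebraMap K A t) ∈ W) (k : ℕ) :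
    f.coeff k ∈ W := by
  by_contra hk
  obtain ⟨φ, hφ, hW⟩ := Submodule.exists_le_ker_of_notMem hk
  let P : K[X] := ∑ j ∈ Finset.range (f.natDegree + 1), C (φ (f.coeff j)) * X ^ j
  have hP : P = 0 := by
    refine Polynomial.funext fun t => ?_
    have h1 : φ (f.eval (algebraMap K A t)) = 0 := hW (h t)
    rw [eval_eq_sum_range, map_sum] at h1
    rw [eval_zero, ← h1, eval_finsetSum]
    refine Finset.sum_congr rfl fun j _ => ?_
    rw [← map_pow, ← Algebra.commutes, ← Algebra.smul_def, map_smul, eval_mul, eval_C, eval_pow,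
      eval_X, smul_eq_mul, mul_comm]
  have hc : P.coeff k = φ (f.coeff k) := by
    simp only [P, finsetSum_coeff, coeff_C_mul, coeff_X_pow, mul_ite, mul_one, mul_zero]
    rw [Finset.sum_ite_eq, if_pos]
    rw [Finset.mem_range]
    by_contra hlt
    exact hφ (by rw [coeff_eq_zero_of_natDegree_lt (by omega), map_zero])
  rw [hP, coeff_zero] at hc
  exact hφ hc.symm

/-- The solutions of `f' = [x, f]`, which are the families `exp(t x) a exp(-t x)`, are stable under
powers. -/
theorem derivative_pow_eq_commutator {A : Type*} [Ring A] {x : A} {f : A[X]}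
    (hf : derivative f = C x * f - f * C x) (n : ℕ) :
    derivative (f ^ n) = C x * f ^ n - f ^ n * C x := by
  induction n with
  | zero => simp
  | succ n ih =>
    rw [pow_succ, derivative_mul, ih, hf]
    noncomm_ring

/-- The conjugates `exp(t x) y exp(-t x)` of a locally nilpotent operator `y` by a locally nilpotent
operator `x` are locally nilpotent. When `y` is killed by a power of `ad x` these conjugates form a
polynomial `p` in `t`, with values in every `ad x`-stable space containing `y`. -/
theorem exists_conj_isLocNilpotentOn [CharZero K] {U : Submodule K Q} {x y : Module.End K Q}
    (hx : IsLocNilpotentOn U x) (hy : IsLocNilpotentOn U y) (hxU : ∀ q ∈ U, x q ∈ U)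
    (d : ℕ) (hd : (fun a => x * a - a * x)^[d] y = 0) :
    ∃ p : (Module.End K Q)[X], p.coeff 1 = x * y - y * x ∧
      (∀ T : Submodule K (Module.End K Q), y ∈ T → (∀ a ∈ T, x * a - a * x ∈ T) →
        ∀ k, p.coeff k ∈ T) ∧
      ∀ t : K, IsLocNilpotentOn U (p.eval (algebraMap K _ t)) := by
  set D : Module.End K Q → Module.End K Q := fun a => x * a - a * x with hD
  have hDsmul : ∀ (c : K) a, D (c • a) = c • D a := fun c a => by
    simp only [hD, mul_smul_comm, smul_mul_assoc, smul_sub]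
  have hD0 : D 0 = 0 := by simp [hD]
  have hge : ∀ k, d ≤ k → D^[k] y = 0 := fun k hk => by
    obtain ⟨e, rfl⟩ := Nat.exists_eq_add_of_le hk
    rw [add_comm, Function.iterate_add_apply, hd]
    exact Function.iterate_fixed hD0 e
  let p : (Module.End K Q)[X] :=
    ∑ j ∈ Finset.range d, C (((j.factorial : K)⁻¹) • D^[j] y) * X ^ j
  have hp : ∀ k, p.coeff k = ((k.factorial : K)⁻¹) • D^[k] y := fun k => by
    simp only [p, finsetSum_coeff, coeff_C_mul, coeff_X_pow, mul_ite, mul_one, mul_zero]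
    rw [Finset.sum_ite_eq]
    split_ifs with hk
    · rfl
    · rw [hge k (by simpa using hk), smul_zero]
  have hder : derivative p = C x * p - p * C x := by
    ext1 k
    rw [coeff_derivative, coeff_sub, coeff_C_mul, coeff_mul_C, hp, hp]
    change _ = D _
    rw [hDsmul, Function.iterate_succ_apply', Nat.factorial_succ]
    have h1 : ((k : Module.End K Q) + 1) = algebraMap K _ ((k : K) + 1) := by simp
    rw [h1, ← Algebra.commutes, ← Algebra.smul_def, smul_smul]
    congr 1
    have : (k : K) + 1 ≠ 0 := Nat.cast_add_one_ne_zero k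
    push_cast
    field_simp
  refine ⟨p, ?_, fun T hyT hT k => ?_, fun t q hq => ?_⟩
  · rw [hp]; simp [hD]
  · rw [hp]
    refine T.smul_mem _ ?_
    induction k with
    | zero => exact hyT
    | succ k ih => rw [Function.iterate_succ_apply']; exact hT _ ih
  · -- a power of `y` large enough to kill all the vectors `x ^ j q`
    obtain ⟨a, ha⟩ := hx q hq
    have hxq : ∀ j, (x ^ j) q ∈ U := fun j => by
      induction j with
      | zero => exact hq
      | succ j ih => rw [pow_succ']; exact hxU _ ih
    choose e he using fun j => hy _ (hxq j)
    let n := (Finset.range a).sup e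
    have hn : ∀ j, (y ^ n) ((x ^ j) q) = 0 := fun j => by
      by_cases hj : j < a
      · obtain ⟨r, hr⟩ := Nat.exists_eq_add_of_le
          (Finset.le_sup (f := e) (Finset.mem_range.2 hj))
        change (y ^ ((Finset.range a).sup e)) _ = 0
        rw [hr, add_comm, pow_add, Module.End.mul_apply, he, map_zero]
      · obtain ⟨r, rfl⟩ := Nat.exists_eq_add_of_le (not_lt.1 hj)
        rw [add_comm, pow_add x, Module.End.mul_apply, ha, map_zero, map_zero]
    -- `p ^ n` kills them as well: its coefficients satisfy the recursion `(p ^ n)' = [x, p ^ n]`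
    have hc : ∀ k j, ((p ^ n).coeff k) ((x ^ j) q) = 0 := fun k => by
      induction k with
      | zero =>
        have h0 : (p ^ n).coeff 0 = y ^ n := by
          rw [← constantCoeff_apply, map_pow, constantCoeff_apply, hp]; simp
        rw [h0]; exact hn
      | succ k ih =>
        intro j
        have h1 := congrArg (fun f => f.coeff k) (derivative_pow_eq_commutator hder n)
        simp only [coeff_derivative, coeff_sub, coeff_C_mul, coeff_mul_C] at h1
        have h2 : ((k : Module.End K Q) + 1) = algebraMap K _ ((k : K) + 1) := by simp
        rw [h2, ← Algebra.commutes, ← Algebra.smul_def] at h1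
        have h3 := congrArg (fun f => f ((x ^ j) q)) h1
        simp only [LinearMap.smul_apply, LinearMap.sub_apply, Module.End.mul_apply] at h3
        rw [ih j, map_zero, ← Module.End.mul_apply x, ← pow_succ', ih (j + 1), sub_zero] at h3
        exact (smul_eq_zero.1 h3).resolve_left (Nat.cast_add_one_ne_zero k)
    refine ⟨n, ?_⟩
    have hev : (p.eval (algebraMap K _ t)) ^ n = (p ^ n).eval (algebraMap K _ t) :=
      (map_pow (eval₂RingHom' (RingHom.id _) (algebraMap K (Module.End K Q) t)
        fun b => (Algebra.commutes t b).symm) p n).symm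
    rw [hev, eval_eq_sum_range, LinearMap.sum_apply]
    refine Finset.sum_eq_zero fun k _ => ?_
    rw [← map_pow, ← Algebra.commutes, ← Algebra.smul_def, LinearMap.smul_apply]
    have := hc k 0
    rw [pow_zero, Module.End.one_apply] at this
    rw [this, smul_zero]

/-- A vector killed by a power of `x` is sent to such vectors by the operators killed by a power
of `ad x`, as in the Leibniz rule. -/
theorem exists_pow_apply_eq_zero {x : Module.End K Q} (d : ℕ) :
    ∀ y : Module.End K Q, (fun a => x * a - a * x)^[d] y = 0 →
    ∀ (n : ℕ) (q : Q), (x ^ n) q = 0 → ∃ m : ℕ, (x ^ m) (y q) = 0 := by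
  induction d with
  | zero => intro y hy n q _; exact ⟨0, by simp [show y = 0 from hy]⟩
  | succ d ihd =>
    intro y hy n
    induction n with
    | zero => intro q hq; exact ⟨0, by simp [show q = 0 by simpa using hq]⟩
    | succ n ihn =>
      intro q hq
      obtain ⟨m₁, h₁⟩ := ihd (x * y - y * x) hy (n + 1) q hq
      obtain ⟨m₂, h₂⟩ := ihn (x q) (by rwa [← Module.End.mul_apply, ← pow_succ])
      refine ⟨m₁ + m₂ + 1, ?_⟩
      have h3 : x (y q) = (x * y - y * x) q + y (x q) := by simp
      rw [pow_succ, Module.End.mul_apply, h3, map_add]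
      rw [add_comm m₁, pow_add, Module.End.mul_apply, h₁, map_zero, zero_add, ← pow_add,
        add_comm m₂, pow_add, Module.End.mul_apply, h₂, map_zero]

section Words

variable {ι : Type*} (z : ι → Module.End K Q) (q : Q)

/-- The span of the vectors obtained from `q` by applying at most `n` operators of the family
`z`. -/
def wordSpan (n : ℕ) : Submodule K Q :=
  Submodule.span K {v | ∃ L : List ι, L.length ≤ n ∧ (L.map z).prod q = v}

theorem wordSpan_mono {m n : ℕ} (h : m ≤ n) : wordSpan z q m ≤ wordSpan z q n :=
  Submodule.span_mono fun _ ⟨L, hL, hv⟩ => ⟨L, hL.trans h, hv⟩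

theorem prod_apply_mem_wordSpan (L : List ι) : (L.map z).prod q ∈ wordSpan z q L.length :=
  Submodule.subset_span ⟨L, le_rfl, rfl⟩

theorem apply_mem_wordSpan (i : ι) (n : ℕ) :
    ∀ v ∈ wordSpan z q n, z i v ∈ wordSpan z q (n + 1) := by
  intro v hv
  refine (Submodule.span_le (p := (wordSpan z q (n + 1)).comap (z i))).2 ?_ hv
  rintro _ ⟨L, hL, rfl⟩
  exact Submodule.subset_span ⟨i :: L, by simpa using hL, by simp⟩

variable {z} {q}

/-- Reordering a word changes it by shorter words only: the spanning half of the
Poincaré–Birkhoff–Witt theorem. -/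
theorem perm_sub_mem_wordSpan
    (hz : ∀ i j, z i * z j - z j * z i ∈ Submodule.span K (Set.range z)) {L L' : List ι}
    (h : L.Perm L') : ∀ n, L.length ≤ n + 1 →
      (L.map z).prod q - (L'.map z).prod q ∈ wordSpan z q n := by
  induction h with
  | nil => intro n _; simp
  | @cons a L₁ L₂ h ih =>
    intro n hn
    rw [List.length_cons] at hn
    simp only [List.map_cons, List.prod_cons, Module.End.mul_apply, ← map_sub]
    cases n with
    | zero =>
      have h1 : L₁ = [] := List.length_eq_zero_iff.1 (by omega)
      subst h1
      rw [List.nil_perm.1 h]; simp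
    | succ n => exact apply_mem_wordSpan z q a n _ (ih n (by omega))
  | swap a b L =>
    intro n hn
    simp only [List.length_cons] at hn
    simp only [List.map_cons, List.prod_cons, Module.End.mul_apply]
    rw [← Module.End.mul_apply, ← Module.End.mul_apply (z a), ← LinearMap.sub_apply]
    have key : ∀ w ∈ Submodule.span K (Set.range z),
        w ((L.map z).prod q) ∈ wordSpan z q (L.length + 1) := by
      intro w hw
      induction hw using Submodule.span_induction with
      | mem _ hx =>
        obtain ⟨i, rfl⟩ := hx
        exact apply_mem_wordSpan z q i _ _ (prod_apply_mem_wordSpan z q L)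
      | zero => simp
      | add u v _ _ hu hv => exact add_mem hu hv
      | smul c u _ hu => exact Submodule.smul_mem _ c hu
    exact wordSpan_mono z q (by omega) (key _ (hz b a))
  | @trans L₁ L₂ L₃ h₁ h₂ ih₁ ih₂ =>
    intro n hn
    rw [← sub_add_sub_cancel _ ((L₂.map z).prod q)]
    exact add_mem (ih₁ n hn) (ih₂ n (h₁.length_eq ▸ hn))

/-- Locally nilpotent operators, applied in a fixed order to a vector, give finitely many monomials
only. -/
theorem finite_ordered_monomials {U : Submodule K Q} (hnil : ∀ i, IsLocNilpotentOn U (z i))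
    (hU : ∀ i, ∀ v ∈ U, z i v ∈ U) (hq : q ∈ U) (l : List ι) :
    {v | ∃ k : ι → ℕ, (l.map fun i => z i ^ k i).prod q = v}.Finite ∧
      ∀ v, (∃ k : ι → ℕ, (l.map fun i => z i ^ k i).prod q = v) → v ∈ U := by
  have hpow : ∀ i (m : ℕ), ∀ v ∈ U, (z i ^ m) v ∈ U := fun i m v hv => by
    induction m with
    | zero => exact hv
    | succ m ih => rw [pow_succ']; exact hU i _ ih
  induction l with
  | nil => exact ⟨(Set.finite_singleton q).subset (by rintro _ ⟨k, rfl⟩; simp),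
      by rintro _ ⟨k, rfl⟩; simpa using hq⟩
  | cons i l ih =>
    obtain ⟨hfin, hmem⟩ := ih
    refine ⟨(hfin.biUnion (t := fun v => {w | ∃ m : ℕ, (z i ^ m) v = w}) ?_).subset ?_, ?_⟩
    · intro v hv
      obtain ⟨n, hn⟩ := hnil i v (hmem v hv)
      refine ((Set.finite_lt_nat n).image (fun m => (z i ^ m) v) |>.insert 0).subset ?_
      rintro _ ⟨m, rfl⟩
      by_cases hm : m < n
      · exact Or.inr ⟨m, hm, rfl⟩
      · obtain ⟨r, rfl⟩ := Nat.exists_eq_add_of_le (not_lt.1 hm)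
        left
        rw [add_comm, pow_add, Module.End.mul_apply, hn, map_zero]
    · rintro _ ⟨k, rfl⟩
      simp only [Set.mem_iUnion]
      exact ⟨_, ⟨k, rfl⟩, k i, by simp⟩
    · rintro _ ⟨k, rfl⟩
      simpa using hpow i (k i) _ (hmem _ ⟨k, rfl⟩)

/-- A vector generates a finite-dimensional module over a Lie algebra of operators that is spanned
by finitely many locally nilpotent operators: the words of length at most some `N` span it. -/
theorem exists_wordSpan_stable [Finite ι]
    (hz : ∀ i j, z i * z j - z j * z i ∈ Submodule.span K (Set.range z))
    {U : Submodule K Q} (hnil : ∀ i, IsLocNilpotentOn U (z i))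
    (hU : ∀ i, ∀ v ∈ U, z i v ∈ U) (hq : q ∈ U) :
    ∃ N, ∀ n, wordSpan z q n ≤ wordSpan z q N := by
  classical
  obtain ⟨_⟩ := nonempty_fintype ι
  let l : List ι := Finset.univ.toList
  obtain ⟨hfin, -⟩ := finite_ordered_monomials hnil hU hq l
  -- the ordered word with exponents `k`
  let wd : (ι → ℕ) → List ι := fun k => l.flatMap fun i => List.replicate (k i) i
  have hwd : ∀ k, ((wd k).map z).prod = (l.map fun i => z i ^ k i).prod := fun k => by
    simp [wd, List.flatMap, List.prod_flatten, Function.comp_def]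
  obtain ⟨N, hN⟩ : ∃ N, ∀ k : ι → ℕ, (l.map fun i => z i ^ k i).prod q ∈ wordSpan z q N := by
    choose! f hf using fun v (hv : ∃ k : ι → ℕ, (l.map fun i => z i ^ k i).prod q = v) => hv
    refine ⟨hfin.toFinset.sup fun v => (wd (f v)).length, fun k => ?_⟩
    have hk := hf _ ⟨k, rfl⟩
    rw [← hk, ← hwd]
    exact wordSpan_mono z q (Finset.le_sup (f := fun v => (wd (f v)).length)
      (hfin.mem_toFinset.2 ⟨k, rfl⟩)) (prod_apply_mem_wordSpan z q _)
  refine ⟨N, fun n => ?_⟩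
  induction n with
  | zero => exact wordSpan_mono z q (Nat.zero_le N)
  | succ n ih =>
    refine Submodule.span_le.2 ?_
    rintro _ ⟨L, hL, rfl⟩
    let k : ι → ℕ := fun i => L.count i
    -- up to shorter words, `L` is the ordered word with the same letters
    have hperm : L.Perm (wd k) := by
      rw [List.perm_iff_count]
      intro a
      simp only [wd, List.count_flatMap, Function.comp_def, List.count_replicate, beq_iff_eq]
      have h1 : (l.map fun i => if i = a then k i else 0).sum
          = ∑ i : ι, if i = a then k i else 0 := Finset.sum_map_toList _ _
      rw [h1, Finset.sum_ite_eq']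
      simp [k]
    have h1 := ih (perm_sub_mem_wordSpan (q := q) hz hperm n hL)
    have h2 := hN k
    rw [← hwd] at h2
    have h3 := add_mem h1 h2
    rwa [sub_add_cancel] at h3

end Words

/-- Let `T` be a finite-dimensional Lie algebra of operators, generated by a set `Γ` of elements
that act nilpotently on `T`. A vector killed by a power of each element of `Γ` lies in a
finite-dimensional `T`-stable subspace, the smallest one containing it. -/
theorem exists_finiteDimensional_stable [CharZero K] (T : Submodule K (Module.End K Q))
    [FiniteDimensional K T]
    (hT : ∀ a ∈ T, ∀ b ∈ T, a * b - b * a ∈ T) (Γ : Set (Module.End K Q)) (hΓ : Γ ⊆ T)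
    (hgen : ∀ W ≤ T, Γ ⊆ W → (∀ x ∈ Γ, ∀ a ∈ W, x * a - a * x ∈ W) → T ≤ W)
    (hnil : ∀ x ∈ Γ, ∀ a ∈ T, ∃ d : ℕ, (fun a => x * a - a * x)^[d] a = 0)
    (q : Q) (hq : ∀ x ∈ Γ, ∃ n : ℕ, (x ^ n) q = 0) :
    ∃ F : Submodule K Q, FiniteDimensional K F ∧ q ∈ F ∧
      ∀ V : Submodule K Q, q ∈ V → (∀ a ∈ T, ∀ v ∈ V, a v ∈ V) →
        F ≤ V ∧ ∀ a ∈ T, ∀ v ∈ F, a v ∈ F := by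
  classical
  -- the space on which the elements of `Γ` are locally nilpotent
  let U : Submodule K Q :=
    { carrier := {v | ∀ x ∈ Γ, ∃ n : ℕ, (x ^ n) v = 0}
      zero_mem' := fun x _ => ⟨0, by simp⟩
      add_mem' := fun {u v} hu hv x hx => by
        obtain ⟨m, hm⟩ := hu x hx
        obtain ⟨n, hn⟩ := hv x hx
        exact ⟨m + n, by rw [map_add, pow_add, Module.End.mul_apply, Module.End.mul_apply, hn,
          map_zero, add_zero, ← Module.End.mul_apply, ← pow_add, add_comm, pow_add,
          Module.End.mul_apply, hm, map_zero]⟩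
      smul_mem' := fun c v hv x hx => by
        obtain ⟨n, hn⟩ := hv x hx
        exact ⟨n, by rw [map_smul, hn, smul_zero]⟩ }
  have hU : ∀ a ∈ T, ∀ v ∈ U, a v ∈ U := fun a ha v hv x hx => by
    obtain ⟨d, hd⟩ := hnil x hx a ha
    obtain ⟨n, hn⟩ := hv x hx
    exact exists_pow_apply_eq_zero d a hd n v hn
  -- the locally nilpotent elements span `T`: their span is stable under `ad x` for `x ∈ Γ`, as the
  -- derivative at `0` of conjugation by `exp(t x)`
  let S : Set (Module.End K Q) := {a | a ∈ T ∧ IsLocNilpotentOn U a}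
  have hspan : T ≤ Submodule.span K S := by
    refine hgen _ (Submodule.span_le.2 fun a ha => ha.1) (fun x hx => Submodule.subset_span
      ⟨hΓ hx, fun v hv => hv x hx⟩) fun x hx a ha => ?_
    induction ha using Submodule.span_induction with
    | mem y hy =>
      obtain ⟨d, hd⟩ := hnil x hx y hy.1
      obtain ⟨p, hp1, hpT, hpn⟩ := exists_conj_isLocNilpotentOn (U := U) (fun v hv => hv x hx)
        hy.2 (hU x (hΓ hx)) d hd
      rw [← hp1]
      refine coeff_mem_of_eval_mem _ p (fun t =>
        Submodule.subset_span (show _ ∈ T ∧ _ from ⟨?_, hpn t⟩)) 1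
      rw [eval_eq_sum_range]
      refine sum_mem fun k _ => ?_
      rw [← map_pow, ← Algebra.commutes, ← Algebra.smul_def]
      exact T.smul_mem _ (hpT T hy.1 (fun a ha => hT x (hΓ hx) a ha) k)
    | zero => simp
    | add u v _ _ hu hv =>
      have : x * (u + v) - (u + v) * x = (x * u - u * x) + (x * v - v * x) := by noncomm_ring
      rw [this]; exact add_mem hu hv
    | smul c u _ hu =>
      have : x * (c • u) - (c • u) * x = c • (x * u - u * x) := by
        rw [mul_smul_comm, smul_mul_assoc, smul_sub]
      rw [this]; exact Submodule.smul_mem _ c hu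
  have hST : Submodule.span K S = T := le_antisymm (Submodule.span_le.2 fun a ha => ha.1) hspan
  obtain ⟨S', hS'S, hS'fin, hS'⟩ : ∃ S' ⊆ S, S'.Finite ∧ Submodule.span K S' = T := by
    obtain ⟨b, hbS, hb, hli⟩ := exists_linearIndependent K S
    refine ⟨b, hbS, ?_, hb.trans hST⟩
    have hbT : ∀ i : b, (i : Module.End K Q) ∈ T := fun i => (hbS i.2).1
    have hli' : LinearIndependent K fun i : b => (⟨i, hbT i⟩ : T) :=
      LinearIndependent.of_comp T.subtype hli
    have := hli'.finite
    exact Set.toFinite b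
  have : Finite S' := hS'fin
  let z : S' → Module.End K Q := Subtype.val
  have hr : Submodule.span K (Set.range z) = T := by rw [Subtype.range_coe, hS']
  have hzT : ∀ i, z i ∈ T := fun i => (hS'S i.2).1
  obtain ⟨N, hN⟩ := exists_wordSpan_stable (z := z) (q := q) (U := U)
    (fun i j => by rw [hr]; exact hT _ (hzT i) _ (hzT j))
    (fun i => (hS'S i.2).2) (fun i => hU _ (hzT i)) hq
  refine ⟨wordSpan z q N, ?_, Submodule.subset_span ⟨[], by simp, by simp⟩,
    fun V hqV hV => ⟨?_, ?_⟩⟩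
  · have hfin : {v | ∃ L : List S', L.length ≤ N ∧ (L.map z).prod q = v}.Finite :=
      (List.finite_length_le S' N).image fun L : List S' => (L.map z).prod q
    exact FiniteDimensional.span_of_finite K hfin
  · refine Submodule.span_le.2 ?_
    rintro _ ⟨L, -, rfl⟩
    induction L with
    | nil => simpa using hqV
    | cons i L ih => simpa using hV _ (hzT i) _ ih
  · intro a ha v hv
    rw [← hr] at ha
    induction ha using Submodule.span_induction with
    | mem _ hx =>
      obtain ⟨i, rfl⟩ := hx
      exact hN (N + 1) (apply_mem_wordSpan z q i N v hv)
    | zero => simp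
    | add u w _ _ hu hw => exact add_mem hu hw
    | smul c u _ hu => exact Submodule.smul_mem _ c hu

end LocallyNilpotent

end LeviTanaka

/-! ### Finiteness of the prolongation -/

namespace LeviTanaka

section GradedLift

variable {V W : Type*} [AddCommGroup V] [Module ℝ V] [AddCommGroup W] [Module ℝ W]
  {gr : ℤ → Submodule ℝ V}

/-- The linear map on a graded space with prescribed restrictions to the homogeneous pieces. -/
noncomputable def gradedLift (h : DirectSum.IsInternal gr) (f : ∀ p, gr p →ₗ[ℝ] W) : V →ₗ[ℝ] W :=
  DirectSum.toModule ℝ ℤ W f ∘ₗ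
    (LinearEquiv.ofBijective (DirectSum.coeLinearMap gr) h).symm.toLinearMap

theorem gradedLift_apply (h : DirectSum.IsInternal gr) (f : ∀ p, gr p →ₗ[ℝ] W) {p : ℤ} {x : V}
    (hx : x ∈ gr p) : gradedLift h f x = f p ⟨x, hx⟩ := by
  have h1 : (LinearEquiv.ofBijective (DirectSum.coeLinearMap gr) h).symm x
      = DirectSum.lof ℝ ℤ (fun p => gr p) p ⟨x, hx⟩ := by
    rw [LinearEquiv.symm_apply_eq]
    exact (DirectSum.coeLinearMap_lof gr p ⟨x, hx⟩).symm
  simp only [gradedLift, LinearMap.comp_apply, LinearEquiv.coe_coe]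
  rw [h1, DirectSum.toModule_lof]

theorem graded_induction (h : DirectSum.IsInternal gr) {P : V → Prop} (h0 : P 0)
    (hadd : ∀ x y, P x → P y → P (x + y)) (hgr : ∀ p, ∀ x ∈ gr p, P x) (x : V) : P x :=
  Submodule.iSup_induction gr (motive := P)
    (h.submodule_iSup_eq_top ▸ Submodule.mem_top (x := x)) hgr h0 hadd

theorem eq_zero_of_mem_of_mem (h : DirectSum.IsInternal gr) {p q : ℤ} (hpq : p ≠ q) {x : V}
    (hp : x ∈ gr p) (hq : x ∈ gr q) : x = 0 :=
  Submodule.disjoint_def.1 (h.submodule_iSupIndep.pairwiseDisjoint hpq) x hp hq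

theorem finiteDimensional_of_bounded (h : DirectSum.IsInternal gr) {a b : ℤ}
    (hfin : ∀ p, FiniteDimensional ℝ (gr p)) (hbot : ∀ p, p < a ∨ b < p → gr p = ⊥) :
    FiniteDimensional ℝ V := by
  have h1 : (Finset.Icc a b).sup gr = ⊤ := by
    rw [eq_top_iff, ← h.submodule_iSup_eq_top]
    refine iSup_le fun p => ?_
    by_cases hp : p ∈ Finset.Icc a b
    · exact Finset.le_sup hp
    · rw [hbot p (by rw [Finset.mem_Icc] at hp; omega)]; exact bot_le
  have h2 : FiniteDimensional ℝ ((Finset.Icc a b).sup gr : Submodule ℝ V) :=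
    Submodule.finiteDimensional_finset_sup _ _
  rw [h1] at h2
  exact Module.finite_def.2 ((Submodule.fg_iff_finiteDimensional _).2 h2)

end GradedLift

section Coadjoint

variable {g : Type*} [LieRing g] [LieAlgebra ℝ g]

/-- The operator `ℓ ↦ ℓ ∘ ad X` on the complex-valued linear functionals. It is complex linear, so
that complex combinations of such operators represent the complexification of `g`. -/
noncomputable def coadOp (X : g) : Module.End ℂ (g →ₗ[ℝ] ℂ) where
  toFun f := f ∘ₗ (LieAlgebra.ad ℝ g X : g →ₗ[ℝ] g)
  map_add' _ _ := rfl
  map_smul' _ _ := rfl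

@[simp] theorem coadOp_apply (X : g) (f : g →ₗ[ℝ] ℂ) (A : g) : coadOp X f A = f ⁅X, A⁆ := rfl

theorem coadOp_add (X Y : g) : coadOp (X + Y) = coadOp X + coadOp Y :=
  LinearMap.ext fun f => LinearMap.ext fun A => by simp

theorem coadOp_smul (t : ℝ) (X : g) : coadOp (t • X) = (t : ℂ) • coadOp X :=
  LinearMap.ext fun f => LinearMap.ext fun A => by simp

theorem coadOp_zero : coadOp (0 : g) = 0 :=
  LinearMap.ext fun f => LinearMap.ext fun A => by simp

theorem coadOp_lie (X Y : g) :
    coadOp X * coadOp Y - coadOp Y * coadOp X = -coadOp ⁅X, Y⁆ :=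
  LinearMap.ext fun f => LinearMap.ext fun A => by simp

theorem coadOp_mem_span {P : Submodule ℂ (Module.End ℂ (g →ₗ[ℝ] ℂ))} {S : Set g}
    (hS : ∀ X ∈ S, coadOp X ∈ P) : ∀ X ∈ Submodule.span ℝ S, coadOp X ∈ P := by
  intro X hX
  induction hX using Submodule.span_induction with
  | mem X hX => exact hS X hX
  | zero => rw [coadOp_zero]; exact zero_mem _
  | add X Y _ _ hX hY => rw [coadOp_add]; exact add_mem hX hY
  | smul t X _ hX => rw [coadOp_smul]; exact P.smul_mem _ hX

namespace GradedCRAlgebra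

variable (G : GradedCRAlgebra g)

/-- The complex span of the operators `coadOp X` with `X` homogeneous of degree at most `m`. -/
noncomputable def coadSpan (m : ℤ) : Submodule ℂ (Module.End ℂ (g →ₗ[ℝ] ℂ)) :=
  Submodule.span ℂ {a | ∃ p ≤ m, ∃ X ∈ G.gr p, coadOp X = a}

variable {G}

theorem coadOp_mem_coadSpan {m p : ℤ} (hp : p ≤ m) {X : g} (hX : X ∈ G.gr p) :
    coadOp X ∈ G.coadSpan m := Submodule.subset_span ⟨p, hp, X, hX, rfl⟩

theorem coadSpan_mono {m n : ℤ} (h : m ≤ n) : G.coadSpan m ≤ G.coadSpan n :=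
  Submodule.span_mono fun _ ⟨p, hp, hX⟩ => ⟨p, hp.trans h, hX⟩

theorem commutator_mem_coadSpan {m n : ℤ} : ∀ a ∈ G.coadSpan m, ∀ b ∈ G.coadSpan n,
    a * b - b * a ∈ G.coadSpan (m + n) := by
  intro a ha b hb
  induction ha using Submodule.span_induction with
  | mem a ha =>
    obtain ⟨p, hp, X, hX, rfl⟩ := ha
    induction hb using Submodule.span_induction with
    | mem b hb =>
      obtain ⟨r, hr, Y, hY, rfl⟩ := hb
      rw [coadOp_lie]
      exact neg_mem (coadOp_mem_coadSpan (add_le_add hp hr) (G.lie_mem hX hY))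
    | zero => simp
    | add u v _ _ hu hv =>
      have : coadOp X * (u + v) - (u + v) * coadOp X
        = (coadOp X * u - u * coadOp X) + (coadOp X * v - v * coadOp X) := by noncomm_ring
      rw [this]; exact add_mem hu hv
    | smul c u _ hu =>
      rw [mul_smul_comm, smul_mul_assoc, ← smul_sub]; exact Submodule.smul_mem _ c hu
  | zero => simp
  | add u v _ _ hu hv =>
    have : (u + v) * b - b * (u + v) = (u * b - b * u) + (v * b - b * v) := by noncomm_ring
    rw [this]; exact add_mem hu hv
  | smul c u _ hu =>
    rw [mul_smul_comm, smul_mul_assoc, ← smul_sub]; exact Submodule.smul_mem _ c hu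

theorem coadSpan_eq_bot {μ : ℤ} (hμ : ∀ p < μ, G.gr p = ⊥) {m : ℤ} (hm : m < μ) :
    G.coadSpan m = ⊥ := by
  refine eq_bot_iff.2 (Submodule.span_le.2 ?_)
  rintro _ ⟨p, hp, X, hX, rfl⟩
  rw [hμ p (by omega), Submodule.mem_bot] at hX
  rw [hX, coadOp_zero]
  exact zero_mem _

theorem finiteDimensional_coadSpan {μ : ℤ} (hμ : ∀ p < μ, G.gr p = ⊥)
    (hneg : ∀ p < 0, FiniteDimensional ℝ (G.gr p)) : FiniteDimensional ℂ (G.coadSpan (-1)) := by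
  have h1 : ∀ p < 0, ∃ S : Set g, S.Finite ∧ Submodule.span ℝ S = G.gr p := fun p hp => by
    have := hneg p hp
    exact Submodule.fg_def.1 ((Submodule.fg_iff_finiteDimensional (G.gr p)).2 this)
  choose! S hS hS' using h1
  have h2 : G.coadSpan (-1) ≤
      Submodule.span ℂ (⋃ p ∈ Set.Ico μ 0, coadOp '' S p) := by
    refine Submodule.span_le.2 ?_
    rintro _ ⟨p, hp, X, hX, rfl⟩
    by_cases hpμ : p < μ
    · rw [hμ p hpμ, Submodule.mem_bot] at hX
      rw [hX, coadOp_zero]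
      exact zero_mem _
    · rw [← hS' p (by omega)] at hX
      refine coadOp_mem_span (fun Y hY => Submodule.subset_span ?_) X hX
      simp only [Set.mem_iUnion]
      exact ⟨p, ⟨by omega, by omega⟩, Y, hY, rfl⟩
  have h3 : (⋃ p ∈ Set.Ico μ 0, coadOp '' S p).Finite :=
    (Set.finite_Ico μ 0).biUnion fun p hp => (hS p hp.2).image _
  have := FiniteDimensional.span_of_finite ℂ h3
  exact Submodule.finiteDimensional_of_le h2

theorem lie_J_right (X Y : G.gr (-1)) : ⁅(X : g), (G.J Y : g)⁆ = -⁅(G.J X : g), (Y : g)⁆ := by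
  rw [← G.J_lie X (G.J Y), G.J_sq, Submodule.coe_neg, lie_neg]

theorem lie_J_zero {A : g} (hA : A ∈ G.gr 0) (X : G.gr (-1)) :
    ∃ Z : G.gr (-1), ⁅(X : g), A⁆ = Z ∧ ⁅(G.J X : g), A⁆ = G.J Z := by
  have h1 : ⁅A, (X : g)⁆ ∈ G.gr (-1) := by simpa using G.lie_mem hA X.2
  refine ⟨-⟨_, h1⟩, ?_, ?_⟩
  · rw [← lie_skew]; rfl
  · rw [map_neg, Submodule.coe_neg, G.lie_J A hA X ⟨_, h1⟩ rfl, lie_skew]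

/-- The real and imaginary parts of `[X + iJX, [X + iJX, A]] = 0`. -/
theorem lie_lie_J {A : g} (hA : A ∈ G.gr 0) (X : G.gr (-1)) :
    ⁅(X : g), ⁅(X : g), A⁆⁆ = ⁅(G.J X : g), ⁅(G.J X : g), A⁆⁆ ∧
      ⁅(X : g), ⁅(G.J X : g), A⁆⁆ + ⁅(G.J X : g), ⁅(X : g), A⁆⁆ = 0 := by
  obtain ⟨Z, h1, h2⟩ := lie_J_zero hA X
  rw [h1, h2, G.J_lie, lie_J_right]
  exact ⟨rfl, neg_add_cancel _⟩

/-- The operators `ad X ± i ad JX` square to zero on the functionals of degree `-2`. This is where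
the integrability conditions of a CR algebra enter: for `A` of degree `0` the brackets
`[X + iJX, [X + iJX, A]]` vanish. -/
theorem coadOp_sq_eq_zero {f : g →ₗ[ℝ] ℂ} (hf : ∀ p ≠ -2, ∀ A ∈ G.gr p, f A = 0)
    (X : G.gr (-1)) {c : ℂ} (hc : c * c = -1) :
    ((coadOp (X : g) + c • coadOp (G.J X : g)) ^ 2) f = 0 := by
  ext A
  rw [LinearMap.zero_apply]
  refine graded_induction G.isInternal (P := fun A =>
    (((coadOp (X : g) + c • coadOp (G.J X : g)) ^ 2) f) A = 0) (map_zero _)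
    (fun A B hA hB => by rw [map_add, hA, hB, add_zero]) (fun p A hA => ?_) A
  have h1 : (((coadOp (X : g) + c • coadOp (G.J X : g)) ^ 2) f) A
      = f ⁅(X : g), ⁅(X : g), A⁆⁆
        + c * f (⁅(X : g), ⁅(G.J X : g), A⁆⁆ + ⁅(G.J X : g), ⁅(X : g), A⁆⁆)
        + c * c * f ⁅(G.J X : g), ⁅(G.J X : g), A⁆⁆ := by
    rw [pow_two]
    simp only [Module.End.mul_apply, LinearMap.add_apply, LinearMap.smul_apply, coadOp_apply,
      map_add, map_smul, smul_eq_mul]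
    ring
  rw [h1]
  by_cases hp : p = 0
  · subst hp
    obtain ⟨h2, h3⟩ := lie_lie_J hA X
    rw [h3, ← h2, hc]
    simp
  · have hdeg : ∀ U ∈ G.gr (-1), ∀ V ∈ G.gr (-1), f ⁅U, ⁅V, A⁆⁆ = 0 := fun U hU V hV =>
      hf _ (by omega) _ (G.lie_mem hU (G.lie_mem hV hA))
    rw [map_add, hdeg _ X.2 _ X.2, hdeg _ X.2 _ (G.J X).2, hdeg _ (G.J X).2 _ X.2,
      hdeg _ (G.J X).2 _ (G.J X).2]
    simp

/-- A functional of degree `-2` lies in a space of functionals that is stable under the operators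
of negative degree and vanishes in all large degrees. -/
theorem exists_stable_vanishing (hfund : G.Fundamental)
    (hneg : ∀ p < 0, FiniteDimensional ℝ (G.gr p)) {μ : ℤ} (hμ : ∀ p < μ, G.gr p = ⊥)
    {f : g →ₗ[ℝ] ℂ} (hf : ∀ p ≠ -2, ∀ A ∈ G.gr p, f A = 0) :
    ∃ (F : Submodule ℂ (g →ₗ[ℝ] ℂ)) (n : ℤ), f ∈ F ∧
      (∀ X ∈ G.gr (-1), ∀ h ∈ F, coadOp X h ∈ F) ∧
      ∀ h ∈ F, ∀ p ≥ n, ∀ A ∈ G.gr p, h A = 0 := by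
  have hfin := finiteDimensional_coadSpan hμ hneg
  -- the operators `ad X ± i ad JX`
  let Γ : Set (Module.End ℂ (g →ₗ[ℝ] ℂ)) :=
    {a | ∃ X : G.gr (-1), ∃ c : ℂ, c * c = -1 ∧ coadOp (X : g) + c • coadOp (G.J X : g) = a}
  have hΓ : Γ ⊆ G.coadSpan (-1) := by
    rintro _ ⟨X, c, -, rfl⟩
    exact add_mem (coadOp_mem_coadSpan le_rfl X.2)
      (Submodule.smul_mem _ _ (coadOp_mem_coadSpan le_rfl (G.J X).2))
  have hgen : ∀ W ≤ G.coadSpan (-1), Γ ⊆ W → (∀ x ∈ Γ, ∀ a ∈ W, x * a - a * x ∈ W) →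
      G.coadSpan (-1) ≤ W := by
    -- `Γ` generates: `m` is generated by its part of degree `-1`
    intro W _ hΓW hW
    have h1 : ∀ X ∈ G.gr (-1), coadOp X ∈ W ∧ ∀ a ∈ W, coadOp X * a - a * coadOp X ∈ W := by
      intro X hX
      have hp : coadOp X + Complex.I • coadOp (G.J ⟨X, hX⟩ : g) ∈ Γ :=
        ⟨⟨X, hX⟩, Complex.I, Complex.I_mul_I, rfl⟩
      have hm : coadOp X + (-Complex.I) • coadOp (G.J ⟨X, hX⟩ : g) ∈ Γ :=
        ⟨⟨X, hX⟩, -Complex.I, by rw [neg_mul_neg, Complex.I_mul_I], rfl⟩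
      have h2 : coadOp X = (1 / 2 : ℂ) • ((coadOp X + Complex.I • coadOp (G.J ⟨X, hX⟩ : g)) +
          (coadOp X + (-Complex.I) • coadOp (G.J ⟨X, hX⟩ : g))) := by
        module
      constructor
      · rw [h2]; exact W.smul_mem _ (add_mem (hΓW hp) (hΓW hm))
      · intro a ha
        have h3 := W.smul_mem (1 / 2 : ℂ) (add_mem (hW _ hp a ha) (hW _ hm a ha))
        rw [sub_add_sub_comm, ← add_mul, ← mul_add, smul_sub, ← smul_mul_assoc,
          ← mul_smul_comm, ← h2] at h3
        exact h3
    have h4 : ∀ k : ℕ, ∀ X ∈ G.gr (-1 - k), coadOp X ∈ W := by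
      intro k
      induction k with
      | zero => intro X hX; exact (h1 X (by simpa using hX)).1
      | succ k ih =>
        intro X hX
        have h5 : (-1 - ((k + 1 : ℕ) : ℤ)) = (-1 - (k : ℤ)) - 1 := by push_cast; ring
        rw [h5, hfund (-1 - k) (by omega)] at hX
        refine coadOp_mem_span ?_ X hX
        rintro _ ⟨Y, hY, Z, hZ, rfl⟩
        have h6 := W.neg_mem ((h1 Y hY).2 _ (ih Z hZ))
        rwa [coadOp_lie, neg_neg] at h6
    refine Submodule.span_le.2 ?_
    rintro _ ⟨p, hp, X, hX, rfl⟩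
    refine h4 (-1 - p).toNat X ?_
    rwa [Int.toNat_of_nonneg (by omega), sub_sub_cancel]
  have hnil : ∀ x ∈ Γ, ∀ a ∈ G.coadSpan (-1), ∃ d : ℕ,
      (fun a => x * a - a * x)^[d] a = 0 := by
    intro x hx a ha
    have h1 : ∀ k : ℕ, (fun a => x * a - a * x)^[k] a ∈ G.coadSpan (-1 - k) := by
      intro k
      induction k with
      | zero => simpa using ha
      | succ k ih =>
        rw [Function.iterate_succ_apply']
        have h2 := commutator_mem_coadSpan x (hΓ hx) _ ih
        convert h2 using 2
        push_cast; ring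
    refine ⟨(-μ).toNat, ?_⟩
    have h3 := h1 (-μ).toNat
    rwa [coadSpan_eq_bot hμ (by have := Int.self_le_toNat (-μ); omega), Submodule.mem_bot] at h3
  have hsq : ∀ x ∈ Γ, ∃ n : ℕ, (x ^ n) f = 0 := by
    rintro _ ⟨X, c, hc, rfl⟩
    exact ⟨2, coadOp_sq_eq_zero hf X hc⟩
  obtain ⟨F, hF, hfF, hstab⟩ := exists_finiteDimensional_stable (G.coadSpan (-1))
    (fun a ha b hb => coadSpan_mono (by norm_num) (commutator_mem_coadSpan a ha b hb))
    Γ hΓ hgen hnil f hsq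
  -- the functionals vanishing in all large degrees
  let V : Submodule ℂ (g →ₗ[ℝ] ℂ) :=
    { carrier := {h | ∃ n : ℤ, ∀ p ≥ n, ∀ A ∈ G.gr p, h A = 0}
      zero_mem' := ⟨0, fun _ _ _ _ => rfl⟩
      add_mem' := by
        rintro h k ⟨m, hm⟩ ⟨n, hn⟩
        refine ⟨max m n, fun p hp A hA => ?_⟩
        rw [LinearMap.add_apply, hm p (le_trans (le_max_left _ _) hp) A hA,
          hn p (le_trans (le_max_right _ _) hp) A hA, add_zero]
      smul_mem' := by
        rintro c h ⟨m, hm⟩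
        exact ⟨m, fun p hp A hA => by rw [LinearMap.smul_apply, hm p hp A hA, smul_zero]⟩ }
  obtain ⟨hFV, hFT⟩ := hstab V ⟨-1, fun p hp A hA => hf p (by omega) A hA⟩ (by
    intro a ha v hv
    induction ha using Submodule.span_induction with
    | mem a ha =>
      obtain ⟨r, -, X, hX, rfl⟩ := ha
      obtain ⟨n, hn⟩ := hv
      exact ⟨n - r, fun p hp A hA => hn (r + p) (by omega) _ (G.lie_mem hX hA)⟩
    | zero => exact zero_mem V
    | add u w _ _ hu hw => exact V.add_mem hu hw
    | smul c u _ hu => exact V.smul_mem c hu)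
  obtain ⟨S, hS⟩ := (Submodule.fg_iff_finiteDimensional F).2 hF
  have hSV : ∀ h ∈ S, ∃ n : ℤ, ∀ p ≥ n, ∀ A ∈ G.gr p, h A = 0 := fun h hh =>
    hFV (hS ▸ Submodule.subset_span hh)
  choose! n hn using hSV
  obtain ⟨N, hN⟩ := Finset.exists_le (S.image n)
  refine ⟨F, N, hfF, fun X hX h hh => hFT _ (coadOp_mem_coadSpan le_rfl hX) h hh,
    fun h hh p hp A hA => ?_⟩
  rw [← hS] at hh
  induction hh using Submodule.span_induction with
  | mem h hh => exact hn h hh p (le_trans (hN _ (Finset.mem_image_of_mem n hh)) hp) A hA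
  | zero => rfl
  | add u v _ _ hu hv => rw [LinearMap.add_apply, hu, hv, add_zero]
  | smul c u _ hu => rw [LinearMap.smul_apply, hu, smul_zero]

theorem eq_zero_of_lie_eq_zero (ht : G.Transitive) (hn : G.Nondegenerate) {p : ℤ} (hp : -1 ≤ p)
    {A : g} (hA : A ∈ G.gr p) (h : ∀ X ∈ G.gr (-1), ⁅X, A⁆ = 0) : A = 0 := by
  rcases hp.eq_or_lt with rfl | hp
  · exact hn A hA h
  · exact ht p (by omega) A hA h

/-- A transitive, fundamental and nondegenerate graded CR algebra with finite-dimensional negative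
part is finite dimensional: by transitivity an element of positive degree is detected by the
functionals generated in degree `-2`, and these vanish in large degrees. -/
theorem finiteDimensional_of_negative (ht : G.Transitive) (hfund : G.Fundamental)
    (hn : G.Nondegenerate) (hneg : ∀ p < 0, FiniteDimensional ℝ (G.gr p))
    {μ : ℤ} (hμ : ∀ p < μ, G.gr p = ⊥) : FiniteDimensional ℝ g := by
  have := hneg (-2) (by norm_num)
  let b := Module.finBasis ℝ (G.gr (-2))
  -- the coordinates of the component of degree `-2`
  let f : Fin (Module.finrank ℝ (G.gr (-2))) → (g →ₗ[ℝ] ℂ) := fun i =>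
    gradedLift G.isInternal fun p =>
      if h : p = -2 then
        Complex.ofRealAm.toLinearMap ∘ₗ b.coord i ∘ₗ
          Submodule.inclusion (le_of_eq (congrArg G.gr h))
      else 0
  have hf : ∀ i, ∀ p ≠ -2, ∀ A ∈ G.gr p, f i A = 0 := fun i p hp A hA => by
    simp only [f]
    rw [gradedLift_apply _ _ hA, dif_neg hp, LinearMap.zero_apply]
  have hf2 : ∀ A ∈ G.gr (-2), (∀ i, f i A = 0) → A = 0 := fun A hA h => by
    have h1 : (⟨A, hA⟩ : G.gr (-2)) = 0 := by
      refine b.ext_elem fun i => ?_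
      have h2 := h i
      simp only [f] at h2
      rw [gradedLift_apply _ _ hA, dif_pos rfl] at h2
      have h3 : ((b.coord i ⟨A, hA⟩ : ℝ) : ℂ) = 0 := h2
      simpa using h3
    exact congrArg Subtype.val h1
  choose F n hfF hFs hFv using fun i => exists_stable_vanishing hfund hneg hμ (hf i)
  -- the functionals obtained from degree `-2` detect all elements of degree at least `-2`
  have hdet : ∀ k : ℕ, ∀ A ∈ G.gr (k - 2), (∀ i, ∀ h ∈ F i, h A = 0) → A = 0 := by
    intro k
    induction k with
    | zero => intro A hA h; exact hf2 A (by simpa using hA) fun i => h i _ (hfF i)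
    | succ k ih =>
      intro A hA h
      refine eq_zero_of_lie_eq_zero ht hn (by push_cast; omega) hA fun X hX => ?_
      refine ih _ ?_ fun i u hu => h i _ (hFs i X hX u hu)
      convert G.lie_mem hX hA using 2
      push_cast; ring
  obtain ⟨N, hN⟩ := Finset.exists_le (Finset.univ.image n)
  have hbig : ∀ p, max N 0 < p → G.gr p = ⊥ := fun p hp => by
    refine (Submodule.eq_bot_iff _).2 fun A hA => ?_
    have hp' : 0 < p := lt_of_le_of_lt (le_max_right _ _) hp
    refine hdet (p + 2).toNat A ?_ fun i h hh => hFv i h hh p ?_ A hA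
    · rwa [Int.toNat_of_nonneg (by omega), add_sub_cancel_right]
    · exact (hN _ (Finset.mem_image_of_mem n (Finset.mem_univ i))).trans
        ((le_max_left _ _).trans hp.le)
  have hnonneg : ∀ k : ℕ, FiniteDimensional ℝ (G.gr (k - 1)) := by
    intro k
    induction k with
    | zero => exact hneg _ (by norm_num)
    | succ k ih =>
      have := hneg (-1) (by norm_num)
      let φ : G.gr ((k + 1 : ℕ) - 1) →ₗ[ℝ] (G.gr (-1) →ₗ[ℝ] G.gr (k - 1)) :=
        LinearMap.mk₂ ℝ (fun A X => ⟨⁅(X : g), (A : g)⁆, by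
            convert G.lie_mem X.2 A.2 using 2
            push_cast; ring⟩)
          (fun A B X => Subtype.ext (by simp)) (fun c A X => Subtype.ext (by simp))
          (fun A X Y => Subtype.ext (by simp)) (fun c A X => Subtype.ext (by simp))
      refine FiniteDimensional.of_injective φ ((injective_iff_map_eq_zero φ).2 fun A hA => ?_)
      refine Subtype.ext (ht _ (by push_cast; omega) A A.2 fun X hX => ?_)
      exact congrArg Subtype.val (LinearMap.congr_fun hA ⟨X, hX⟩)
  refine finiteDimensional_of_bounded G.isInternal (a := μ) (b := max N 0) (fun p => ?_) ?_
  · rcases lt_or_ge p 0 with hp | hp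
    · exact hneg p hp
    · have := hnonneg (p + 1).toNat
      rwa [Int.toNat_of_nonneg (by omega), add_sub_cancel_right] at this
  · rintro p (hp | hp)
    · exact hμ p hp
    · exact hbig p hp

end GradedCRAlgebra

end Coadjoint

end LeviTanaka

/-! ### Complete reducibility -/

namespace LeviTanaka

section Weyl

open Module LieModule

universe u v

variable {k : Type*} [Field k]

/-- The canonical tensor `∑ bᵢ ⊗ bᵢ*` of a nondegenerate form is invariant under skew operators. -/
theorem sum_dualBasis_skew {V W ι : Type*} [AddCommGroup V] [Module k V]
    [AddCommGroup W] [Module k W] [Fintype ι] [DecidableEq ι] (B : LinearMap.BilinForm k V)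
    (hB : B.Nondegenerate) (hs : B.IsSymm) (b : Basis ι k V) (A : V →ₗ[k] V)
    (hA : ∀ x y, B (A x) y = -B x (A y)) (Φ : V →ₗ[k] V →ₗ[k] W) :
    ∑ i, (Φ (A (b i)) (B.dualBasis hB b i) + Φ (b i) (A (B.dualBasis hB b i))) = 0 := by
  set b' := B.dualBasis hB b
  have h1 : ∀ x, x = ∑ j, B x (b' j) • b j := fun x => by
    conv_lhs => rw [← b.sum_repr x]
    refine Finset.sum_congr rfl fun j _ => ?_
    congr 1
    conv_rhs => rw [← b.sum_repr x]
    simp only [map_sum, map_smul, LinearMap.sum_apply, LinearMap.smul_apply]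
    simp [b', LinearMap.BilinForm.apply_dualBasis_right hB hs]
  have h2 : ∀ x, x = ∑ j, B x (b j) • b' j := fun x => by
    conv_lhs => rw [← b'.sum_repr x]
    simp [b', LinearMap.BilinForm.dualBasis_repr_apply]
  have h3 : ∑ i, Φ (A (b i)) (b' i) = ∑ i, ∑ j, B (A (b i)) (b' j) • Φ (b j) (b' i) :=
    Finset.sum_congr rfl fun i _ => by
      conv_lhs => rw [h1 (A (b i))]
      simp
  have h4 : ∑ i, Φ (b i) (A (b' i)) = ∑ i, ∑ j, B (A (b' i)) (b j) • Φ (b i) (b' j) :=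
    Finset.sum_congr rfl fun i _ => by
      conv_lhs => rw [h2 (A (b' i))]
      simp
  rw [Finset.sum_add_distrib, h3, h4, Finset.sum_comm, ← Finset.sum_add_distrib]
  refine Finset.sum_eq_zero fun j _ => ?_
  rw [← Finset.sum_add_distrib]
  refine Finset.sum_eq_zero fun i _ => ?_
  rw [← add_smul, hA, hs.eq (b i), neg_add_cancel, zero_smul]

variable {L : Type u} [LieRing L] [LieAlgebra k L] [FiniteDimensional k L]

/-- A semisimple Lie algebra is perfect. -/
theorem span_lie_eq_top [LieAlgebra.IsKilling k L] :
    Submodule.span k {z : L | ∃ x y : L, ⁅x, y⁆ = z} = ⊤ := by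
  let D : LieIdeal k L := ⁅(⊤ : LieIdeal k L), (⊤ : LieIdeal k L)⁆
  have hD : D.toSubmodule = Submodule.span k {z : L | ∃ x y : L, ⁅x, y⁆ = z} := by
    rw [LieSubmodule.lieIdeal_oper_eq_linear_span']
    simp
  have h1 : D.killingCompl = ⊥ := by
    refine (LieSubmodule.eq_bot_iff _).2 fun x hx => ?_
    rw [LieIdeal.mem_killingCompl] at hx
    have h2 : x ∈ LieAlgebra.center k L := by
      rw [LieModule.mem_maxTrivSubmodule]
      intro y
      refine (LieAlgebra.IsKilling.killingForm_nondegenerate k L).1 _ fun z => ?_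
      rw [← lie_skew, map_neg, LinearMap.neg_apply, neg_eq_zero,
        LieModule.traceForm_apply_lie_apply, LieModule.traceForm_comm]
      exact hx _ (LieSubmodule.lie_mem_lie trivial trivial)
    simpa using h2
  have h2 : D = ⊤ := by
    have := (LieIdeal.isCompl_killingCompl D).sup_eq_top
    rwa [h1, sup_bot_eq] at this
  rw [← hD, h2, LieSubmodule.top_toSubmodule]

variable [CharZero k]

section Irreducible

variable {M : Type v} [AddCommGroup M] [Module k M] [LieRingModule L M] [LieModule k L M]
  [FiniteDimensional k M]

/-- On an ideal meeting the kernel of an irreducible representation trivially, the trace form has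
trivial radical: by Cartan's criterion the derived algebra of the radical acts nilpotently. -/
theorem eq_bot_of_traceForm_eq_zero [LieAlgebra.IsKilling k L] [Nontrivial M]
    (hirr : ∀ N : LieSubmodule k L M, N = ⊥ ∨ N = ⊤) (R : LieIdeal k L)
    (hR : ∀ x ∈ R, ∀ y ∈ R, traceForm k L M x y = 0)
    (hfaith : ∀ x ∈ R, (∀ m : M, ⁅x, m⁆ = 0) → x = 0) : R = ⊥ := by
  set D : LieIdeal k L := ⁅R, R⁆ with hD
  have hDR : D ≤ R := LieSubmodule.lie_le_left R R
  have hform : traceForm k R M = 0 := by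
    ext ⟨x, hx⟩ ⟨y, hy⟩
    exact hR x hx y hy
  have hnil := LieModule.isNilpotent_derivedSeries_of_traceForm_eq_zero hform
  have hDnil : LieModule.IsNilpotent D M := by
    rw [LieModule.isNilpotent_iff_forall' (R := k)]
    rintro ⟨x, hx⟩
    refine (LieModule.isNilpotent_iff_forall' (R := k)).mp hnil ⟨⟨x, hDR hx⟩, ?_⟩
    rwa [LieIdeal.derivedSeries_eq_derivedSeriesOfIdeal_comap, LieIdeal.mem_comap]
  let N : LieSubmodule k L M :=
    { carrier := {m | ∀ d ∈ D, ⁅d, m⁆ = 0}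
      zero_mem' := fun d _ => lie_zero d
      add_mem' := fun {a b} ha hb d hd => by rw [lie_add, ha d hd, hb d hd, add_zero]
      smul_mem' := fun c m hm d hd => by rw [lie_smul, hm d hd, smul_zero]
      lie_mem := fun {x m} hm d hd => by
        rw [leibniz_lie, hm d hd, lie_zero, add_zero]
        exact hm _ (lie_mem_left k L D d x hd) }
  have hN : N = ⊤ := by
    refine (hirr N).resolve_left fun hbot => ?_
    have := LieModule.nontrivial_max_triv_of_isNilpotent k D M
    obtain ⟨m, hm⟩ := exists_ne (0 : maxTrivSubmodule k D M)
    refine hm (Subtype.ext ?_)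
    have h1 : (m : M) ∈ N := fun d hd =>
      (mem_maxTrivSubmodule k D M (m : M)).1 m.2 ⟨d, hd⟩
    rwa [hbot, LieSubmodule.mem_bot] at h1
  have hD0 : D = ⊥ := (LieSubmodule.eq_bot_iff _).2 fun d hd =>
    hfaith d (hDR hd) fun m => (hN ▸ LieSubmodule.mem_top m : m ∈ N) d hd
  have : IsLieAbelian R := (LieSubmodule.lie_abelian_iff_lie_self_eq_bot R).2 hD0
  exact LieAlgebra.IsKilling.ideal_eq_bot_of_isLieAbelian R

/-- Whitehead's first lemma for a nontrivial irreducible module, by means of the Casimir operator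
of the trace form. -/
theorem exists_eq_lie_of_irreducible [LieAlgebra.IsKilling k L] [Nontrivial M]
    (hirr : ∀ N : LieSubmodule k L M, N = ⊥ ∨ N = ⊤) (hnt : ∃ (x : L) (m : M), ⁅x, m⁆ ≠ 0)
    (φ : L →ₗ[k] M) (hφ : ∀ x y, φ ⁅x, y⁆ = ⁅x, φ y⁆ - ⁅y, φ x⁆) :
    ∃ m : M, ∀ x, φ x = ⁅x, m⁆ := by
  classical
  let κ : LieIdeal k L := LieModule.ker k L M
  have hκ : ∀ x, x ∈ κ ↔ ∀ m : M, ⁅x, m⁆ = 0 := fun x => LieModule.mem_ker k L M x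
  let I : LieIdeal k L := κ.killingCompl
  have hI : IsCompl κ I := κ.isCompl_killingCompl
  let B : LinearMap.BilinForm k I := (traceForm k L M).restrict I.toSubmodule
  have hBapp : ∀ x y : I, B x y = traceForm k L M x y := fun _ _ => rfl
  have hsymm : B.IsSymm := ⟨fun x y => traceForm_comm k L M x y⟩
  have hnd : B.Nondegenerate := by
    refine hsymm.isRefl.nondegenerate_iff_separatingLeft.mpr fun x hx => ?_
    let R : LieIdeal k L :=
      { carrier := {x | x ∈ I ∧ ∀ y ∈ I, traceForm k L M x y = 0}
        zero_mem' := ⟨zero_mem I, fun y _ => by simp⟩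
        add_mem' := fun {a b} ha hb => ⟨add_mem ha.1 hb.1, fun y hy => by
          rw [map_add, LinearMap.add_apply, ha.2 y hy, hb.2 y hy, add_zero]⟩
        smul_mem' := fun c a ha => ⟨I.smul_mem c ha.1, fun y hy => by
          rw [map_smul, LinearMap.smul_apply, ha.2 y hy, smul_zero]⟩
        lie_mem := fun {z a} ha => ⟨lie_mem_right k L I z a ha.1, fun y hy => by
          rw [← lie_skew, map_neg, LinearMap.neg_apply, traceForm_apply_lie_apply,
            ha.2 _ (lie_mem_right k L I z y hy), neg_zero]⟩ }
    have hR : R = ⊥ := eq_bot_of_traceForm_eq_zero hirr R (fun x hx y hy => hx.2 y hy.1)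
      fun x hx hm => by
        have : x ∈ κ ⊓ I := ⟨(hκ x).2 hm, hx.1⟩
        rwa [hI.inf_eq_bot, LieSubmodule.mem_bot] at this
    have hx' : (x : L) ∈ R := ⟨x.2, fun y hy => hx ⟨y, hy⟩⟩
    rw [hR, LieSubmodule.mem_bot] at hx'
    exact Subtype.ext hx'
  let b := Module.finBasis k I
  set b' := B.dualBasis hnd b with hb'
  have hskew : ∀ (y : L) (p q : I), B (toEnd k L I y p) q = -B p (toEnd k L I y q) :=
    fun y p q => by
      rw [hBapp, hBapp, toEnd_apply_apply, toEnd_apply_apply, LieSubmodule.coe_bracket,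
        LieSubmodule.coe_bracket, ← lie_skew, map_neg, LinearMap.neg_apply,
        traceForm_apply_lie_apply]
  -- the Casimir operator of the trace form; its trace is `dim I`, so that it is invertible
  let C : M →ₗ[k] M := ∑ i, toEnd k L M (b i) ∘ₗ toEnd k L M (b' i)
  have hCapp : ∀ m, C m = ∑ i, ⁅(b i : L), ⁅(b' i : L), m⁆⁆ := fun m => by
    simp [C, LinearMap.sum_apply]
  have hCcomm : ∀ (y : L) (m : M), ⁅y, C m⁆ = C ⁅y, m⁆ := fun y m => by
    let Φ : I →ₗ[k] I →ₗ[k] M := LinearMap.mk₂ k (fun p q => ⁅(p : L), ⁅(q : L), m⁆⁆)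
      (fun _ _ _ => by simp) (fun _ _ _ => by simp) (fun _ _ _ => by simp) (fun _ _ _ => by simp)
    have h := sum_dualBasis_skew B hnd hsymm b (toEnd k L I y) (hskew y) Φ
    rw [hCapp, hCapp, lie_sum, ← sub_eq_zero, ← Finset.sum_sub_distrib, ← h]
    refine Finset.sum_congr rfl fun i _ => ?_
    simp only [Φ, LinearMap.mk₂_apply, toEnd_apply_apply, LieSubmodule.coe_bracket]
    rw [leibniz_lie y (b i : L), leibniz_lie y (b' i : L), lie_add]
    abel
  have htr : LinearMap.trace k M C = (Module.finrank k I : k) := by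
    simp only [C, map_sum]
    have : ∀ i, LinearMap.trace k M (toEnd k L M (b i) ∘ₗ toEnd k L M (b' i)) = 1 := fun i => by
      have h1 : B (b i) (b' i) = 1 := by
        rw [hb', LinearMap.BilinForm.apply_dualBasis_right hnd hsymm, if_pos rfl]
      exact h1
    simp [this]
  have hC0 : C ≠ 0 := by
    intro h0
    rw [h0, map_zero] at htr
    have h1 : Module.finrank k I = 0 := by exact_mod_cast htr.symm
    have h2 : I = ⊥ := by
      rw [← LieSubmodule.toSubmodule_eq_bot]
      exact Submodule.finrank_eq_zero.1 h1
    have h3 : κ = ⊤ := by have := hI.sup_eq_top; rwa [h2, sup_bot_eq] at this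
    obtain ⟨x, m, hxm⟩ := hnt
    exact hxm ((hκ x).1 (h3 ▸ LieSubmodule.mem_top x) m)
  let N : LieSubmodule k L M :=
    { LinearMap.ker C with
      lie_mem := fun {x m} hm => by
        change C ⁅x, m⁆ = 0
        rw [← hCcomm, show C m = 0 from hm, lie_zero] }
  have hinj : Function.Injective C := by
    rw [← LinearMap.ker_eq_bot]
    rcases hirr N with h | h
    · exact (LieSubmodule.toSubmodule_eq_bot N).2 h
    · refine absurd (LinearMap.ext fun m => ?_) hC0
      exact (h ▸ LieSubmodule.mem_top m : m ∈ N)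
  -- the Casimir operator maps the sought vector `m` to `∑ bᵢ φ(bᵢ*)`
  let m₀ : M := ∑ i, ⁅(b i : L), φ (b' i)⁆
  obtain ⟨m, hm⟩ := (LinearMap.injective_iff_surjective.1 hinj) m₀
  refine ⟨m, fun y => hinj ?_⟩
  rw [← hCcomm, hm]
  let Φ : I →ₗ[k] I →ₗ[k] M := LinearMap.mk₂ k (fun p q => ⁅(p : L), φ (q : L)⁆)
    (fun _ _ _ => by simp) (fun _ _ _ => by simp) (fun _ _ _ => by simp) (fun _ _ _ => by simp)
  have h := sum_dualBasis_skew B hnd hsymm b (toEnd k L I y) (hskew y) Φ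
  rw [hCapp, lie_sum, ← sub_eq_zero, ← neg_eq_zero, neg_sub, ← Finset.sum_sub_distrib, ← h]
  refine Finset.sum_congr rfl fun i _ => ?_
  simp only [Φ, LinearMap.mk₂_apply, toEnd_apply_apply, LieSubmodule.coe_bracket]
  rw [leibniz_lie y (b i : L), hφ, lie_sub]
  abel

end Irreducible

/-- Whitehead's first lemma: the first cohomology of a semisimple Lie algebra with values in a
finite-dimensional module vanishes. -/
theorem exists_eq_lie_of_cocycle [LieAlgebra.IsKilling k L] (n : ℕ) :
    ∀ (M : Type v) [AddCommGroup M] [Module k M] [LieRingModule L M] [LieModule k L M]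
      [FiniteDimensional k M], Module.finrank k M = n → ∀ φ : L →ₗ[k] M,
      (∀ x y, φ ⁅x, y⁆ = ⁅x, φ y⁆ - ⁅y, φ x⁆) → ∃ m : M, ∀ x, φ x = ⁅x, m⁆ := by
  induction n using Nat.strong_induction_on with
  | _ n ih =>
    intro M _ _ _ _ _ hn φ hφ
    by_cases htriv : ∀ (x : L) (m : M), ⁅x, m⁆ = 0
    · refine ⟨0, fun x => ?_⟩
      rw [lie_zero]
      have hx : x ∈ Submodule.span k {z : L | ∃ x y : L, ⁅x, y⁆ = z} := by
        rw [span_lie_eq_top]; trivial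
      refine (Submodule.span_le (p := LinearMap.ker φ)).2 ?_ hx
      rintro _ ⟨y, z, rfl⟩
      change φ _ = 0
      rw [hφ, htriv, htriv, sub_zero]
    · push Not at htriv
      have : Nontrivial M := by
        obtain ⟨x, m, hxm⟩ := htriv
        exact ⟨⟨_, _, hxm⟩⟩
      by_cases hirr : ∀ N : LieSubmodule k L M, N = ⊥ ∨ N = ⊤
      · exact exists_eq_lie_of_irreducible hirr htriv φ hφ
      · push Not at hirr
        obtain ⟨N, hN0, hN1⟩ := hirr
        have hN0' : N.toSubmodule ≠ ⊥ := fun h => hN0 ((LieSubmodule.toSubmodule_eq_bot N).1 h)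
        have hN1' : N.toSubmodule ≠ ⊤ := fun h => hN1 ((LieSubmodule.toSubmodule_eq_top N).1 h)
        have hlt : Module.finrank k N < n := hn ▸ Submodule.finrank_lt hN1'
        have hltq : Module.finrank k (M ⧸ N) < n := by
          have h1 := Submodule.finrank_quotient_add_finrank N.toSubmodule
          have h2 : 0 < Module.finrank k N.toSubmodule :=
            Nat.pos_of_ne_zero fun h => hN0' (Submodule.finrank_eq_zero.1 h)
          have h3 : Module.finrank k (M ⧸ N) = Module.finrank k (M ⧸ N.toSubmodule) := rfl
          omega
        obtain ⟨mq, hmq⟩ := ih _ hltq (M ⧸ N) rfl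
          ((LieSubmodule.Quotient.mk' N : M →ₗ[k] M ⧸ N) ∘ₗ φ) (fun x y => by
            simp only [LinearMap.comp_apply, hφ, map_sub]
            rfl)
        obtain ⟨m, rfl⟩ := LieSubmodule.Quotient.surjective_mk' N mq
        have hmem : ∀ x, φ x - ⁅x, m⁆ ∈ N := fun x => by
          have h1 := hmq x
          rw [← LieSubmodule.Quotient.mk_eq_zero']
          have h2 : LieSubmodule.Quotient.mk (N := N) (φ x - ⁅x, m⁆) =
            (LieSubmodule.Quotient.mk' N : M →ₗ[k] M ⧸ N) (φ x) -
              ⁅x, LieSubmodule.Quotient.mk' N m⁆ := rfl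
          rw [h2, ← h1]
          exact sub_self _
        let φ' : L →ₗ[k] N :=
          { toFun := fun x => ⟨φ x - ⁅x, m⁆, hmem x⟩
            map_add' := fun x y => Subtype.ext (by simp; abel)
            map_smul' := fun c x => Subtype.ext (by simp [smul_sub]) }
        obtain ⟨p, hp⟩ := ih _ hlt N rfl φ' (fun x y => Subtype.ext (by
          simp only [φ', LinearMap.coe_mk, AddHom.coe_mk, hφ, lie_sub, LieSubmodule.coe_bracket,
            AddSubgroupClass.coe_sub, lie_lie]
          abel))
        refine ⟨m + p, fun x => ?_⟩
        have h1 : φ x - ⁅x, m⁆ = ⁅x, (p : M)⁆ := congrArg Subtype.val (hp x)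
        rw [lie_add, ← h1, add_sub_cancel]

/-- Weyl's theorem: a submodule of a finite-dimensional module over a semisimple Lie algebra is the
image of an equivariant projection. -/
theorem exists_equivariant_projection [LieAlgebra.IsKilling k L] {M : Type v} [AddCommGroup M]
    [Module k M] [LieRingModule L M] [LieModule k L M] [FiniteDimensional k M]
    (N : LieSubmodule k L M) :
    ∃ P : M →ₗ[k] M, (∀ m, P m ∈ N) ∧ (∀ m ∈ N, P m = m) ∧
      ∀ (x : L) (m : M), P ⁅x, m⁆ = ⁅x, P m⁆ := by
  obtain ⟨P₀', hP₀'⟩ := LinearMap.exists_leftInverse_of_injective N.toSubmodule.subtype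
    (Submodule.ker_subtype _)
  let P₀ : M →ₗ[k] M := N.toSubmodule.subtype ∘ₗ P₀'
  have hP₀N : ∀ m, P₀ m ∈ N := fun m => (P₀' m).2
  have hP₀id : ∀ m ∈ N, P₀ m = m := fun m hm =>
    congrArg Subtype.val (LinearMap.congr_fun hP₀' ⟨m, hm⟩)
  -- `x ↦ [x, P₀]` is a cocycle with values in `Hom(M / N, N)`
  let H : LieSubmodule k L (M →ₗ[k] M) :=
    { carrier := {f | (∀ m, f m ∈ N) ∧ ∀ m ∈ N, f m = 0}
      zero_mem' := ⟨fun _ => zero_mem N, fun _ _ => rfl⟩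
      add_mem' := fun {a b} ha hb => ⟨fun m => add_mem (ha.1 m) (hb.1 m), fun m hm => by
        rw [LinearMap.add_apply, ha.2 m hm, hb.2 m hm, add_zero]⟩
      smul_mem' := fun c a ha => ⟨fun m => N.smul_mem c (ha.1 m), fun m hm => by
        rw [LinearMap.smul_apply, ha.2 m hm, smul_zero]⟩
      lie_mem := fun {x f} hf => ⟨fun m => by
          rw [LieHom.lie_apply]
          exact sub_mem (N.lie_mem (hf.1 m)) (hf.1 _), fun m hm => by
          rw [LieHom.lie_apply, hf.2 m hm, hf.2 _ (N.lie_mem hm), lie_zero, sub_zero]⟩ }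
  let φ : L →ₗ[k] H :=
    { toFun := fun x => ⟨⁅x, P₀⁆, fun m => by
          rw [LieHom.lie_apply]
          exact sub_mem (N.lie_mem (hP₀N m)) (hP₀N _), fun m hm => by
          rw [LieHom.lie_apply, hP₀id m hm, hP₀id _ (N.lie_mem hm), sub_self]⟩
      map_add' := fun x y => Subtype.ext (by simp)
      map_smul' := fun c x => Subtype.ext (by simp) }
  obtain ⟨f, hf⟩ := exists_eq_lie_of_cocycle _ H rfl φ (fun x y => Subtype.ext (by
    simp only [φ, LinearMap.coe_mk, AddHom.coe_mk, LieSubmodule.coe_bracket,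
      AddSubgroupClass.coe_sub, lie_lie]))
  refine ⟨P₀ - f, fun m => sub_mem (hP₀N m) (f.2.1 m), fun m hm => ?_, fun x m => ?_⟩
  · rw [LinearMap.sub_apply, hP₀id m hm, f.2.2 m hm, sub_zero]
  · have h1 : ⁅x, P₀⁆ = ⁅x, (f : M →ₗ[k] M)⁆ := congrArg Subtype.val (hf x)
    have h2 := LinearMap.congr_fun h1 m
    rw [LieHom.lie_apply, LieHom.lie_apply] at h2
    rw [LinearMap.sub_apply, LinearMap.sub_apply, lie_sub]
    rw [sub_eq_sub_iff_sub_eq_sub] at h2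
    exact h2.symm

end Weyl

end LeviTanaka

/-! ### Grading elements and the commutant -/

namespace LeviTanaka

section DegreeOperator

variable {V : Type*} [AddCommGroup V] [Module ℝ V] {gr : ℤ → Submodule ℝ V}

/-- The operator acting on the homogeneous piece of degree `p` as multiplication by `p`. -/
noncomputable def degreeOp (h : DirectSum.IsInternal gr) : V →ₗ[ℝ] V :=
  gradedLift h fun p => (p : ℝ) • (gr p).subtype

theorem degreeOp_apply (h : DirectSum.IsInternal gr) {p : ℤ} {x : V} (hx : x ∈ gr p) :
    degreeOp h x = (p : ℝ) • x := by
  rw [degreeOp, gradedLift_apply h _ hx]; rfl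

/-- The eigenspaces of the degree operator are the homogeneous pieces. -/
theorem mem_of_degreeOp_eq (h : DirectSum.IsInternal gr) {p : ℤ} {x : V}
    (hx : degreeOp h x = (p : ℝ) • x) : x ∈ gr p := by
  let P : V →ₗ[ℝ] V := gradedLift h fun r => if r = p then (gr r).subtype else 0
  -- the inverse of `degreeOp - p` on the sum of the pieces of degree different from `p`
  let T : V →ₗ[ℝ] V := gradedLift h fun r =>
    if r = p then 0 else ((r : ℝ) - p)⁻¹ • (gr r).subtype
  have hP : ∀ x, P x ∈ gr p := graded_induction h (by simp)
    (fun x y hx hy => by rw [map_add]; exact add_mem hx hy) fun r x hx => by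
      simp only [P]
      rw [gradedLift_apply h _ hx]
      split_ifs with hr
      · exact hr ▸ hx
      · simp
  have hT : ∀ x, x = P x + T (degreeOp h x - (p : ℝ) • x) := graded_induction h (by simp)
    (fun x y hx hy => by
      conv_lhs => rw [hx, hy]
      simp only [map_add, map_sub, map_smul, smul_add]
      abel) fun r x hx => by
      rw [degreeOp_apply h hx, ← sub_smul, map_smul]
      simp only [P, T]
      rw [gradedLift_apply h _ hx, gradedLift_apply h _ hx]
      split_ifs with hr
      · simp
      · have : (r : ℝ) - p ≠ 0 := sub_ne_zero.2 (by exact_mod_cast hr)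
        simp [smul_smul, mul_inv_cancel₀ this]
  rw [hT x, hx, sub_self, map_zero, add_zero]
  exact hP x

/-- The eigenvalues of the degree operator are degrees. -/
theorem exists_mem_of_degreeOp_eq (h : DirectSum.IsInternal gr) {μ : ℝ} {x : V} (hx0 : x ≠ 0)
    (hx : degreeOp h x = μ • x) : ∃ p, x ∈ gr p := by
  by_cases hμ : ∃ p : ℤ, (p : ℝ) = μ
  · obtain ⟨p, rfl⟩ := hμ
    exact ⟨p, mem_of_degreeOp_eq h hx⟩
  · push Not at hμ
    let T : V →ₗ[ℝ] V := gradedLift h fun r => ((r : ℝ) - μ)⁻¹ • (gr r).subtype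
    have hT : ∀ x, x = T (degreeOp h x - μ • x) := graded_induction h (by simp)
      (fun x y hx hy => by
        conv_lhs => rw [hx, hy]
        simp only [map_add, map_sub, map_smul, smul_add]
        abel) fun r x hx => by
        rw [degreeOp_apply h hx, ← sub_smul, map_smul]
        simp only [T]
        rw [gradedLift_apply h _ hx]
        simp [smul_smul, mul_inv_cancel₀ (sub_ne_zero.2 (hμ r))]
    exact absurd (by rw [hT x, hx, sub_self, map_zero]) hx0

/-- A nonzero subspace stable under the degree operator contains a nonzero homogeneous element. -/
theorem exists_homogeneous_mem [FiniteDimensional ℝ V] (h : DirectSum.IsInternal gr)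
    {W : Submodule ℝ V} (hW : ∀ x ∈ W, degreeOp h x ∈ W) (hW0 : W ≠ ⊥) :
    ∃ p, ∃ x ∈ gr p, x ∈ W ∧ x ≠ 0 := by
  have htop : ⨆ μ : ℝ, Module.End.genEigenspace (degreeOp h) μ 1 = ⊤ := by
    rw [eq_top_iff, ← h.submodule_iSup_eq_top]
    refine iSup_le fun p => le_iSup_of_le (p : ℝ) fun x hx => ?_
    exact Module.End.mem_eigenspace_iff.2 (degreeOp_apply h hx)
  have h1 := Submodule.eq_iSup_inf_genEigenspace 1 hW htop
  by_contra hne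
  push Not at hne
  refine hW0 (h1.trans (iSup_eq_bot.2 fun μ => (Submodule.eq_bot_iff _).2 fun x hx => ?_))
  by_contra hx0
  obtain ⟨p, hp⟩ := exists_mem_of_degreeOp_eq h hx0 (Module.End.mem_eigenspace_iff.1 hx.2)
  exact hx0 (hne p x hp hx.1)

theorem finite_setOf_gr_ne_bot [FiniteDimensional ℝ V] (h : DirectSum.IsInternal gr) :
    {p | gr p ≠ ⊥}.Finite :=
  WellFoundedGT.finite_ne_bot_of_iSupIndep h.submodule_iSupIndep

theorem exists_bound_of_gr_ne_bot [FiniteDimensional ℝ V] (h : DirectSum.IsInternal gr) :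
    ∃ μ : ℤ, ∀ p < μ, gr p = ⊥ := by
  obtain ⟨μ, hμ⟩ := (finite_setOf_gr_ne_bot h).bddBelow
  exact ⟨μ, fun p hp => by by_contra hne; exact absurd (hμ hne) (not_le.2 hp)⟩

/-- The trace of an operator `F` of degree `0`, weighted by the degree. -/
theorem trace_degreeOp_comp [FiniteDimensional ℝ V] (h : DirectSum.IsInternal gr)
    (F : V →ₗ[ℝ] V) (hF : ∀ p, Set.MapsTo F (gr p) (gr p)) :
    LinearMap.trace ℝ V (degreeOp h ∘ₗ F) = ∑ p ∈ (finite_setOf_gr_ne_bot h).toFinset,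
      (p : ℝ) * LinearMap.trace ℝ (gr p) (F.restrict (hF p)) := by
  have hD : ∀ p, Set.MapsTo (degreeOp h ∘ₗ F) (gr p) (gr p) := fun p x hx => by
    rw [LinearMap.comp_apply, degreeOp_apply h (hF p hx)]
    exact (gr p).smul_mem _ (hF p hx)
  rw [LinearMap.trace_eq_sum_trace_restrict' h (finite_setOf_gr_ne_bot h) hD]
  refine Finset.sum_congr rfl fun p _ => ?_
  have : (degreeOp h ∘ₗ F).restrict (hD p) = (p : ℝ) • F.restrict (hF p) :=
    LinearMap.ext fun x => Subtype.ext (degreeOp_apply h (hF p x.2))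
  rw [this, map_smul, smul_eq_mul]

end DegreeOperator

/-- An operator whose square is a negative scalar has trace zero: it is skew with respect to a
scalar product. -/
theorem trace_eq_zero_of_sq {V : Type*} [AddCommGroup V] [Module ℝ V] [FiniteDimensional ℝ V]
    (F : V →ₗ[ℝ] V) {c : ℝ} (hc : c < 0) (hF : ∀ x, F (F x) = c • x) :
    LinearMap.trace ℝ V F = 0 := by
  classical
  let b := Module.finBasis ℝ V
  rw [LinearMap.trace_eq_matrix_trace ℝ b]
  set A := LinearMap.toMatrix b b F with hA
  have hAA : A * A = c • (1 : Matrix _ _ ℝ) := by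
    rw [hA, ← LinearMap.toMatrix_comp, ← LinearMap.toMatrix_id b, ← map_smul]
    congr 1
    exact LinearMap.ext hF
  -- the Gram matrix of a scalar product for which `F` is skew
  let Q : Matrix _ _ ℝ := (-c) • (1 : Matrix _ _ ℝ) + A.transpose * A
  have hQ : IsUnit Q := by
    refine Matrix.PosDef.isUnit (Matrix.PosDef.add_posSemidef
      (Matrix.PosDef.smul Matrix.PosDef.one (neg_pos.2 hc)) ?_)
    have := Matrix.posSemidef_conjTranspose_mul_self A
    rwa [Matrix.conjTranspose_eq_transpose_of_trivial] at this
  have hskew : A.transpose * Q = -(Q * A) := by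
    have h1 : A.transpose * (A.transpose * A) = c • A := by
      rw [← mul_assoc, ← Matrix.transpose_mul, hAA]; simp
    have h2 : A.transpose * A * A = c • A.transpose := by
      rw [mul_assoc, hAA]; simp
    simp only [Q, mul_add, add_mul, h1, h2]
    simp
  obtain ⟨u, hu⟩ := hQ
  have h1 : A.transpose = -(Q * A * (u⁻¹).val) := by
    rw [← neg_mul, ← hskew, ← hu, Units.mul_inv_cancel_right]
  have h2 : A.trace = -A.trace := by
    conv_lhs => rw [← Matrix.trace_transpose, h1, Matrix.trace_neg, Matrix.trace_mul_comm,
      ← hu, Units.inv_mul_cancel_left]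
  linarith

section Commutant

variable {s : Type*} [LieRing s] [LieAlgebra ℝ s]
variable {l : Type*} [AddCommGroup l] [Module ℝ l] [LieRingModule s l] [LieModule ℝ s l]

theorem mem_commutant_iff {φ : Module.End ℝ l} :
    φ ∈ commutant s l ↔ ∀ (x : s) (m : l), φ ⁅x, m⁆ = ⁅x, φ m⁆ := by
  rw [commutant, Subalgebra.mem_centralizer_iff]
  constructor
  · intro h x m
    exact (LinearMap.congr_fun (h _ ⟨x, rfl⟩) m).symm
  · rintro h _ ⟨x, rfl⟩
    exact LinearMap.ext fun m => (h x m).symm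

/-- Schur's lemma. -/
theorem eq_zero_or_injective_of_mem_commutant (hirr : LieModule.IsIrreducible ℝ s l)
    {φ : Module.End ℝ l} (hφ : φ ∈ commutant s l) : φ = 0 ∨ Function.Injective φ := by
  rw [mem_commutant_iff] at hφ
  let N : LieSubmodule ℝ s l :=
    { LinearMap.ker φ with
      lie_mem := fun {x m} hm => by
        change φ ⁅x, m⁆ = 0
        rw [hφ, show φ m = 0 from hm, lie_zero] }
  rcases eq_bot_or_eq_top N with h | h
  · right
    rw [← LinearMap.ker_eq_bot]
    exact (LieSubmodule.toSubmodule_eq_bot N).2 h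
  · left
    exact LinearMap.ext fun m => (h ▸ LieSubmodule.mem_top m : m ∈ N)

/-- An element of the commutant of an irreducible module is a real scalar, or becomes a square root
of a negative scalar after subtraction of a real scalar: by Schur's lemma it is a root of an
irreducible real polynomial, which has degree at most two. -/
theorem exists_sub_sq_of_mem_commutant [FiniteDimensional ℝ l]
    (hirr : LieModule.IsIrreducible ℝ s l) {φ : Module.End ℝ l} (hφ : φ ∈ commutant s l) :
    (∃ c : ℝ, φ = c • 1) ∨ ∃ c d : ℝ, d < 0 ∧ (φ - c • 1) * (φ - c • 1) = d • 1 := by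
  open Polynomial in
  have hnt : Nontrivial l := LieModule.nontrivial_of_isIrreducible ℝ s l
  have hinj0 : ¬ Function.Injective (0 : Module.End ℝ l) := fun h => by
    obtain ⟨m, hm⟩ := exists_ne (0 : l)
    exact hm (h rfl)
  have hint : IsIntegral ℝ φ := Algebra.IsIntegral.isIntegral φ
  have haeval : ∀ p : ℝ[X], aeval φ p ∈ commutant s l := fun p =>
    (Subalgebra.mem_carrier).1 (by
      have := aeval_mem_adjoin_singleton ℝ φ (p := p)
      exact (Algebra.adjoin_le (Set.singleton_subset_iff.2 hφ)) this)
  obtain ⟨q, hq, r, hr⟩ := WfDvdMonoid.exists_irreducible_factor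
    (minpoly.not_isUnit ℝ φ) (minpoly.ne_zero hint)
  have hq0 : aeval φ q = 0 := by
    refine (eq_zero_or_injective_of_mem_commutant hirr (haeval q)).resolve_right fun hinj => ?_
    have hr0 : r ≠ 0 := fun h => minpoly.ne_zero hint (by rw [hr, h, mul_zero])
    have h1 : aeval φ r = 0 := by
      have h2 : aeval φ q * aeval φ r = 0 := by rw [← map_mul, ← hr, minpoly.aeval]
      exact LinearMap.ext fun m => hinj (by
        rw [← Module.End.mul_apply, h2]; simp)
    have h3 := minpoly.degree_le_of_ne_zero ℝ φ hr0 h1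
    have hdeg : (minpoly ℝ φ).degree = q.degree + r.degree := by rw [hr, degree_mul]
    have hqd : 0 < q.degree := degree_pos_of_irreducible hq
    rw [hdeg, degree_eq_natDegree hr0, degree_eq_natDegree hq.ne_zero] at h3
    rw [degree_eq_natDegree hq.ne_zero] at hqd
    norm_cast at h3 hqd
    omega
  have hquad := eq_quadratic_of_degree_le_two hq.degree_le_two
  set a := q.coeff 2
  set b := q.coeff 1
  set c := q.coeff 0
  have h1 : a • (φ * φ) + b • φ + c • (1 : Module.End ℝ l) = 0 := by
    rw [hquad] at hq0
    simpa [Algebra.smul_def, pow_two] using hq0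
  by_cases ha : a = 0
  · left
    by_cases hb : b = 0
    · exfalso
      rw [ha, hb, zero_smul, zero_smul, zero_add, zero_add] at h1
      have hc : c = 0 := (smul_eq_zero.1 h1).resolve_right one_ne_zero
      exact hq.ne_zero (by rw [hquad, ha, hb, hc]; simp)
    · refine ⟨-(b⁻¹ * c), ?_⟩
      rw [ha, zero_smul, zero_add] at h1
      rw [neg_smul, eq_neg_iff_add_eq_zero, ← smul_right_injective _ hb |>.eq_iff, smul_add,
        smul_smul, mul_inv_cancel_left₀ hb, h1, smul_zero]
  · set t : ℝ := -(b / (2 * a)) with ht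
    set d : ℝ := (b ^ 2 - 4 * a * c) / (4 * a ^ 2) with hd
    have h2 : (φ - t • 1) * (φ - t • 1) = d • (1 : Module.End ℝ l) := by
      have h3 : φ * φ = -(a⁻¹ • (b • φ + c • (1 : Module.End ℝ l))) := by
        rw [eq_neg_iff_add_eq_zero, ← smul_right_injective _ ha |>.eq_iff, smul_add, smul_smul,
          mul_inv_cancel₀ ha, one_smul, ← add_assoc, h1, smul_zero]
      simp only [sub_mul, mul_sub, smul_mul_assoc, mul_smul_comm, one_mul, mul_one, h3, ht, hd]
      match_scalars <;> field_simp <;> ring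
    by_cases hdneg : d < 0
    · exact Or.inr ⟨t, d, hdneg, h2⟩
    · left
      push Not at hdneg
      have h3 : (φ - t • 1 - (√d) • 1) * (φ - t • 1 + (√d) • (1 : Module.End ℝ l)) = 0 := by
        rw [sub_mul, mul_add, mul_add, h2]
        simp only [smul_mul_assoc, mul_smul_comm, one_mul, mul_one, smul_smul,
          Real.mul_self_sqrt hdneg]
        abel
      have hmem : ∀ u : ℝ, φ - u • 1 ∈ commutant s l := fun u =>
        sub_mem hφ ((commutant s l).smul_mem (one_mem _) u)
      rcases eq_zero_or_injective_of_mem_commutant hirr (hmem (t + √d)) with h4 | h4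
      · exact ⟨_, sub_eq_zero.1 h4⟩
      · refine ⟨t - √d, sub_eq_zero.1 (LinearMap.ext fun m => h4 ?_)⟩
        have h5 := LinearMap.congr_fun h3 m
        rw [LinearMap.zero_apply, map_zero, ← Module.End.mul_apply]
        rw [add_smul, sub_smul, ← sub_sub, sub_sub_eq_add_sub, add_sub_right_comm]
        exact h5

end Commutant

section GradingElement

variable {s : Type*} [LieRing s] [LieAlgebra ℝ s]

namespace GradedCRModule

variable {S : GradedCRAlgebra s}
variable {l : Type*} [AddCommGroup l] [Module ℝ l] [LieRingModule s l] [LieModule ℝ s l]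

/-- The commutant is complex linear in degree `-1`, by nondegeneracy. -/
theorem J_apply_of_mem_commutant {M : GradedCRModule S l} (hnd : IsNondegenerate S.gr M.gr)
    {φ : Module.End ℝ l} (hφ : φ ∈ commutant s l) (Y Z : M.gr (-1)) (hZ : (Z : l) = φ Y)
    (hφJ : φ (M.J Y) ∈ M.gr (-1)) : (M.J Z : l) = φ (M.J Y) := by
  rw [mem_commutant_iff] at hφ
  rw [← sub_eq_zero]
  refine hnd _ (sub_mem (M.J Z).2 hφJ) fun X hX => ?_
  have hX' : X = S.J (-S.J ⟨X, hX⟩) := by rw [map_neg, S.J_sq]; simp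
  rw [hX', lie_sub, M.J_lie, hZ, ← hφ, ← hφ, M.J_lie, sub_self]

end GradedCRModule

variable [FiniteDimensional ℝ s]

/-- A semisimple Lie algebra is perfect, so its elements act with trace zero, even after composition
with an equivariant map. -/
theorem trace_toEnd_comp_eq_zero [LieAlgebra.IsKilling ℝ s] {W : Type*} [AddCommGroup W]
    [Module ℝ W] [LieRingModule s W] [LieModule ℝ s W] (F : W →ₗ[ℝ] W)
    (hF : ∀ (x : s) (m : W), F ⁅x, m⁆ = ⁅x, F m⁆) (x : s) :
    LinearMap.trace ℝ W (LieModule.toEnd ℝ s W x ∘ₗ F) = 0 := by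
  have hx : x ∈ Submodule.span ℝ {z : s | ∃ x y : s, ⁅x, y⁆ = z} := by
    rw [span_lie_eq_top]; trivial
  induction hx using Submodule.span_induction with
  | mem x hx =>
    obtain ⟨y, z, rfl⟩ := hx
    have h1 : LieModule.toEnd ℝ s W ⁅y, z⁆ ∘ₗ F
        = LieModule.toEnd ℝ s W y * (LieModule.toEnd ℝ s W z * F)
          - (LieModule.toEnd ℝ s W z * F) * LieModule.toEnd ℝ s W y :=
      LinearMap.ext fun m => by simp [hF]
    rw [h1, map_sub, LinearMap.trace_mul_comm, sub_self]
  | zero => simp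
  | add u v _ _ hu hv => rw [map_add, LinearMap.add_comp, map_add, hu, hv, add_zero]
  | smul c u _ hu => rw [map_smul, LinearMap.smul_comp, map_smul, hu, smul_zero]

namespace GradedCRAlgebra

/-- The gradation of a semisimple graded Lie algebra is defined by an inner derivation. -/
theorem exists_gradingElement [LieAlgebra.IsKilling ℝ s] (S : GradedCRAlgebra s) :
    ∃ E ∈ S.gr 0, ∀ p, ∀ X ∈ S.gr p, ⁅E, X⁆ = (p : ℝ) • X := by
  let D : LieDerivation ℝ s s :=
    { degreeOp S.isInternal with
      leibniz' := by
        change ∀ a b, degreeOp S.isInternal ⁅a, b⁆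
          = ⁅a, degreeOp S.isInternal b⁆ - ⁅b, degreeOp S.isInternal a⁆
        intro a b
        refine graded_induction S.isInternal (P := fun a => degreeOp S.isInternal ⁅a, b⁆
          = ⁅a, degreeOp S.isInternal b⁆ - ⁅b, degreeOp S.isInternal a⁆) (by simp)
          (fun x y hx hy => by simp only [add_lie, map_add, hx, hy, lie_add]; abel)
          (fun p a ha => ?_) a
        refine graded_induction S.isInternal (P := fun b => degreeOp S.isInternal ⁅a, b⁆
          = ⁅a, degreeOp S.isInternal b⁆ - ⁅b, degreeOp S.isInternal a⁆) (by simp)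
          (fun x y hx hy => by simp only [add_lie, map_add, hx, hy, lie_add]; abel)
          (fun q b hb => ?_) b
        rw [degreeOp_apply _ (S.lie_mem ha hb), degreeOp_apply _ ha, degreeOp_apply _ hb, lie_smul,
          lie_smul, ← lie_skew a b, smul_neg, smul_neg, Int.cast_add, add_smul]
        abel }
  obtain ⟨E, hE⟩ := LieDerivation.IsKilling.exists_eq_ad D
  have h1 : ∀ X, ⁅E, X⁆ = degreeOp S.isInternal X := fun X => by
    have h : LieDerivation.ad ℝ s E X = D X := congrArg (fun F : LieDerivation ℝ s s => F X) hE
    rwa [LieDerivation.ad_apply_apply] at h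
  refine ⟨E, mem_of_degreeOp_eq S.isInternal ?_, fun p X hX => by
    rw [h1, degreeOp_apply _ hX]⟩
  rw [← h1, lie_self]; simp

end GradedCRAlgebra

namespace GradedCRModule

variable {S : GradedCRAlgebra s}
variable {l : Type*} [AddCommGroup l] [Module ℝ l] [LieRingModule s l] [LieModule ℝ s l]
variable (M : GradedCRModule S l)

/-- On an irreducible graded module the grading element acts as the degree up to a scalar. By
Schur's lemma the only alternative is a nonreal difference, which is excluded by traces. -/
theorem exists_shift [LieAlgebra.IsKilling ℝ s] [FiniteDimensional ℝ l]
    (hirr : LieModule.IsIrreducible ℝ s l) {E : s} (hE0 : E ∈ S.gr 0)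
    (hE : ∀ p, ∀ X ∈ S.gr p, ⁅E, X⁆ = (p : ℝ) • X) :
    ∃ c : ℝ, ∀ Y : l, degreeOp M.isInternal Y = ⁅E, Y⁆ + c • Y := by
  set δ := degreeOp M.isInternal with hδ
  let ψ : Module.End ℝ l := δ - LieModule.toEnd ℝ s l E
  have hψapp : ∀ Y, ψ Y = δ Y - ⁅E, Y⁆ := fun _ => rfl
  have hψ : ψ ∈ commutant s l := by
    rw [mem_commutant_iff]
    intro X Y
    refine graded_induction S.isInternal (P := fun X => ψ ⁅X, Y⁆ = ⁅X, ψ Y⁆) (by simp)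
      (fun X X' h h' => by rw [add_lie, map_add, h, h', add_lie]) (fun q X hX => ?_) X
    refine graded_induction M.isInternal (P := fun Y => ψ ⁅X, Y⁆ = ⁅X, ψ Y⁆) (by simp)
      (fun Y Y' h h' => by rw [lie_add, map_add, h, h', map_add, lie_add]) (fun p Y hY => ?_) Y
    rw [hψapp, hψapp, hδ, degreeOp_apply _ (M.lie_mem hX hY), degreeOp_apply _ hY, leibniz_lie,
      hE q X hX, lie_sub, lie_smul, smul_lie, Int.cast_add, add_smul]
    abel
  have hψgr : ∀ p, ∀ Y ∈ M.gr p, ψ Y ∈ M.gr p := fun p Y hY => by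
    rw [hψapp, hδ, degreeOp_apply _ hY]
    exact sub_mem ((M.gr p).smul_mem _ hY) (by simpa using M.lie_mem hE0 hY)
  rcases exists_sub_sq_of_mem_commutant hirr hψ with ⟨c, hc⟩ | ⟨c, d, hd, hsq⟩
  · refine ⟨c, fun Y => ?_⟩
    have := LinearMap.congr_fun hc Y
    rw [hψapp] at this
    rw [sub_eq_iff_eq_add.1 this, add_comm]; rfl
  · -- the trace of `ad E` composed with a complex structure would be nonzero
    exfalso
    let F : Module.End ℝ l := ψ - c • 1
    have hFF : ∀ Y, F (F Y) = d • Y := fun Y => LinearMap.congr_fun hsq Y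
    have hFc : ∀ (x : s) (m : l), F ⁅x, m⁆ = ⁅x, F m⁆ :=
      mem_commutant_iff.1 (sub_mem hψ ((commutant s l).smul_mem (one_mem _) c))
    have hFgr : ∀ p, Set.MapsTo F (M.gr p) (M.gr p) := fun p Y hY =>
      sub_mem (hψgr p Y hY) ((M.gr p).smul_mem c hY)
    have h1 := trace_toEnd_comp_eq_zero F hFc E
    have h2 : LieModule.toEnd ℝ s l E ∘ₗ F = δ ∘ₗ F - c • F - d • LinearMap.id := by
      ext Y
      have h3 : ⁅E, F Y⁆ = δ (F Y) - ψ (F Y) := by rw [hψapp, sub_sub_cancel]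
      have h4 : ψ (F Y) = d • Y + c • F Y := by
        rw [← hFF]; simp [F]
      simp only [LinearMap.comp_apply, LieModule.toEnd_apply_apply, LinearMap.sub_apply,
        LinearMap.smul_apply, LinearMap.id_apply]
      rw [h3, h4]; abel
    have h3 : LinearMap.trace ℝ l (δ ∘ₗ F) = 0 := by
      rw [hδ, trace_degreeOp_comp M.isInternal F hFgr]
      refine Finset.sum_eq_zero fun p _ => ?_
      rw [trace_eq_zero_of_sq (F.restrict (hFgr p)) hd fun x => Subtype.ext (hFF x), mul_zero]
    rw [h2, map_sub, map_sub, h3, map_smul, trace_eq_zero_of_sq F hd hFF, map_smul,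
      LinearMap.trace_id] at h1
    have hnt : Nontrivial l := LieModule.nontrivial_of_isIrreducible ℝ s l
    have h5 : (0 : ℝ) < Module.finrank ℝ l := by exact_mod_cast Module.finrank_pos
    simp only [smul_eq_mul] at h1
    nlinarith

variable {M} in
/-- The endomorphisms of an irreducible graded module commute with the grading element, hence
preserve the degree. -/
theorem mem_gr_of_mem_commutant [LieAlgebra.IsKilling ℝ s] [FiniteDimensional ℝ l]
    (hirr : LieModule.IsIrreducible ℝ s l) {φ : Module.End ℝ l} (hφ : φ ∈ commutant s l) {p : ℤ}
    {Y : l} (hY : Y ∈ M.gr p) : φ Y ∈ M.gr p := by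
  obtain ⟨E, hE0, hE⟩ := S.exists_gradingElement
  obtain ⟨c, hc⟩ := M.exists_shift hirr hE0 hE
  refine mem_of_degreeOp_eq M.isInternal ?_
  rw [hc, ← mem_commutant_iff.1 hφ, ← map_smul, ← map_add, ← hc, degreeOp_apply _ hY, map_smul]

end GradedCRModule

end GradingElement

end LeviTanaka

/-! ### The Levi–Tanaka extension: embedding and degree operator -/

namespace LeviTanaka

instance AbelianExt.instFiniteDimensional {s l : Type*} [AddCommGroup s] [Module ℝ s]
    [AddCommGroup l] [Module ℝ l] [FiniteDimensional ℝ s] [FiniteDimensional ℝ l] :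
    FiniteDimensional ℝ (AbelianExt s l) :=
  inferInstanceAs (Module.Finite ℝ (s × l))

section Components

variable {s l : Type*} [AddCommGroup s] [Module ℝ s] [AddCommGroup l] [Module ℝ l]

@[simp] theorem AbelianExt.inl_fst (X : s) : (inl X : AbelianExt s l).1 = X := rfl

@[simp] theorem AbelianExt.inl_snd (X : s) : (inl X : AbelianExt s l).2 = 0 := rfl

@[simp] theorem AbelianExt.inr_fst (Y : l) : (inr Y : AbelianExt s l).1 = 0 := rfl

@[simp] theorem AbelianExt.inr_snd (Y : l) : (inr Y : AbelianExt s l).2 = Y := rfl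

end Components

/-- The induction on the degree in which the negative degrees are known. -/
theorem int_induction_of_neg {P : ℤ → Prop} (hneg : ∀ p < 0, P p)
    (hstep : ∀ p, 0 ≤ p → P (p - 1) → P p) (p : ℤ) : P p := by
  have h : ∀ n : ℕ, ∀ p < (n : ℤ), P p := fun n => by
    induction n with
    | zero => simpa using hneg
    | succ n ih =>
      intro p hp
      rcases lt_or_ge p 0 with h | h
      · exact hneg p h
      · exact hstep p h (ih (p - 1) (by push_cast at hp; omega))
  exact h (p.toNat + 1) p (by push_cast; have := Int.self_le_toNat p; omega)

/-- Let `f` be a graded homomorphism whose image contains the piece of degree `-1` of a transitive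
target. A derivation of degree `0` along `f` vanishes as soon as it vanishes on the negative
part. -/
theorem GradedCRAlgebra.derivation_eq_zero {h g : Type*} [LieRing h] [LieAlgebra ℝ h] [LieRing g]
    [LieAlgebra ℝ g] {H : GradedCRAlgebra h} {G : GradedCRAlgebra g} (ht : G.Transitive)
    (f : h →ₗ⁅ℝ⁆ g) (hf : ∀ x ∈ G.gr (-1), ∃ X ∈ H.gr (-1), f X = x) (d : h →ₗ[ℝ] g)
    (hgr : ∀ p, ∀ x ∈ H.gr p, d x ∈ G.gr p) (hd : ∀ x y, d ⁅x, y⁆ = ⁅d x, f y⁆ + ⁅f x, d y⁆)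
    (hneg : ∀ p < 0, ∀ x ∈ H.gr p, d x = 0) : d = 0 := by
  refine LinearMap.ext fun x => graded_induction H.isInternal (P := fun x => d x = 0) (by simp)
    (fun x y hx hy => by rw [map_add, hx, hy, add_zero]) (fun p => ?_) x
  refine int_induction_of_neg (P := fun p => ∀ x ∈ H.gr p, d x = 0) hneg (fun p hp ih x hx => ?_) p
  refine ht p hp _ (hgr p x hx) fun z hz => ?_
  obtain ⟨X, hX, rfl⟩ := hf z hz
  have h1 := hd X x
  rw [ih _ (by rw [sub_eq_neg_add]; exact H.lie_mem hX hx), hneg (-1) (by norm_num) X hX, zero_lie,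
    zero_add] at h1
  exact h1.symm

section Extension

variable {s : Type*} [LieRing s] [LieAlgebra ℝ s]
variable {l : Type*} [AddCommGroup l] [Module ℝ l] [LieRingModule s l] [LieModule ℝ s l]
variable {g : Type*} [LieRing g] [LieAlgebra ℝ g]

/-- The restriction to `s` of a homomorphism defined on `s ⊕ l`. -/
def algMap (ι : AbelianExt s l →ₗ⁅ℝ⁆ g) : s →ₗ⁅ℝ⁆ g :=
  { ι.toLinearMap ∘ₗ AbelianExt.inl with
    map_lie' := fun {x y} => by
      change ι (AbelianExt.inl ⁅x, y⁆) = ⁅ι (AbelianExt.inl x), ι (AbelianExt.inl y)⁆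
      rw [← LieHom.map_lie]
      congr 1
      exact Prod.ext rfl (by simp) }

/-- The restriction to `l` of a homomorphism defined on `s ⊕ l`. -/
def modMap (ι : AbelianExt s l →ₗ⁅ℝ⁆ g) : l →ₗ[ℝ] g := ι.toLinearMap ∘ₗ AbelianExt.inr

variable {ι : AbelianExt s l →ₗ⁅ℝ⁆ g}

theorem algMap_apply (X : s) : algMap ι X = ι (AbelianExt.inl X) := rfl

theorem modMap_apply (Y : l) : modMap ι Y = ι (AbelianExt.inr Y) := rfl

theorem map_eq_add (x : AbelianExt s l) : ι x = algMap ι x.1 + modMap ι x.2 := by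
  rw [algMap_apply, modMap_apply, ← map_add]
  congr 1
  exact Prod.ext (add_zero _).symm (zero_add _).symm

theorem lie_algMap_modMap (X : s) (Y : l) : ⁅algMap ι X, modMap ι Y⁆ = modMap ι ⁅X, Y⁆ := by
  simp only [algMap_apply, modMap_apply, ← LieHom.map_lie]
  congr 1
  exact Prod.ext (by simp) (by simp)

theorem lie_modMap_algMap (X : s) (Y : l) : ⁅modMap ι Y, algMap ι X⁆ = -modMap ι ⁅X, Y⁆ := by
  rw [← lie_skew, lie_algMap_modMap]

theorem lie_modMap_modMap (Y Z : l) : ⁅modMap ι Y, modMap ι Z⁆ = 0 := by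
  simp only [modMap_apply, ← LieHom.map_lie]
  rw [← map_zero ι]
  congr 1
  exact Prod.ext (by simp) (by simp)

theorem modMap_injective (hι : Function.Injective ι) : Function.Injective (modMap ι) :=
  fun Y Z h => congrArg Prod.snd (hι h : AbelianExt.inr (s := s) Y = AbelianExt.inr Z)

theorem algMap_injective (hι : Function.Injective ι) : Function.Injective (algMap ι) :=
  fun X Z h => congrArg Prod.fst (hι h : AbelianExt.inl (l := l) X = AbelianExt.inl Z)

namespace IsLeviTanakaExtension

variable {S : GradedCRAlgebra s} {M : GradedCRModule S l} {G : GradedCRAlgebra g}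

theorem algMap_mem (hG : IsLeviTanakaExtension M G ι) {p : ℤ} {X : s} (hX : X ∈ S.gr p) :
    algMap ι X ∈ G.gr p :=
  hG.map_mem p _ ⟨hX, zero_mem _⟩

theorem modMap_mem (hG : IsLeviTanakaExtension M G ι) {p : ℤ} {Y : l} (hY : Y ∈ M.gr p) :
    modMap ι Y ∈ G.gr p :=
  hG.map_mem p _ ⟨zero_mem _, hY⟩

theorem exists_of_neg (hG : IsLeviTanakaExtension M G ι) {p : ℤ} (hp : p < 0) {x : g}
    (hx : x ∈ G.gr p) : ∃ y ∈ M.ext.gr p, ι y = x :=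
  (hG.bijOn_neg p hp).surjOn hx

theorem exists_add_of_neg (hG : IsLeviTanakaExtension M G ι) {p : ℤ} (hp : p < 0) {x : g}
    (hx : x ∈ G.gr p) : ∃ X ∈ S.gr p, ∃ Y ∈ M.gr p, x = algMap ι X + modMap ι Y := by
  obtain ⟨y, hy, rfl⟩ := hG.exists_of_neg hp hx
  exact ⟨y.1, hy.1, y.2, hy.2, map_eq_add y⟩

theorem eq_zero_of_lie_eq_zero (hG : IsLeviTanakaExtension M G ι) {p : ℤ} (hp : -1 ≤ p) {z : g}
    (hz : z ∈ G.gr p) (hs : ∀ X ∈ S.gr (-1), ⁅algMap ι X, z⁆ = 0)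
    (hl : ∀ Y ∈ M.gr (-1), ⁅modMap ι Y, z⁆ = 0) : z = 0 := by
  refine GradedCRAlgebra.eq_zero_of_lie_eq_zero hG.leviTanaka.transitive
    hG.leviTanaka.nondegenerate hp hz fun x hx => ?_
  obtain ⟨X, hX, Y, hY, rfl⟩ := hG.exists_add_of_neg (by norm_num) hx
  rw [add_lie, hs X hX, hl Y hY, add_zero]

/-- `s ⊕ l` embeds in its Levi–Tanaka extension: the kernel of `ι` is graded, and its elements of
least nonnegative degree would be killed by `s_{-1}`. -/
theorem injective [FiniteDimensional ℝ s] [FiniteDimensional ℝ l]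
    (hG : IsLeviTanakaExtension M G ι) (hS : S.Transitive) : Function.Injective ι := by
  have hdeg : ∀ x, ι (degreeOp M.ext.isInternal x) = degreeOp G.isInternal (ι x) :=
    graded_induction M.ext.isInternal (by simp)
      (fun x y hx hy => by simp only [map_add, hx, hy]) fun p x hx => by
        rw [degreeOp_apply _ hx, degreeOp_apply _ (hG.map_mem p x hx), map_smul]
  have hhom : ∀ p, ∀ x ∈ M.ext.gr p, ι x = 0 → x = 0 := by
    refine int_induction_of_neg (fun p hp x hx h => ?_) fun p hp ih x hx h => ?_
    · exact (hG.bijOn_neg p hp).injOn hx (zero_mem _) (h.trans (map_zero ι).symm)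
    · have h1 : ∀ X ∈ S.gr (-1), ⁅(AbelianExt.inl X : AbelianExt s l), x⁆ = 0 := fun X hX => by
        refine ih _ ?_ (by rw [LieHom.map_lie, h, lie_zero])
        rw [sub_eq_neg_add]
        exact M.ext.lie_mem ⟨hX, zero_mem _⟩ hx
      refine Prod.ext (hS p hp _ hx.1 fun X hX => congrArg Prod.fst (h1 X hX))
        (hG.transitive p hp _ hx.2 fun X hX => ?_)
      have h2 := congrArg Prod.snd (h1 X hX)
      simpa using h2
  have hker : LinearMap.ker ι.toLinearMap = ⊥ := by
    by_contra hne
    obtain ⟨p, x, hx, hx', hx0⟩ := exists_homogeneous_mem M.ext.isInternal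
      (W := LinearMap.ker ι.toLinearMap) (fun x (hx : ι x = 0) => by
        change ι _ = 0
        rw [hdeg, hx, map_zero]) hne
    exact hx0 (hhom p x hx hx')
  exact LinearMap.ker_eq_bot.1 hker

theorem finiteDimensional [FiniteDimensional ℝ s] [FiniteDimensional ℝ l]
    (hG : IsLeviTanakaExtension M G ι) : FiniteDimensional ℝ g := by
  have hmap : ∀ p < 0, G.gr p = (M.ext.gr p).map ι.toLinearMap := fun p hp =>
    SetLike.coe_injective (hG.bijOn_neg p hp).image_eq.symm
  obtain ⟨μ, hμ⟩ := exists_bound_of_gr_ne_bot M.ext.isInternal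
  refine GradedCRAlgebra.finiteDimensional_of_negative hG.leviTanaka.transitive
    hG.leviTanaka.fundamental hG.leviTanaka.nondegenerate (fun p hp => ?_) (μ := min μ 0)
    fun p hp => ?_
  · rw [hmap p hp]
    infer_instance
  · rw [hmap p (hp.trans_le (min_le_right _ _)), hμ p (hp.trans_le (min_le_left _ _)),
      Submodule.map_bot]

/-- Every endomorphism of the module `l` extends by zero on `s` to a derivation of `s ⊕ l`, which by
maximality is realized by an element of degree `0`. -/
theorem exists_realization [FiniteDimensional ℝ s] [LieAlgebra.IsKilling ℝ s]
    [FiniteDimensional ℝ l] (hG : IsLeviTanakaExtension M G ι) (hS : S.Transitive)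
    (hirr : LieModule.IsIrreducible ℝ s l) (hnd : IsNondegenerate S.gr M.gr) {φ : Module.End ℝ l}
    (hφ : φ ∈ commutant s l) : ∃ A ∈ G.gr 0, ∀ x, ⁅A, ι x⁆ = modMap ι (φ x.2) := by
  obtain ⟨r, hr⟩ := LinearMap.exists_leftInverse_of_injective ι.toLinearMap
    (LinearMap.ker_eq_bot.2 (hG.injective hS))
  have hr' : ∀ x, r (ι x) = x := fun x => LinearMap.congr_fun hr x
  have hgr : ∀ {p Y}, Y ∈ M.gr p → φ Y ∈ M.gr p := fun hY =>
    GradedCRModule.mem_gr_of_mem_commutant hirr hφ hY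
  let sndL : AbelianExt s l →ₗ[ℝ] l := LinearMap.snd ℝ s l
  let D : g →ₗ[ℝ] g := modMap ι ∘ₗ φ ∘ₗ sndL ∘ₗ r
  have hD : ∀ x, D (ι x) = modMap ι (φ x.2) := fun x => by
    change modMap ι (φ (r (ι x)).2) = _
    rw [hr']
  have hder : ∀ x y : AbelianExt s l, modMap ι (φ ⁅x, y⁆.2)
      = ⁅modMap ι (φ x.2), ι y⁆ + ⁅ι x, modMap ι (φ y.2)⁆ := fun x y => by
    rw [map_eq_add x, map_eq_add y, add_lie, lie_add, lie_modMap_modMap, lie_modMap_modMap,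
      lie_algMap_modMap, lie_modMap_algMap, AbelianExt.lie_snd, map_sub,
      mem_commutant_iff.1 hφ, mem_commutant_iff.1 hφ, map_sub]
    abel
  obtain ⟨A, hA, hA'⟩ := hG.leviTanaka.realize_zero D ⟨fun q hq x hx => by
      obtain ⟨y, hy, rfl⟩ := hG.exists_of_neg hq hx
      rw [hD, zero_add]
      exact hG.modMap_mem (hgr hy.2), fun q hq r hr x hx y hy => by
      obtain ⟨x, hx, rfl⟩ := hG.exists_of_neg hq hx
      obtain ⟨y, hy, rfl⟩ := hG.exists_of_neg hr hy
      rw [← LieHom.map_lie, hD, hD, hD, hder]⟩ fun X Z hXZ => by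
      obtain ⟨y, hy, hyX⟩ := hG.exists_of_neg (by norm_num) X.2
      have hφy : AbelianExt.inr (φ y.2) ∈ M.ext.gr (-1) := ⟨zero_mem _, hgr hy.2⟩
      rw [hG.map_J ⟨y, hy⟩ X hyX.symm, hD, hG.map_J ⟨_, hφy⟩ Z (by
        rw [hXZ, ← hyX, hD]; rfl)]
      rw [map_eq_add]
      have h1 : (M.ext.J ⟨_, hφy⟩ : AbelianExt s l).1 = 0 := by
        change (S.J ⟨0, zero_mem _⟩ : s) = 0
        rw [show (⟨0, zero_mem _⟩ : S.gr (-1)) = 0 from rfl, map_zero]; rfl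
      have h2 : (M.ext.J ⟨_, hφy⟩ : AbelianExt s l).2 = φ (M.ext.J ⟨y, hy⟩ : AbelianExt s l).2 :=
        GradedCRModule.J_apply_of_mem_commutant hnd hφ ⟨y.2, hy.2⟩ ⟨φ y.2, hgr hy.2⟩ rfl
          (hgr (M.J _).2)
      rw [h1, h2, map_zero, zero_add]
  -- the equality holds on the negative part, and extends to `s ⊕ l` by transitivity
  refine ⟨A, hA, fun x => ?_⟩
  let d : AbelianExt s l →ₗ[ℝ] g :=
    (LieAlgebra.ad ℝ g A : g →ₗ[ℝ] g) ∘ₗ ι.toLinearMap - modMap ι ∘ₗ φ ∘ₗ sndL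
  have hdapp : ∀ x, d x = ⁅A, ι x⁆ - modMap ι (φ x.2) := fun _ => rfl
  have hd0 : d = 0 := by
    refine GradedCRAlgebra.derivation_eq_zero (H := M.ext) hG.leviTanaka.transitive ι
      (fun x hx => hG.exists_of_neg (by norm_num) hx) d (fun p x hx => ?_) (fun x y => ?_)
      fun p hp x hx => ?_
    · rw [hdapp]
      exact sub_mem (by simpa using G.lie_mem hA (hG.map_mem p x hx)) (hG.modMap_mem (hgr hx.2))
    · simp only [hdapp]
      rw [hder, LieHom.map_lie, leibniz_lie, sub_lie, lie_sub]
      abel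
    · rw [hdapp, hA' p hp _ (hG.map_mem p x hx), hD, sub_self]
  exact sub_eq_zero.1 (LinearMap.congr_fun hd0 x)

/-- Elements of degree `0` are determined by their action on `s ⊕ l`. -/
theorem eq_of_lie_eq (hG : IsLeviTanakaExtension M G ι) {A B : g} (hA : A ∈ G.gr 0)
    (hB : B ∈ G.gr 0) (h : ∀ x, ⁅A, ι x⁆ = ⁅B, ι x⁆) : A = B := by
  rw [← sub_eq_zero]
  refine hG.leviTanaka.transitive 0 le_rfl _ (sub_mem hA hB) fun x hx => ?_
  obtain ⟨y, -, rfl⟩ := hG.exists_of_neg (by norm_num) hx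
  rw [← lie_skew, sub_lie, h, sub_self, neg_zero]

/-- The linear map sending an endomorphism of the module `l` to the element of degree `0` of `g`
which acts by it on `l` and trivially on `s`. -/
theorem exists_commutantMap [FiniteDimensional ℝ s] [LieAlgebra.IsKilling ℝ s]
    [FiniteDimensional ℝ l] (hG : IsLeviTanakaExtension M G ι) (hS : S.Transitive)
    (hirr : LieModule.IsIrreducible ℝ s l) (hnd : IsNondegenerate S.gr M.gr) :
    ∃ j : commutant s l →ₗ[ℝ] g, (∀ φ, j φ ∈ G.gr 0) ∧
      ∀ φ x, ⁅j φ, ι x⁆ = modMap ι ((φ : Module.End ℝ l) x.2) := by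
  have h1 : ∀ φ : commutant s l, ∃ A ∈ G.gr 0, ∀ x, ⁅A, ι x⁆
      = modMap ι ((φ : Module.End ℝ l) x.2) :=
    fun φ => hG.exists_realization hS hirr hnd φ.2
  choose j hj hj' using h1
  exact ⟨{ toFun := j
           map_add' := fun φ ψ => hG.eq_of_lie_eq (hj _) (add_mem (hj _) (hj _)) fun x => by
             rw [add_lie, hj', hj', hj', ← map_add]; rfl
           map_smul' := fun t φ => hG.eq_of_lie_eq (hj _) ((G.gr 0).smul_mem _ (hj _)) fun x => by
             rw [RingHom.id_apply, smul_lie, hj', hj', ← map_smul]; rfl }, hj, hj'⟩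

/-- The degree operator of `g` is inner: it agrees with the adjoint of `E + c π` on the negative
part, and therefore everywhere by transitivity. -/
theorem exists_ad_eq_degreeOp [FiniteDimensional ℝ s] [LieAlgebra.IsKilling ℝ s]
    [FiniteDimensional ℝ l] (hG : IsLeviTanakaExtension M G ι)
    (hirr : LieModule.IsIrreducible ℝ s l) {π : g} (hπ : π ∈ G.gr 0)
    (hπ' : ∀ x, ⁅π, ι x⁆ = modMap ι x.2) :
    ∃ E : s, ∃ c : ℝ, (∀ p, ∀ X ∈ S.gr p, ⁅E, X⁆ = (p : ℝ) • X) ∧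
      ∀ x, ⁅algMap ι E + c • π, x⁆ = degreeOp G.isInternal x := by
  obtain ⟨E, hE0, hE⟩ := S.exists_gradingElement
  obtain ⟨c, hc⟩ := M.exists_shift hirr hE0 hE
  refine ⟨E, c, hE, fun x => ?_⟩
  have hE' : algMap ι E + c • π ∈ G.gr 0 :=
    add_mem (hG.algMap_mem hE0) ((G.gr 0).smul_mem c hπ)
  have hlie : ∀ p, ∀ x ∈ G.gr p, ⁅algMap ι E + c • π, x⁆ ∈ G.gr p := fun p x hx => by
    simpa using G.lie_mem hE' hx
  have hδ : ∀ x y, degreeOp G.isInternal ⁅x, y⁆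
      = ⁅degreeOp G.isInternal x, y⁆ + ⁅x, degreeOp G.isInternal y⁆ := fun x y => by
    refine graded_induction G.isInternal (P := fun x => degreeOp G.isInternal ⁅x, y⁆
      = ⁅degreeOp G.isInternal x, y⁆ + ⁅x, degreeOp G.isInternal y⁆) (by simp)
      (fun a b ha hb => by simp only [add_lie, map_add, ha, hb]; abel) (fun p x hx => ?_) x
    refine graded_induction G.isInternal (P := fun y => degreeOp G.isInternal ⁅x, y⁆
      = ⁅degreeOp G.isInternal x, y⁆ + ⁅x, degreeOp G.isInternal y⁆) (by simp)
      (fun a b ha hb => by simp only [lie_add, map_add, ha, hb]; abel) (fun q y hy => ?_) y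
    rw [degreeOp_apply _ (G.lie_mem hx hy), degreeOp_apply _ hx, degreeOp_apply _ hy, lie_smul,
      smul_lie, Int.cast_add, add_smul]
  let d : g →ₗ[ℝ] g := LieAlgebra.ad ℝ g (algMap ι E + c • π) - degreeOp G.isInternal
  have hdapp : ∀ x, d x = ⁅algMap ι E + c • π, x⁆ - degreeOp G.isInternal x := fun _ => rfl
  have hd0 : d = 0 := by
    refine GradedCRAlgebra.derivation_eq_zero (H := G) hG.leviTanaka.transitive LieHom.id
      (fun x hx => ⟨x, hx, rfl⟩) d (fun p x hx => ?_) (fun x y => ?_) fun p hp x hx => ?_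
    · rw [hdapp, degreeOp_apply _ hx]
      exact sub_mem (hlie p x hx) ((G.gr p).smul_mem _ hx)
    · simp only [hdapp, LieHom.id_apply]
      rw [hδ, leibniz_lie, sub_lie, lie_sub]
      abel
    · obtain ⟨y, hy, rfl⟩ := hG.exists_of_neg hp hx
      rw [hdapp, degreeOp_apply _ hx, add_lie, smul_lie, hπ', map_eq_add y, lie_add,
        lie_algMap_modMap, ← LieHom.map_lie, hE p _ hy.1, map_smul, smul_add, ← map_smul,
        ← map_smul (modMap ι) (p : ℝ), ← degreeOp_apply M.isInternal hy.2, hc, map_add]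
      simp only [map_smul]
      abel
  exact sub_eq_zero.1 (LinearMap.congr_fun hd0 x)

end IsLeviTanakaExtension

end Extension

end LeviTanaka

/-! ### The Levi–Tanaka extension: decomposition under `s` -/

namespace LeviTanaka

section Pullback

variable {s : Type*} [LieRing s] [LieAlgebra ℝ s] [FiniteDimensional ℝ s] [LieAlgebra.IsKilling ℝ s]
variable {g : Type*} [LieRing g] [LieAlgebra ℝ g]

/-- Weyl's theorem for a Lie algebra seen as a module over `s` through a homomorphism. -/
theorem exists_projection_of_hom [FiniteDimensional ℝ g] (f : s →ₗ⁅ℝ⁆ g) (N : Submodule ℝ g)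
    (hN : ∀ X, ∀ x ∈ N, ⁅f X, x⁆ ∈ N) :
    ∃ P : g →ₗ[ℝ] g, (∀ x, P x ∈ N) ∧ (∀ x ∈ N, P x = x) ∧ ∀ X x, P ⁅f X, x⁆ = ⁅f X, P x⁆ := by
  let _ : LieRingModule s g := LieRingModule.compLieHom g f
  have : LieModule ℝ s g := LieModule.compLieHom g f
  exact exists_equivariant_projection (L := s) (k := ℝ) (M := g)
    { N with lie_mem := fun {X x} hx => hN X x hx }

theorem trace_ad_comp_eq_zero (f : s →ₗ⁅ℝ⁆ g) (F : g →ₗ[ℝ] g)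
    (hF : ∀ X x, F ⁅f X, x⁆ = ⁅f X, F x⁆) (X : s) :
    LinearMap.trace ℝ g ((LieAlgebra.ad ℝ g (f X) : g →ₗ[ℝ] g) ∘ₗ F) = 0 := by
  let _ : LieRingModule s g := LieRingModule.compLieHom g f
  have : LieModule ℝ s g := LieModule.compLieHom g f
  exact trace_toEnd_comp_eq_zero (s := s) (W := g) F hF X

end Pullback

theorem trace_nonneg_of_isIdempotentElem {V : Type*} [AddCommGroup V] [Module ℝ V]
    [FiniteDimensional ℝ V] {F : V →ₗ[ℝ] V} (hF : IsIdempotentElem F) :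
    0 ≤ LinearMap.trace ℝ V F := by
  rw [LinearMap.IsProj.trace (LinearMap.IsIdempotentElem.isProj_range F hF)]
  exact Nat.cast_nonneg _

/-- An idempotent of degree `0` vanishing on the negative part whose trace weighted by the degree is
zero takes values in degree `0`. -/
theorem eq_zero_of_trace_degreeOp_comp {V : Type*} [AddCommGroup V] [Module ℝ V]
    [FiniteDimensional ℝ V] {gr : ℤ → Submodule ℝ V} (h : DirectSum.IsInternal gr) {F : V →ₗ[ℝ] V}
    (hFF : ∀ x, F (F x) = F x) (hF : ∀ p, Set.MapsTo F (gr p) (gr p))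
    (hneg : ∀ p < 0, ∀ x ∈ gr p, F x = 0) (htr : LinearMap.trace ℝ V (degreeOp h ∘ₗ F) = 0)
    {p : ℤ} (hp : p ≠ 0) {x : V} (hx : x ∈ gr p) : F x = 0 := by
  have hid : ∀ p, IsIdempotentElem (F.restrict (hF p)) := fun p =>
    LinearMap.ext fun x => Subtype.ext (hFF x)
  have hneg' : ∀ p < 0, F.restrict (hF p) = 0 := fun p hp =>
    LinearMap.ext fun x => Subtype.ext (hneg p hp x x.2)
  rw [trace_degreeOp_comp h F hF, Finset.sum_eq_zero_iff_of_nonneg] at htr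
  · rcases eq_or_ne (gr p) ⊥ with hb | hb
    · rw [hb, Submodule.mem_bot] at hx
      rw [hx, map_zero]
    · have h1 := htr p (by simpa using hb)
      have h2 := LinearMap.IsIdempotentElem.eq_zero_of_trace_eq_zero (hid p)
        ((mul_eq_zero.1 h1).resolve_left (by exact_mod_cast hp))
      exact congrArg Subtype.val (LinearMap.congr_fun h2 ⟨x, hx⟩)
  · intro p _
    rcases lt_or_ge p 0 with hp | hp
    · rw [hneg' p hp, map_zero, mul_zero]
    · exact mul_nonneg (by exact_mod_cast hp) (trace_nonneg_of_isIdempotentElem (hid p))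

/-- By Cartan's criterion, a nonzero proper Lie algebra has a nonzero Abelian ideal. -/
theorem IsProper.exists_abelian_ideal {g : Type*} [LieRing g] [LieAlgebra ℝ g]
    [FiniteDimensional ℝ g] [Nontrivial g] (hg : IsProper g) :
    ∃ a : LieIdeal ℝ g, IsLieAbelian a ∧ a ≠ ⊥ := by
  by_contra! hne
  have h1 : LieAlgebra.HasTrivialRadical ℝ g :=
    (LieAlgebra.hasTrivialRadical_iff_no_abelian_ideals ℝ g).2 hne
  have h2 : LieAlgebra.IsKilling ℝ g := inferInstance
  have h3 : LieAlgebra.IsKilling ℝ (⊤ : LieIdeal ℝ g) :=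
    LieAlgebra.isKilling_of_equiv (LieIdeal.topEquiv (R := ℝ) (L := g)).symm
  have h4 := hg ⊤ inferInstance
  obtain ⟨x, hx⟩ := exists_ne (0 : g)
  exact hx ((LieSubmodule.mem_bot x).1 (h4 ▸ LieSubmodule.mem_top x))

theorem lie_eq_zero_of_isLieAbelian {g : Type*} [LieRing g] [LieAlgebra ℝ g] {a : LieIdeal ℝ g}
    [IsLieAbelian a] {x y : g} (hx : x ∈ a) (hy : y ∈ a) : ⁅x, y⁆ = 0 :=
  congrArg Subtype.val (LieModule.IsTrivial.trivial (⟨x, hx⟩ : a) (⟨y, hy⟩ : a))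

section Structure

variable {s : Type*} [LieRing s] [LieAlgebra ℝ s]
variable {l : Type*} [AddCommGroup l] [Module ℝ l] [LieRingModule s l] [LieModule ℝ s l]
variable {g : Type*} [LieRing g] [LieAlgebra ℝ g] {ι : AbelianExt s l →ₗ⁅ℝ⁆ g}

/-- An Abelian ideal of `g` meets the image of `s ⊕ l` inside the image of `l`: the elements of `s`
below it form an Abelian ideal. -/
theorem fst_eq_zero_of_mem_abelian_ideal [FiniteDimensional ℝ s] [LieAlgebra.IsKilling ℝ s]
    (hι : Function.Injective ι) (a : LieIdeal ℝ g) [IsLieAbelian a] {X : s} {Y : l}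
    (h : algMap ι X + modMap ι Y ∈ a) : X = 0 := by
  let I : LieIdeal ℝ s :=
    { carrier := {X | ∃ Y : l, algMap ι X + modMap ι Y ∈ a}
      add_mem' := by
        rintro X X' ⟨Y, h⟩ ⟨Y', h'⟩
        refine ⟨Y + Y', ?_⟩
        rw [map_add, map_add, add_add_add_comm]
        exact add_mem h h'
      zero_mem' := ⟨0, by simp⟩
      smul_mem' := by
        rintro t X ⟨Y, h⟩
        refine ⟨t • Y, ?_⟩
        rw [map_smul, map_smul, ← smul_add]
        exact a.smul_mem t h
      lie_mem := by
        rintro X' X ⟨Y, h⟩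
        refine ⟨⁅X', Y⁆, ?_⟩
        rw [LieHom.map_lie, ← lie_algMap_modMap, ← lie_add]
        exact lie_mem_right ℝ g a _ _ h }
  have hI : ∀ X ∈ I, ∀ X' ∈ I, ⁅X, X'⁆ = 0 := by
    rintro X ⟨Y, h⟩ X' ⟨Y', h'⟩
    have h1 := lie_eq_zero_of_isLieAbelian h h'
    rw [algMap_apply, modMap_apply, algMap_apply, modMap_apply, ← map_add, ← map_add,
      ← LieHom.map_lie, ← map_zero ι] at h1
    simpa using congrArg Prod.fst (hι h1)
  have : IsLieAbelian I := ⟨fun X X' => Subtype.ext (hI X X.2 X' X'.2)⟩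
  have hbot := LieAlgebra.IsKilling.ideal_eq_bot_of_isLieAbelian I
  have hX : X ∈ I := ⟨Y, h⟩
  rwa [hbot, LieSubmodule.mem_bot] at hX

namespace IsLeviTanakaExtension

variable {S : GradedCRAlgebra s} {M : GradedCRModule S l} {G : GradedCRAlgebra g}

/-- On an Abelian ideal containing `l`, `ad π` is the identity: this holds in negative degrees,
where the ideal lies in `l`, and propagates to the others by transitivity. -/
theorem lie_eq_self_of_mem_abelian_ideal [FiniteDimensional ℝ s] [LieAlgebra.IsKilling ℝ s]
    (hG : IsLeviTanakaExtension M G ι) (hι : Function.Injective ι) {π : g} (hπ : π ∈ G.gr 0)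
    (hπ' : ∀ x, ⁅π, ι x⁆ = modMap ι x.2) {a : LieIdeal ℝ g} [IsLieAbelian a]
    (ha : ∀ Y, modMap ι Y ∈ a) : ∀ p, ∀ x ∈ G.gr p, x ∈ a → ⁅π, x⁆ = x := by
  refine int_induction_of_neg (fun p hp x hx hxa => ?_) fun p hp ih x hx hxa => ?_
  · obtain ⟨y, hy, rfl⟩ := hG.exists_of_neg hp hx
    have h1 : y.1 = 0 := fst_eq_zero_of_mem_abelian_ideal hι a (by rwa [← map_eq_add])
    rw [hπ', map_eq_add, h1, map_zero, zero_add]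
  · rw [← sub_eq_zero]
    refine hG.leviTanaka.transitive p hp _
      (sub_mem (by simpa using G.lie_mem hπ hx) hx) fun z hz => ?_
    have h1 := ih ⁅z, x⁆ (by rw [sub_eq_neg_add]; exact G.lie_mem hz hx)
      (lie_mem_right ℝ g a _ _ hxa)
    obtain ⟨y, hy, rfl⟩ := hG.exists_of_neg (by norm_num) hz
    rw [lie_sub, leibniz_lie, h1, add_sub_cancel_right, ← lie_skew (ι y) π, hπ', neg_lie,
      lie_eq_zero_of_isLieAbelian (ha _) hxa, neg_zero]

/-- A nonzero Abelian ideal contains `l`: it is graded because the degree operator is inner, has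
elements of negative degree by transitivity, and these lie in the irreducible module `l`. -/
theorem modMap_mem_abelian_ideal [FiniteDimensional ℝ g] [FiniteDimensional ℝ s]
    [LieAlgebra.IsKilling ℝ s] (hG : IsLeviTanakaExtension M G ι)
    (hirr : LieModule.IsIrreducible ℝ s l) (hι : Function.Injective ι) {E' : g}
    (hE' : ∀ x, ⁅E', x⁆ = degreeOp G.isInternal x) {a : LieIdeal ℝ g} [IsLieAbelian a]
    (ha : a ≠ ⊥) (Y : l) : modMap ι Y ∈ a := by
  obtain ⟨p, x, hx, hxa, hx0⟩ := exists_homogeneous_mem G.isInternal (W := a.toSubmodule)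
    (fun x hx => by rw [← hE']; exact lie_mem_right ℝ g a _ _ hx)
    (fun h => ha ((LieSubmodule.toSubmodule_eq_bot a).1 h))
  have hdesc : ∀ p, ∀ x ∈ G.gr p, x ∈ a → x ≠ 0 → ∃ q < 0, ∃ y ∈ G.gr q, y ∈ a ∧ y ≠ 0 := by
    refine int_induction_of_neg (fun p hp x hx hxa hx0 => ⟨p, hp, x, hx, hxa, hx0⟩)
      fun p hp ih x hx hxa hx0 => ?_
    by_contra hne
    refine hx0 (hG.leviTanaka.transitive p hp x hx fun z hz => ?_)
    by_contra hzx
    exact hne (ih ⁅z, x⁆ (by rw [sub_eq_neg_add]; exact G.lie_mem hz hx)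
      (lie_mem_right ℝ g a _ _ hxa) hzx)
  obtain ⟨q, hq, y, hy, hya, hy0⟩ := hdesc p x hx hxa hx0
  obtain ⟨X, hX, Y₀, hY₀, rfl⟩ := hG.exists_add_of_neg hq hy
  have hX0 : X = 0 := fst_eq_zero_of_mem_abelian_ideal hι a hya
  rw [hX0, map_zero, zero_add] at hya hy0
  let N : LieSubmodule ℝ s l :=
    { a.toSubmodule.comap (modMap ι) with
      lie_mem := fun {X Y} hY => by
        change modMap ι ⁅X, Y⁆ ∈ a
        rw [← lie_algMap_modMap]
        exact lie_mem_right ℝ g a _ _ hY }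
  have hN : N = ⊤ := (eq_bot_or_eq_top N).resolve_left fun h => by
    have h1 : Y₀ ∈ N := hya
    rw [h, LieSubmodule.mem_bot] at h1
    exact hy0 (by rw [h1, map_zero])
  exact (hN ▸ LieSubmodule.mem_top Y : Y ∈ N)

/-- `ad π` is the identity on `[l, g]`, which is contained in an Abelian ideal; equivalently, the
image of `ad π` commutes with `l`. -/
theorem lie_modMap_lie_eq_zero [FiniteDimensional ℝ s] [FiniteDimensional ℝ l]
    [FiniteDimensional ℝ g] [LieAlgebra.IsKilling ℝ s] (hG : IsLeviTanakaExtension M G ι)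
    (hirr : LieModule.IsIrreducible ℝ s l) (hι : Function.Injective ι) (hproper : IsProper g)
    {π : g} (hπ : π ∈ G.gr 0) (hπ' : ∀ x, ⁅π, ι x⁆ = modMap ι x.2) (Y : l) (A : g) :
    ⁅π, ⁅modMap ι Y, A⁆⁆ = ⁅modMap ι Y, A⁆ ∧ ⁅modMap ι Y, ⁅π, A⁆⁆ = 0 := by
  obtain ⟨E, c, -, hE'⟩ := hG.exists_ad_eq_degreeOp hirr hπ hπ'
  have hnt : Nontrivial l := LieModule.nontrivial_of_isIrreducible ℝ s l
  have : Nontrivial g := (modMap_injective hι).nontrivial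
  obtain ⟨a, hab, ha⟩ := hproper.exists_abelian_ideal
  have hla := hG.modMap_mem_abelian_ideal hirr hι hE' ha
  have h1 : ⁅π, ⁅modMap ι Y, A⁆⁆ = ⁅modMap ι Y, A⁆ := by
    refine graded_induction M.isInternal (P := fun Y => ⁅π, ⁅modMap ι Y, A⁆⁆ = ⁅modMap ι Y, A⁆)
      (by simp) (fun Y Y' h h' => by rw [map_add, add_lie, lie_add, h, h']) (fun q Y hY => ?_) Y
    refine graded_induction G.isInternal (P := fun A => ⁅π, ⁅modMap ι Y, A⁆⁆ = ⁅modMap ι Y, A⁆)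
      (by simp) (fun A B h h' => by rw [lie_add, lie_add, h, h']) (fun p A hA => ?_) A
    exact hG.lie_eq_self_of_mem_abelian_ideal hι hπ hπ' hla _ _
      (G.lie_mem (hG.modMap_mem hY) hA) (lie_mem_left ℝ g a _ _ (hla Y))
  refine ⟨h1, ?_⟩
  have h2 : ⁅π, modMap ι Y⁆ = modMap ι Y := by rw [modMap_apply, hπ']; rfl
  rw [leibniz_lie, h2] at h1
  exact left_eq_add.1 h1.symm

theorem lie_algMap_eq_zero {π : g} (hπ' : ∀ x, ⁅π, ι x⁆ = modMap ι x.2) (X : s) :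
    ⁅π, algMap ι X⁆ = 0 := by
  rw [algMap_apply, hπ', AbelianExt.inl_snd, map_zero]

theorem lie_lie_algMap {π : g} (hπ' : ∀ x, ⁅π, ι x⁆ = modMap ι x.2) (X : s) (A : g) :
    ⁅algMap ι X, ⁅π, A⁆⁆ = ⁅π, ⁅algMap ι X, A⁆⁆ := by
  rw [leibniz_lie π, lie_algMap_eq_zero hπ', zero_lie, zero_add]

/-- `ad π` is idempotent: it is so on the negative part, and its image commutes with `l`. -/
theorem lie_lie_self (hG : IsLeviTanakaExtension M G ι) {π : g} (hπ : π ∈ G.gr 0)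
    (hπ' : ∀ x, ⁅π, ι x⁆ = modMap ι x.2) (hl : ∀ (Y : l) (A : g), ⁅modMap ι Y, ⁅π, A⁆⁆ = 0)
    (A : g) : ⁅π, ⁅π, A⁆⁆ = ⁅π, A⁆ := by
  refine graded_induction G.isInternal (P := fun A => ⁅π, ⁅π, A⁆⁆ = ⁅π, A⁆) (by simp)
    (fun A B h h' => by rw [lie_add, lie_add, h, h']) (fun p => ?_) A
  have hmem : ∀ {p A}, A ∈ G.gr p → ⁅π, A⁆ ∈ G.gr p := fun hA => by simpa using G.lie_mem hπ hA
  refine int_induction_of_neg (P := fun p => ∀ A ∈ G.gr p, ⁅π, ⁅π, A⁆⁆ = ⁅π, A⁆)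
    (fun p hp A hA => ?_) (fun p hp ih A hA => ?_) p
  · obtain ⟨y, hy, rfl⟩ := hG.exists_of_neg hp hA
    rw [hπ', modMap_apply, hπ']; rfl
  · rw [← sub_eq_zero]
    refine hG.eq_zero_of_lie_eq_zero (by omega) (sub_mem (hmem (hmem hA)) (hmem hA))
      (fun X hX => ?_) fun Y hY => by rw [lie_sub, hl, hl, sub_zero]
    rw [lie_sub, lie_lie_algMap hπ', lie_lie_algMap hπ', ih ⁅algMap ι X, A⁆
      (by rw [sub_eq_neg_add]; exact G.lie_mem (hG.algMap_mem hX) hA), sub_self]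

/-- The image of `ad π` is `l`: by transitivity, an equivariant projection onto `l` is the identity
on it. -/
theorem lie_mem_range_modMap [FiniteDimensional ℝ s] [FiniteDimensional ℝ l] [FiniteDimensional ℝ g]
    [LieAlgebra.IsKilling ℝ s] (hG : IsLeviTanakaExtension M G ι)
    (hirr : LieModule.IsIrreducible ℝ s l) {π : g} (hπ : π ∈ G.gr 0)
    (hπ' : ∀ x, ⁅π, ι x⁆ = modMap ι x.2) (hl : ∀ (Y : l) (A : g), ⁅modMap ι Y, ⁅π, A⁆⁆ = 0)
    (A : g) : ⁅π, A⁆ ∈ LinearMap.range (modMap ι) := by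
  obtain ⟨E, c, -, hE'⟩ := hG.exists_ad_eq_degreeOp hirr hπ hπ'
  obtain ⟨Q, hQ, hQ', hQs⟩ := exists_projection_of_hom (algMap ι) (LinearMap.range (modMap ι))
    (by rintro X _ ⟨Y, rfl⟩; exact ⟨_, (lie_algMap_modMap X Y).symm⟩)
  have hπQ : ∀ A, ⁅π, Q A⁆ = Q A := fun A => by
    obtain ⟨Y, hY⟩ := hQ A
    rw [← hY, modMap_apply, hπ']; rfl
  have hlQ : ∀ Y A, ⁅modMap ι Y, Q A⁆ = 0 := fun Y A => by rw [← hπQ, hl]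
  have hmem : ∀ {p A}, A ∈ G.gr p → ⁅π, A⁆ ∈ G.gr p := fun hA => by simpa using G.lie_mem hπ hA
  have hfix : ∀ p, ∀ x ∈ G.gr p, ⁅π, x⁆ = x → Q x = x := by
    refine int_induction_of_neg (fun p hp x hx h => ?_) fun p hp ih x hx h => ?_
    · obtain ⟨y, hy, rfl⟩ := hG.exists_of_neg hp hx
      rw [hπ'] at h
      exact hQ' _ ⟨_, h⟩
    · have hQx : Q x ∈ G.gr p := mem_of_degreeOp_eq G.isInternal (by
        have h1 : (p : ℝ) • x = ⁅algMap ι E, x⁆ + c • x := by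
          rw [← degreeOp_apply G.isInternal hx, ← hE', add_lie, smul_lie, h]
        rw [← hE', add_lie, smul_lie, hπQ, ← hQs, ← map_smul, ← map_add, ← h1, map_smul])
      rw [← sub_eq_zero]
      refine hG.eq_zero_of_lie_eq_zero (by omega) (sub_mem hQx hx) (fun X hX => ?_) fun Y hY => ?_
      · rw [lie_sub, ← hQs, ih ⁅algMap ι X, x⁆
          (by rw [sub_eq_neg_add]; exact G.lie_mem (hG.algMap_mem hX) hx)
          (by rw [← lie_lie_algMap hπ', h]), sub_self]
      · rw [lie_sub, hlQ, ← h, hl, sub_zero]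
  refine graded_induction G.isInternal (P := fun A => ⁅π, A⁆ ∈ LinearMap.range (modMap ι))
    (by simp) (fun A B h h' => by rw [lie_add]; exact add_mem h h') (fun p A hA => ?_) A
  rw [← hfix p _ (hmem hA) (hG.lie_lie_self hπ hπ' hl A)]
  exact hQ _

/-- An ideal of a transitive semisimple graded algebra containing all the homogeneous pieces of
nonzero degree is everything: the complementary ideal has degree `0` and commutes with `s_{-1}`. -/
theorem _root_.LeviTanaka.GradedCRAlgebra.ideal_eq_top [FiniteDimensional ℝ s]
    [LieAlgebra.IsKilling ℝ s] (hS : S.Transitive) (I : LieIdeal ℝ s)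
    (hI : ∀ p ≠ 0, ∀ X ∈ S.gr p, X ∈ I) : I = ⊤ := by
  obtain ⟨E, hE0, hE⟩ := S.exists_gradingElement
  have hc := I.isCompl_killingCompl
  have hinf : ∀ x ∈ I, x ∈ LieIdeal.killingCompl ℝ s I → x = 0 := fun x hx hx' => by
    have h1 : x ∈ I ⊓ LieIdeal.killingCompl ℝ s I := ⟨hx, hx'⟩
    rwa [hc.inf_eq_bot, LieSubmodule.mem_bot] at h1
  have hEdeg : ∀ x, ⁅E, x⁆ = degreeOp S.isInternal x := graded_induction S.isInternal (by simp)
    (fun x y hx hy => by rw [lie_add, map_add, hx, hy])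
    fun p x hx => by rw [hE p x hx, degreeOp_apply _ hx]
  have hEI : ∀ x, ⁅E, x⁆ ∈ I := graded_induction S.isInternal (by simp)
    (fun x y hx hy => by rw [lie_add]; exact add_mem hx hy) fun p x hx => by
      rw [hE p x hx]
      rcases eq_or_ne p 0 with rfl | hp
      · simp
      · exact I.smul_mem _ (hI p hp x hx)
  have hbot : LieIdeal.killingCompl ℝ s I = ⊥ := (LieSubmodule.eq_bot_iff _).2 fun x hx => by
    have h1 : ⁅E, x⁆ = 0 := hinf _ (hEI x) (lie_mem_right ℝ s _ _ _ hx)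
    have h2 : x ∈ S.gr 0 := mem_of_degreeOp_eq S.isInternal (by rw [← hEdeg, h1]; simp)
    exact hS 0 le_rfl x h2 fun X hX => hinf _
      (lie_mem_left ℝ s I _ _ (hI _ (by norm_num) X hX)) (lie_mem_right ℝ s _ _ _ hx)
  rw [← hc.sup_eq_top, hbot, sup_bot_eq]

/-- The `s`-module `g` is the sum of `s`, of `l`, and of elements acting on `s ⊕ l` through
endomorphisms of the module `l`. The third summand is the image of an equivariant idempotent `F`
vanishing on `s ⊕ l`; it sits in degrees `p ≥ 0`, and in degree `0` only since the grading element
of the semisimple algebra `s` has trace zero on it. -/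
theorem exists_decomposition [FiniteDimensional ℝ s] [FiniteDimensional ℝ l]
    [LieAlgebra.IsKilling ℝ s] (hG : IsLeviTanakaExtension M G ι) (hS : S.Transitive)
    (hirr : LieModule.IsIrreducible ℝ s l) (hproper : IsProper g)
    {j : commutant s l →ₗ[ℝ] g} (hj : ∀ φ, j φ ∈ G.gr 0)
    (hj' : ∀ φ x, ⁅j φ, ι x⁆ = modMap ι ((φ : Module.End ℝ l) x.2)) (A : g) :
    ∃ X φ Y, A = algMap ι X + j φ + modMap ι Y := by
  have : FiniteDimensional ℝ g := hG.finiteDimensional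
  have hι := hG.injective hS
  set π := j 1
  have hπ : π ∈ G.gr 0 := hj 1
  have hπ' : ∀ x, ⁅π, ι x⁆ = modMap ι x.2 := fun x => hj' 1 x
  have hl1 := fun Y A => (hG.lie_modMap_lie_eq_zero hirr hι hproper hπ hπ' Y A).1
  have hl := fun Y A => (hG.lie_modMap_lie_eq_zero hirr hι hproper hπ hπ' Y A).2
  have hrange := hG.lie_mem_range_modMap hirr hπ hπ' hl
  have hPP := hG.lie_lie_self hπ hπ' hl
  obtain ⟨E, c, hE, hE'⟩ := hG.exists_ad_eq_degreeOp hirr hπ hπ'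
  obtain ⟨Q, hQ, hQ', hQs⟩ := exists_projection_of_hom (algMap ι)
    (LinearMap.range (algMap ι).toLinearMap)
    (by rintro X _ ⟨Y, rfl⟩; exact ⟨⁅X, Y⁆, LieHom.map_lie _ _ _⟩)
  have hπQ : ∀ A, ⁅π, Q A⁆ = 0 := fun A => by
    obtain ⟨X, hX⟩ := hQ A
    rw [← hX]
    exact lie_algMap_eq_zero hπ' X
  have hQQ : ∀ A, Q (Q A) = Q A := fun A => hQ' _ (hQ A)
  let F : g →ₗ[ℝ] g := (LinearMap.id - Q) ∘ₗ (LinearMap.id - (LieAlgebra.ad ℝ g π : g →ₗ[ℝ] g))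
  have hF : ∀ A, F A = A - ⁅π, A⁆ - (Q A - Q ⁅π, A⁆) := fun A => by
    simp [F]
  have hπF : ∀ A, ⁅π, F A⁆ = 0 := fun A => by
    simp only [hF, lie_sub, hPP, hπQ, sub_self]
  have hFπ : ∀ A, F ⁅π, A⁆ = 0 := fun A => by simp only [hF, hPP, sub_self]
  have hFF : ∀ A, F (F A) = F A := fun A => by
    rw [hF (F A), hπF, map_zero, sub_zero, sub_zero, hF A]
    simp only [map_sub, hQQ, sub_self, sub_zero]
  have hFs : ∀ X A, F ⁅algMap ι X, A⁆ = ⁅algMap ι X, F A⁆ := fun X A => by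
    simp only [hF, ← lie_lie_algMap hπ', hQs, lie_sub]
  have hFgr : ∀ p, Set.MapsTo F (G.gr p) (G.gr p) := fun p A hA => by
    refine mem_of_degreeOp_eq G.isInternal ?_
    rw [← hE', add_lie, smul_lie, hπF, ← hFs, ← map_smul, ← degreeOp_apply G.isInternal hA, ← hE',
      add_lie, smul_lie, map_add, map_smul, hFπ]
  have hFalg : ∀ X, F (algMap ι X) = 0 := fun X => by
    rw [hF, lie_algMap_eq_zero hπ', map_zero, hQ' (algMap ι X) ⟨X, rfl⟩]; simp
  have hFneg : ∀ p < 0, ∀ A ∈ G.gr p, F A = 0 := fun p hp A hA => by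
    obtain ⟨y, hy, rfl⟩ := hG.exists_of_neg hp hA
    have h1 : modMap ι y.2 = ⁅π, modMap ι y.2⁆ := by rw [modMap_apply, hπ']; rfl
    rw [map_eq_add, map_add, hFalg, h1, hFπ, add_zero]
  -- on the image of `F` the degree is the action of the grading element
  have htr : LinearMap.trace ℝ g (degreeOp G.isInternal ∘ₗ F) = 0 := by
    have h1 : degreeOp G.isInternal ∘ₗ F
        = (LieAlgebra.ad ℝ g (algMap ι E) : g →ₗ[ℝ] g) ∘ₗ F := LinearMap.ext fun A => by
      simp only [LinearMap.comp_apply, ← hE', add_lie, smul_lie, hπF, smul_zero, add_zero,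
        LieAlgebra.ad_apply]
    rw [h1]
    exact trace_ad_comp_eq_zero _ F hFs E
  have hF0 : ∀ A, F A ∈ G.gr 0 := graded_induction G.isInternal (by simp)
    (fun A B h h' => by rw [map_add]; exact add_mem h h') fun p A hA => by
      rcases eq_or_ne p 0 with rfl | hp
      · exact hFgr 0 hA
      · rw [eq_zero_of_trace_degreeOp_comp G.isInternal hFF hFgr hFneg htr hp hA]
        exact zero_mem _
  -- the ideal of the elements of `s` acting trivially on the image of `F`
  let I : LieIdeal ℝ s :=
    { carrier := {X | ∀ A, ⁅algMap ι X, F A⁆ = 0}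
      add_mem' := fun {X X'} h h' A => by rw [map_add, add_lie, h, h', add_zero]
      zero_mem' := fun A => by rw [map_zero, zero_lie]
      smul_mem' := fun t X h A => by rw [map_smul, smul_lie, h, smul_zero]
      lie_mem := fun {X X'} h A => by
        rw [LieHom.map_lie, lie_lie, h, lie_zero, ← hFs, h, sub_zero] }
  have hI : I = ⊤ := GradedCRAlgebra.ideal_eq_top hS I fun p hp X hX A =>
    eq_zero_of_mem_of_mem G.isInternal hp
      (by simpa using G.lie_mem (hG.algMap_mem hX) (hF0 A)) (by rw [← hFs]; exact hF0 _)
  have hsF : ∀ X A, ⁅algMap ι X, F A⁆ = 0 := fun X =>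
    (hI ▸ LieSubmodule.mem_top X : X ∈ I)
  obtain ⟨r, hr⟩ := LinearMap.exists_leftInverse_of_injective (modMap ι)
    (LinearMap.ker_eq_bot.2 (modMap_injective hι))
  let φ : Module.End ℝ l := r ∘ₗ (LieAlgebra.ad ℝ g (F A) : g →ₗ[ℝ] g) ∘ₗ modMap ι
  have hφ : ∀ Y, modMap ι (φ Y) = ⁅F A, modMap ι Y⁆ := fun Y => by
    have h1 : ⁅F A, modMap ι Y⁆ ∈ LinearMap.range (modMap ι) := by
      rw [← lie_skew, ← hl1]
      exact neg_mem (hrange _)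
    obtain ⟨Z, hZ⟩ := h1
    change modMap ι (r ⁅F A, modMap ι Y⁆) = _
    rw [← hZ]
    congr 1
    exact LinearMap.congr_fun hr Z
  have hφc : φ ∈ commutant s l := mem_commutant_iff.2 fun X Y => modMap_injective hι (by
    rw [hφ, ← lie_algMap_modMap, ← lie_algMap_modMap, hφ, leibniz_lie (F A),
      ← lie_skew (F A), hsF, neg_zero, zero_lie, zero_add])
  have hFA : F A = j ⟨φ, hφc⟩ := hG.eq_of_lie_eq (hF0 A) (hj _) fun x => by
    rw [hj', map_eq_add x, lie_add, ← lie_skew, hsF, neg_zero, zero_add, ← hφ]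
  obtain ⟨Y, hY⟩ := hrange A
  obtain ⟨X, hX⟩ := hQ (A - ⁅π, A⁆)
  refine ⟨X, ⟨φ, hφc⟩, Y, ?_⟩
  rw [← hFA, hY, hF, show algMap ι X = Q (A - ⁅π, A⁆) from hX, map_sub]
  abel

end IsLeviTanakaExtension

end Structure

end LeviTanaka

/-! ### Radical, nilradical and tori of the decomposition -/

namespace LeviTanaka

section Splitting

variable {s : Type*} [LieRing s] [LieAlgebra ℝ s]
variable {l : Type*} [AddCommGroup l] [Module ℝ l] [LieRingModule s l] [LieModule ℝ s l]
variable {g : Type*} [LieRing g] [LieAlgebra ℝ g]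

/-- `g` contains `s ⊕ l` through `ι`, and is its sum with a copy, in degree `0`, of the algebra of
endomorphisms of the module `l`, acting naturally on `l` and trivially on `s`. -/
structure IsCommutantExtension (G : GradedCRAlgebra g) (ι : AbelianExt s l →ₗ⁅ℝ⁆ g)
    (j : commutant s l →ₗ[ℝ] g) : Prop where
  injective : Function.Injective ι
  mem_zero : ∀ φ, j φ ∈ G.gr 0
  lie_map : ∀ φ x, ⁅j φ, ι x⁆ = modMap ι ((φ : Module.End ℝ l) x.2)
  eq_of_lie_eq : ∀ A ∈ G.gr 0, ∀ B ∈ G.gr 0, (∀ x, ⁅A, ι x⁆ = ⁅B, ι x⁆) → A = B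
  exists_eq : ∀ A, ∃ X φ Y, A = algMap ι X + j φ + modMap ι Y

namespace IsCommutantExtension

variable {G : GradedCRAlgebra g} {ι : AbelianExt s l →ₗ⁅ℝ⁆ g} {j : commutant s l →ₗ[ℝ] g}

theorem lie_algMap (h : IsCommutantExtension G ι j) (φ : commutant s l) (X : s) :
    ⁅j φ, algMap ι X⁆ = 0 := by
  rw [algMap_apply, h.lie_map, AbelianExt.inl_snd, map_zero, map_zero]

theorem algMap_lie (h : IsCommutantExtension G ι j) (φ : commutant s l) (X : s) :
    ⁅algMap ι X, j φ⁆ = 0 := by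
  rw [← lie_skew, h.lie_algMap, neg_zero]

theorem lie_modMap (h : IsCommutantExtension G ι j) (φ : commutant s l) (Y : l) :
    ⁅j φ, modMap ι Y⁆ = modMap ι ((φ : Module.End ℝ l) Y) := by
  rw [modMap_apply, h.lie_map, AbelianExt.inr_snd]

theorem modMap_lie (h : IsCommutantExtension G ι j) (φ : commutant s l) (Y : l) :
    ⁅modMap ι Y, j φ⁆ = -modMap ι ((φ : Module.End ℝ l) Y) := by
  rw [← lie_skew, h.lie_modMap]

/-- The decomposition is direct. -/
theorem eq_zero_of_add_eq_zero [LieAlgebra.HasTrivialRadical ℝ s]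
    (h : IsCommutantExtension G ι j) {X : s} {φ : commutant s l} {Y : l}
    (h0 : algMap ι X + j φ + modMap ι Y = 0) : X = 0 ∧ φ = 0 ∧ Y = 0 := by
  have hX : X = 0 := by
    have h1 : X ∈ LieAlgebra.center ℝ s := by
      rw [LieModule.mem_maxTrivSubmodule]
      intro X'
      have h2 : ⁅algMap ι X', algMap ι X + j φ + modMap ι Y⁆ = 0 := by rw [h0, lie_zero]
      rw [lie_add, lie_add, h.algMap_lie, add_zero, lie_algMap_modMap, ← LieHom.map_lie,
        algMap_apply, modMap_apply, ← map_add, ← map_zero ι] at h2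
      simpa using congrArg Prod.fst (h.injective h2)
    rwa [LieAlgebra.center_eq_bot, LieSubmodule.mem_bot] at h1
  rw [hX, map_zero, zero_add] at h0
  have hφ : φ = 0 := Subtype.ext <| LinearMap.ext fun Z => modMap_injective h.injective (by
    have h2 : ⁅j φ + modMap ι Y, modMap ι Z⁆ = 0 := by rw [h0, zero_lie]
    rw [add_lie, lie_modMap_modMap, add_zero, h.lie_modMap] at h2
    rw [h2]; simp)
  rw [hφ, map_zero, zero_add] at h0
  exact ⟨hX, hφ, modMap_injective h.injective (h0.trans (map_zero _).symm)⟩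

theorem injective_map [LieAlgebra.HasTrivialRadical ℝ s] (h : IsCommutantExtension G ι j) :
    Function.Injective j := by
  rw [injective_iff_map_eq_zero]
  intro φ hφ
  exact (h.eq_zero_of_add_eq_zero (X := 0) (Y := 0) (by simp [hφ])).2.1

theorem lie_map_map (h : IsCommutantExtension G ι j) (φ ψ : commutant s l) :
    ⁅j φ, j ψ⁆ = j (φ * ψ - ψ * φ) := by
  refine h.eq_of_lie_eq _ (by simpa using G.lie_mem (h.mem_zero φ) (h.mem_zero ψ)) _
    (h.mem_zero _) fun x => ?_
  rw [lie_lie, h.lie_map, h.lie_map, h.lie_map, h.lie_modMap, h.lie_modMap, ← map_sub]; rfl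

theorem lie_one (h : IsCommutantExtension G ι j) (X : s) (φ : commutant s l) (Y : l) :
    ⁅j 1, algMap ι X + j φ + modMap ι Y⁆ = modMap ι Y := by
  rw [lie_add, lie_add, h.lie_algMap, h.lie_map_map, one_mul, mul_one, sub_self, map_zero,
    h.lie_modMap, zero_add, zero_add]; rfl

/-- The image of `l`, as an ideal. -/
def modIdeal (h : IsCommutantExtension G ι j) : LieIdeal ℝ g :=
  { LinearMap.range (modMap ι) with
    lie_mem := by
      rintro A _ ⟨Z, rfl⟩
      obtain ⟨X, φ, Y, rfl⟩ := h.exists_eq A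
      rw [add_lie, add_lie, lie_modMap_modMap, h.lie_modMap, lie_algMap_modMap, add_zero, ← map_add]
      exact ⟨_, rfl⟩ }

/-- The ideal spanned by `l` and by a central subspace of the endomorphisms of the module `l`. -/
def radIdeal (h : IsCommutantExtension G ι j) (T : Submodule ℝ (commutant s l))
    (hT : ∀ t ∈ T, ∀ φ, t * φ = φ * t) : LieIdeal ℝ g :=
  { LinearMap.range (modMap ι) ⊔ T.map j with
    lie_mem := by
      intro A x hx
      obtain ⟨_, ⟨Z, rfl⟩, _, ⟨t, ht, rfl⟩, rfl⟩ := Submodule.mem_sup.1 hx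
      refine Submodule.mem_sup_left ?_
      obtain ⟨X, φ, Y, rfl⟩ := h.exists_eq A
      rw [lie_add]
      refine add_mem (h.modIdeal.lie_mem ⟨Z, rfl⟩) ?_
      rw [add_lie, add_lie, h.algMap_lie, h.lie_map_map, hT t ht, sub_self, map_zero, h.modMap_lie,
        zero_add, zero_add]
      exact neg_mem ⟨_, rfl⟩ }

theorem mem_radIdeal (h : IsCommutantExtension G ι j) {T : Submodule ℝ (commutant s l)}
    {hT : ∀ t ∈ T, ∀ φ, t * φ = φ * t} {x : g} :
    x ∈ h.radIdeal T hT ↔ ∃ Y, ∃ t ∈ T, x = modMap ι Y + j t := by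
  constructor
  · intro hx
    obtain ⟨_, ⟨Z, rfl⟩, _, ⟨t, ht, rfl⟩, rfl⟩ := Submodule.mem_sup.1 hx
    exact ⟨Z, t, ht, rfl⟩
  · rintro ⟨Y, t, ht, rfl⟩
    exact Submodule.add_mem_sup ⟨Y, rfl⟩ ⟨t, ht, rfl⟩

theorem isSolvable_radIdeal (h : IsCommutantExtension G ι j) (T : Submodule ℝ (commutant s l))
    (hT : ∀ t ∈ T, ∀ φ, t * φ = φ * t) : LieAlgebra.IsSolvable (h.radIdeal T hT) := by
  rw [LieAlgebra.isSolvable_iff ℝ]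
  refine ⟨2, (LieIdeal.derivedSeries_eq_bot_iff _ _).2 ?_⟩
  have h1 : ⁅h.radIdeal T hT, h.radIdeal T hT⁆ ≤ h.modIdeal := by
    rw [LieSubmodule.lie_le_iff]
    intro x hx y hy
    obtain ⟨Y, t, ht, rfl⟩ := h.mem_radIdeal.1 hx
    obtain ⟨Z, u, hu, rfl⟩ := h.mem_radIdeal.1 hy
    rw [add_lie, lie_add, lie_add, lie_modMap_modMap, h.lie_map_map, hT t ht, sub_self, map_zero,
      h.modMap_lie, h.lie_modMap, zero_add, add_zero, ← map_neg, ← map_add]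
    exact ⟨_, rfl⟩
  have h2 : ⁅h.modIdeal, h.modIdeal⁆ = ⊥ := by
    rw [LieSubmodule.lie_eq_bot_iff]
    rintro _ ⟨Y, rfl⟩ _ ⟨Z, rfl⟩
    exact lie_modMap_modMap Y Z
  rw [LieAlgebra.derivedSeriesOfIdeal_succ, LieAlgebra.derivedSeriesOfIdeal_succ,
    LieAlgebra.derivedSeriesOfIdeal_zero, eq_bot_iff, ← h2]
  exact LieSubmodule.mono_lie h1 h1

variable [FiniteDimensional ℝ g]

/-- A semisimple subalgebra meets the radical trivially: the intersection is a solvable ideal of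
it. -/
theorem radical_disjoint (L : LieSubalgebra ℝ g) [LieAlgebra.HasTrivialRadical ℝ L] :
    L.toSubmodule ⊓ (LieAlgebra.radical ℝ g).toSubmodule = ⊥ := by
  let I : LieIdeal ℝ L := (LieAlgebra.radical ℝ g).comap L.incl
  have hI : ∀ x : I, ((x : L) : g) ∈ LieAlgebra.radical ℝ g := fun x => x.2
  let f : I →ₗ⁅ℝ⁆ LieAlgebra.radical ℝ g :=
    { toFun := fun x => ⟨((x : L) : g), hI x⟩
      map_add' := fun _ _ => rfl
      map_smul' := fun _ _ => rfl
      map_lie' := rfl }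
  have hf : Function.Injective f := fun x y hxy =>
    Subtype.ext (Subtype.ext (congrArg (Subtype.val : LieAlgebra.radical ℝ g → g) hxy))
  have : LieAlgebra.IsSolvable I := hf.lieAlgebra_isSolvable
  have hbot := LieAlgebra.HasTrivialRadical.eq_bot_of_isSolvable I
  rw [Submodule.eq_bot_iff]
  rintro x ⟨hx, hx'⟩
  have h1 : (⟨x, hx⟩ : L) ∈ I := hx'
  rw [hbot, LieSubmodule.mem_bot] at h1
  exact congrArg Subtype.val h1

/-- If `T` is a central subspace of the endomorphisms of the module `l` and a complementary subspace
spans with `s` a semisimple subalgebra, then the radical is `l ⊕ T`. -/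
theorem radical_eq (h : IsCommutantExtension G ι j) {T K : Submodule ℝ (commutant s l)}
    (hT : ∀ t ∈ T, ∀ φ, t * φ = φ * t) (hKT : K ⊔ T = ⊤) {L : LieSubalgebra ℝ g}
    (hL : L.toSubmodule = LinearMap.range (algMap ι).toLinearMap ⊔ K.map j)
    [LieAlgebra.HasTrivialRadical ℝ L] :
    LieAlgebra.radical ℝ g = h.radIdeal T hT ∧
      IsCompl L.toSubmodule (LieAlgebra.radical ℝ g).toSubmodule := by
  have h1 : h.radIdeal T hT ≤ LieAlgebra.radical ℝ g :=
    (LieAlgebra.LieIdeal.solvable_iff_le_radical ℝ g _).1 (h.isSolvable_radIdeal T hT)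
  have hdisj := radical_disjoint L
  have hsplit : ∀ A, ∃ x ∈ L.toSubmodule, ∃ y ∈ h.radIdeal T hT, x + y = A := fun A => by
    obtain ⟨X, φ, Y, rfl⟩ := h.exists_eq A
    obtain ⟨k, hk, t, ht, rfl⟩ := Submodule.mem_sup.1 (hKT ▸ Submodule.mem_top : φ ∈ K ⊔ T)
    refine ⟨algMap ι X + j k, ?_, modMap ι Y + j t, h.mem_radIdeal.2 ⟨Y, t, ht, rfl⟩, ?_⟩
    · rw [hL]; exact Submodule.add_mem_sup ⟨X, rfl⟩ ⟨k, hk, rfl⟩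
    · rw [map_add]; abel
  refine ⟨le_antisymm (fun A hA => ?_) h1, disjoint_iff.2 hdisj, codisjoint_iff.2 ?_⟩
  · obtain ⟨x, hx, y, hy, rfl⟩ := hsplit A
    have h2 : x ∈ L.toSubmodule ⊓ (LieAlgebra.radical ℝ g).toSubmodule :=
      ⟨hx, by simpa using sub_mem hA (h1 hy)⟩
    rw [hdisj, Submodule.mem_bot] at h2
    rwa [h2, zero_add]
  · rw [eq_top_iff]
    intro A _
    obtain ⟨x, hx, y, hy, rfl⟩ := hsplit A
    exact Submodule.add_mem_sup hx (h1 hy)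

end IsCommutantExtension

end Splitting

end LeviTanaka

/-! ### Levi–Malcev decompositions -/

namespace LeviTanaka

open Polynomial in
theorem isSemisimple_of_idempotent {V : Type*} [AddCommGroup V] [Module ℝ V] {P : Module.End ℝ V}
    (hP : ∀ x, P (P x) = P x) : P.IsSemisimple := by
  refine Module.End.isSemisimple_of_squarefree_aeval_eq_zero (p := X * (X - C 1))
    (separable_X.mul (separable_X_sub_C (x := (1 : ℝ))) ⟨1, -1, by simp⟩).squarefree ?_
  ext x
  simp [hP]

open Polynomial in
/-- `F` is semisimple: it is killed by `X (X² - 2cX + c² - d)`, which is separable as `d < 0`. -/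
theorem isSemisimple_of_shift_sq {V : Type*} [AddCommGroup V] [Module ℝ V] {F : Module.End ℝ V}
    {c d : ℝ} (hd : d < 0) (hF : ∀ x, F (F (F x)) - (2 * c) • F (F x) + (c ^ 2 - d) • F x = 0) :
    F.IsSemisimple := by
  have hd0 : d ≠ 0 := hd.ne
  have hcd : c ^ 2 - d ≠ 0 := by nlinarith [sq_nonneg c]
  let q : ℝ[X] := X ^ 2 - C (2 * c) * X + C (c ^ 2 - d)
  have hq' : derivative q = 2 * X - C (2 * c) := by
    simp only [q, derivative_add, derivative_sub, derivative_X_pow, derivative_C_mul, derivative_X,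
      derivative_C]
    norm_num
    rfl
  have hq : q.Separable := by
    refine ⟨-C d⁻¹, C (d⁻¹ * 2⁻¹) * (X - C c), ?_⟩
    rw [hq']
    have h1 : (C d⁻¹ : ℝ[X]) * C d = 1 := by rw [← C_mul, inv_mul_cancel₀ hd0, C_1]
    have h2 : (C (2⁻¹) : ℝ[X]) * 2 = 1 := by
      rw [show (2 : ℝ[X]) = C 2 from rfl, ← C_mul]; norm_num
    simp only [q, C_mul, C_sub, C_pow, show (C 2 : ℝ[X]) = 2 from rfl]
    linear_combination h1 + C d⁻¹ * (X - C c) ^ 2 * h2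
  have hXq : IsCoprime (X : ℝ[X]) q := by
    refine ⟨-C (c ^ 2 - d)⁻¹ * (X - C (2 * c)), C (c ^ 2 - d)⁻¹, ?_⟩
    have h1 : (C (c ^ 2 - d)⁻¹ : ℝ[X]) * C (c ^ 2 - d) = 1 := by
      rw [← C_mul, inv_mul_cancel₀ hcd, C_1]
    simp only [q]
    linear_combination h1
  refine Module.End.isSemisimple_of_squarefree_aeval_eq_zero
    (p := q * X) (separable_X.mul hq hXq |> fun h => by rw [mul_comm]; exact h.squarefree) ?_
  ext x
  simp only [q, map_mul, map_add, map_sub, aeval_X, aeval_C, Module.End.mul_apply,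
    LinearMap.add_apply, LinearMap.sub_apply, Module.algebraMap_end_apply, pow_two,
    LinearMap.zero_apply]
  refine Eq.trans ?_ (hF x)
  module

section Splitting

variable {s : Type*} [LieRing s] [LieAlgebra ℝ s]
variable {l : Type*} [AddCommGroup l] [Module ℝ l] [LieRingModule s l] [LieModule ℝ s l]
variable {g : Type*} [LieRing g] [LieAlgebra ℝ g]

namespace IsCommutantExtension

variable {G : GradedCRAlgebra g} {ι : AbelianExt s l →ₗ⁅ℝ⁆ g} {j : commutant s l →ₗ[ℝ] g}

/-- A central endomorphism of the module `l` is realized by an ad-semisimple element: it acts as a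
scalar or as a complex number on `l`, and trivially on the other summands. -/
theorem isSemisimple_ad (h : IsCommutantExtension G ι j) [FiniteDimensional ℝ l]
    (hirr : LieModule.IsIrreducible ℝ s l) {t : commutant s l} (ht : ∀ φ, t * φ = φ * t) :
    (LieAlgebra.ad ℝ g (j t)).IsSemisimple := by
  have had : ∀ X φ Y, ⁅j t, algMap ι X + j φ + modMap ι Y⁆
      = modMap ι ((t : Module.End ℝ l) Y) := fun X φ Y => by
    rw [lie_add, lie_add, h.lie_algMap, h.lie_map_map, ht, sub_self, map_zero, h.lie_modMap,
      zero_add, zero_add]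
  rcases exists_sub_sq_of_mem_commutant hirr t.2 with ⟨c, hc⟩ | ⟨c, d, hd, hcd⟩
  · have h1 : t = c • 1 := Subtype.ext hc
    have hP : (LieAlgebra.ad ℝ g (j 1)).IsSemisimple := isSemisimple_of_idempotent fun A => by
      obtain ⟨X, φ, Y, rfl⟩ := h.exists_eq A
      simp only [LieAlgebra.ad_apply]
      rw [h.lie_one, h.lie_modMap]; rfl
    rw [h1, map_smul, map_smul]
    exact Module.End.IsSemisimple_smul c hP
  · refine isSemisimple_of_shift_sq (c := c) hd fun A => ?_
    obtain ⟨X, φ, Y, rfl⟩ := h.exists_eq A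
    have h1 : (t : Module.End ℝ l) ((t : Module.End ℝ l) Y)
        = (2 * c) • (t : Module.End ℝ l) Y - (c ^ 2 - d) • Y := by
      have h2 := LinearMap.congr_fun hcd Y
      simp only [Module.End.mul_apply, LinearMap.sub_apply, LinearMap.smul_apply,
        Module.End.one_apply, map_sub, map_smul] at h2
      rw [← sub_eq_zero] at h2 ⊢
      rw [← h2]
      module
    simp only [LieAlgebra.ad_apply, had, h.lie_modMap]
    rw [h1]
    simp only [map_sub, map_smul, h1]
    module

section CR

variable {S : GradedCRAlgebra s} {M : GradedCRModule S l}

/-- `s ⊕ K` is graded CR for every space `K` of endomorphisms of the module `l`. -/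
theorem isCRSubspace_levi [LieAlgebra.HasTrivialRadical ℝ s] (h : IsCommutantExtension G ι j)
    (hG : IsLeviTanakaExtension M G ι) (K : Submodule ℝ (commutant s l)) :
    G.IsCRSubspace (LinearMap.range (algMap ι).toLinearMap ⊔ K.map j) := by
  constructor
  · refine le_antisymm (sup_le ?_ ?_) (iSup_le fun p => inf_le_left)
    · rintro _ ⟨X, rfl⟩
      change algMap ι X ∈ _
      refine graded_induction S.isInternal (P := fun X => algMap ι X ∈ ⨆ p,
        (LinearMap.range (algMap ι).toLinearMap ⊔ K.map j) ⊓ G.gr p) (by simp)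
        (fun X X' h h' => by rw [map_add]; exact add_mem h h') (fun p X hX => ?_) X
      exact Submodule.mem_iSup_of_mem p ⟨Submodule.mem_sup_left ⟨X, rfl⟩, hG.algMap_mem hX⟩
    · rintro _ ⟨φ, hφ, rfl⟩
      exact Submodule.mem_iSup_of_mem 0 ⟨Submodule.mem_sup_right ⟨φ, hφ, rfl⟩, h.mem_zero φ⟩
  · intro X hX
    obtain ⟨y, hy, hyX⟩ := hG.exists_of_neg (by norm_num) X.2
    obtain ⟨_, ⟨X', rfl⟩, _, ⟨φ, hφ, rfl⟩, h2⟩ := Submodule.mem_sup.1 hX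
    have h3 := h.eq_zero_of_add_eq_zero (X := X' - y.1) (φ := φ) (Y := -y.2) (by
      rw [map_sub, map_neg]
      rw [← hyX, map_eq_add y] at h2
      change algMap ι X' + j φ = _ at h2
      rw [sub_add_eq_add_sub, h2]; abel)
    have hy0 : (⟨y.2, hy.2⟩ : M.gr (-1)) = 0 := Subtype.ext (neg_eq_zero.1 h3.2.2)
    rw [hG.map_J ⟨y, hy⟩ X hyX.symm, map_eq_add]
    refine Submodule.mem_sup_left ?_
    have h4 : (M.ext.J ⟨y, hy⟩ : AbelianExt s l).2 = 0 := by
      change (M.J ⟨y.2, hy.2⟩ : l) = 0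
      rw [hy0, map_zero]; rfl
    rw [h4, map_zero, add_zero]
    exact ⟨_, rfl⟩

/-- `l ⊕ T` is graded CR for every space `T` of endomorphisms of the module `l`. -/
theorem isCRSubspace_radical [LieAlgebra.HasTrivialRadical ℝ s] (h : IsCommutantExtension G ι j)
    (hG : IsLeviTanakaExtension M G ι) (T : Submodule ℝ (commutant s l)) :
    G.IsCRSubspace (LinearMap.range (modMap ι) ⊔ T.map j) := by
  constructor
  · refine le_antisymm (sup_le ?_ ?_) (iSup_le fun p => inf_le_left)
    · rintro _ ⟨Y, rfl⟩
      refine graded_induction M.isInternal (P := fun Y => modMap ι Y ∈ ⨆ p,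
        (LinearMap.range (modMap ι) ⊔ T.map j) ⊓ G.gr p) (by simp)
        (fun X X' h h' => by rw [map_add]; exact add_mem h h') (fun p Y hY => ?_) Y
      exact Submodule.mem_iSup_of_mem p ⟨Submodule.mem_sup_left ⟨Y, rfl⟩, hG.modMap_mem hY⟩
    · rintro _ ⟨φ, hφ, rfl⟩
      exact Submodule.mem_iSup_of_mem 0 ⟨Submodule.mem_sup_right ⟨φ, hφ, rfl⟩, h.mem_zero φ⟩
  · intro X hX
    obtain ⟨y, hy, hyX⟩ := hG.exists_of_neg (by norm_num) X.2
    obtain ⟨_, ⟨Y, rfl⟩, _, ⟨φ, hφ, rfl⟩, h2⟩ := Submodule.mem_sup.1 hX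
    have h3 := h.eq_zero_of_add_eq_zero (X := -y.1) (φ := φ) (Y := Y - y.2) (by
      rw [map_sub, map_neg]
      rw [← hyX, map_eq_add y] at h2
      rw [add_comm (modMap ι Y)] at h2
      rw [add_assoc, add_sub, h2]; abel)
    have hy0 : (⟨y.1, hy.1⟩ : S.gr (-1)) = 0 := Subtype.ext (neg_eq_zero.1 h3.1)
    rw [hG.map_J ⟨y, hy⟩ X hyX.symm, map_eq_add]
    refine Submodule.mem_sup_left ?_
    have h4 : (M.ext.J ⟨y, hy⟩ : AbelianExt s l).1 = 0 := by
      change (S.J ⟨y.1, hy.1⟩ : s) = 0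
      rw [hy0, map_zero]; rfl
    rw [h4, map_zero, zero_add]
    exact ⟨_, rfl⟩

end CR

/-- `l` is the largest nilpotent ideal of `l ⊕ T`: the elements of `T` act injectively on `l` by
Schur's lemma, so that an ideal not contained in `l` contains `l`, and is not nilpotent. -/
theorem exists_nilradical [LieAlgebra.HasTrivialRadical ℝ s] [FiniteDimensional ℝ l]
    (h : IsCommutantExtension G ι j) (hirr : LieModule.IsIrreducible ℝ s l)
    {T : Submodule ℝ (commutant s l)} {hT : ∀ t ∈ T, ∀ φ, t * φ = φ * t} {R : LieIdeal ℝ g}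
    (hR : R = h.radIdeal T hT) :
    ∃ I : LieIdeal ℝ R, IsGreatest {K : LieIdeal ℝ R | LieRing.IsNilpotent K} I ∧
      I.toSubmodule.map R.toSubmodule.subtype = LinearMap.range (modMap ι) := by
  have hmR : ∀ Y, modMap ι Y ∈ R := fun Y => by
    rw [hR]; exact h.mem_radIdeal.2 ⟨Y, 0, zero_mem _, by simp⟩
  let I : LieIdeal ℝ R :=
    { (LinearMap.range (modMap ι)).comap R.toSubmodule.subtype with
      lie_mem := fun {x y} hy => h.modIdeal.lie_mem (x := (x : g)) hy }
  have hI : ∀ x : R, x ∈ I ↔ ∃ Y, modMap ι Y = (x : g) := fun x => Iff.rfl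
  refine ⟨I, ⟨?_, ?_⟩, ?_⟩
  · have : IsLieAbelian I := ⟨fun x y => by
      obtain ⟨Y, hY⟩ := (hI x).1 x.2
      obtain ⟨Z, hZ⟩ := (hI y).1 y.2
      refine Subtype.ext (Subtype.ext ?_)
      change ⁅((x : R) : g), ((y : R) : g)⁆ = 0
      rw [← hY, ← hZ, lie_modMap_modMap]⟩
    change LieRing.IsNilpotent I
    infer_instance
  · intro K hK x hx
    have hK' : LieRing.IsNilpotent K := hK
    rw [hI]
    have hxR : (x : g) ∈ h.radIdeal T hT := by rw [← hR]; exact x.2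
    obtain ⟨Y, t, ht, hxt⟩ := h.mem_radIdeal.1 hxR
    rcases eq_or_ne t 0 with rfl | ht0
    · exact ⟨Y, by rw [hxt, map_zero, add_zero]⟩
    exfalso
    have hinj : Function.Injective (t : Module.End ℝ l) :=
      (eq_zero_or_injective_of_mem_commutant hirr t.2).resolve_left fun h0 => ht0 (Subtype.ext h0)
    have hxZ : ∀ Z, ⁅(x : g), modMap ι Z⁆ = modMap ι ((t : Module.End ℝ l) Z) := fun Z => by
      rw [hxt, add_lie, lie_modMap_modMap, h.lie_modMap, zero_add]
    have hmK : ∀ Z, (⟨modMap ι Z, hmR Z⟩ : R) ∈ K := fun Z => by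
      obtain ⟨Z, rfl⟩ := LinearMap.injective_iff_surjective.1 hinj Z
      have h1 : ⁅x, (⟨modMap ι Z, hmR Z⟩ : R)⁆ ∈ K := lie_mem_left ℝ R K _ _ hx
      convert h1 using 1
      exact Subtype.ext (hxZ Z).symm
    let m : l → K := fun Z => ⟨⟨modMap ι Z, hmR Z⟩, hmK Z⟩
    obtain ⟨n, hn⟩ := LieModule.isNilpotent_toEnd_of_isNilpotent ℝ K K (⟨x, hx⟩ : K)
    have hpow : ∀ n Z, ((LieModule.toEnd ℝ K K ⟨x, hx⟩) ^ n) (m Z)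
        = m (((t : Module.End ℝ l) ^ n) Z) := fun n => by
      induction n with
      | zero => intro Z; rfl
      | succ n ih =>
        intro Z
        rw [pow_succ, pow_succ, Module.End.mul_apply, Module.End.mul_apply, ← ih]
        congr 1
        exact Subtype.ext (Subtype.ext (hxZ Z))
    have hnt : Nontrivial l := LieModule.nontrivial_of_isIrreducible ℝ s l
    obtain ⟨Z, hZ⟩ := exists_ne (0 : l)
    have h1 := hpow n Z
    rw [hn, LinearMap.zero_apply] at h1
    have h2 : modMap ι (((t : Module.End ℝ l) ^ n) Z) = 0 :=
      (congrArg (fun k : K => ((k : R) : g)) h1).symm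
    have h3 : ((t : Module.End ℝ l) ^ n) Z = 0 :=
      modMap_injective h.injective (h2.trans (map_zero _).symm)
    have h4 : Function.Injective ((t : Module.End ℝ l) ^ n) := by
      rw [Module.End.coe_pow]
      exact hinj.iterate n
    exact hZ (h4 (h3.trans (map_zero _).symm))
  · refine le_antisymm ?_ ?_
    · rintro _ ⟨x, hx, rfl⟩
      exact hx
    · rintro _ ⟨Y, rfl⟩
      exact ⟨⟨modMap ι Y, hmR Y⟩, ⟨Y, rfl⟩, rfl⟩

/-- A decomposition of the endomorphisms of the module `l` in a central subspace `T` containing the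
identity and a subspace `K` spanning with `s` a semisimple subalgebra provides a Levi–Malcev
decomposition. -/
theorem isCRLeviMalcev [LieAlgebra.HasTrivialRadical ℝ s] [FiniteDimensional ℝ l]
    [FiniteDimensional ℝ g] {S : GradedCRAlgebra s} {M : GradedCRModule S l}
    (h : IsCommutantExtension G ι j) (hG : IsLeviTanakaExtension M G ι)
    (hirr : LieModule.IsIrreducible ℝ s l) {T K : Submodule ℝ (commutant s l)} (h1 : 1 ∈ T)
    (hT : ∀ t ∈ T, ∀ φ, t * φ = φ * t) (hKT : K ⊔ T = ⊤) {L : LieSubalgebra ℝ g}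
    (hL : L.toSubmodule = LinearMap.range (algMap ι).toLinearMap ⊔ K.map j)
    (hss : LieAlgebra.HasTrivialRadical ℝ L) :
    IsCRLeviMalcev G L (LinearMap.range (modMap ι)) (T.map j) := by
  obtain ⟨hrad, hcompl⟩ := h.radical_eq hT hKT hL
  have hrad' : (LieAlgebra.radical ℝ g).toSubmodule = LinearMap.range (modMap ι) ⊔ T.map j := by
    rw [hrad]; rfl
  refine ⟨inferInstance, hcompl, hL ▸ h.isCRSubspace_levi hG K,
    hrad' ▸ h.isCRSubspace_radical hG T, ?_, hrad'.symm, h.exists_nilradical hirr hrad, ?_⟩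
  · rw [Submodule.disjoint_def]
    rintro _ ⟨Y, rfl⟩ ⟨t, -, hY⟩
    have h2 := h.lie_one 0 0 Y
    rw [map_zero, map_zero, zero_add, zero_add, ← hY, h.lie_map_map, one_mul, mul_one, sub_self,
      map_zero] at h2
    rw [← hY, ← h2]
  · refine ⟨⟨?_, ?_, ?_⟩, ?_⟩
    · rw [hrad']; exact le_sup_right
    · rintro _ ⟨t, ht, rfl⟩ _ ⟨u, -, rfl⟩
      rw [h.lie_map_map, hT t ht, sub_self, map_zero]
    · rintro _ ⟨t, ht, rfl⟩
      exact h.isSemisimple_ad hirr (hT t ht)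
    · -- an element of a larger torus commutes with the one acting on `l` as the identity
      rintro T' ⟨hT'r, hT'c, -⟩ hTT' x hx
      have hxr := hT'r hx
      rw [hrad'] at hxr
      obtain ⟨_, ⟨Y, rfl⟩, _, ⟨t, ht, rfl⟩, rfl⟩ := Submodule.mem_sup.1 hxr
      have h2 := hT'c _ (hTT' ⟨1, h1, rfl⟩) _ hx
      have h3 := h.lie_one 0 t Y
      rw [map_zero, zero_add, add_comm, h2] at h3
      rw [← h3, zero_add]
      exact ⟨t, ht, rfl⟩

end IsCommutantExtension

end Splitting

end LeviTanaka

/-! ### The quaternionic Levi factor -/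

namespace LeviTanaka

section Triple

variable {a : Type*} [LieRing a] [LieAlgebra ℝ a]

/-- A Lie algebra spanned by elements with the commutation relations of the imaginary quaternions
`i`, `j`, `k` is simple. -/
theorem isSimple_of_triple {u v w : a} (hu : u ≠ 0) (huv : ⁅u, v⁆ = (2 : ℝ) • w)
    (hvw : ⁅v, w⁆ = (2 : ℝ) • u) (hwu : ⁅w, u⁆ = (2 : ℝ) • v)
    (hspan : ∀ x : a, ∃ b c d : ℝ, x = b • u + c • v + d • w) : LieAlgebra.IsSimple ℝ a := by
  refine ⟨fun I => or_iff_not_imp_left.2 fun hI => ?_, fun h => hu ?_⟩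
  · have hmem : ∀ {t : ℝ} {z : a}, t ≠ 0 → t • z ∈ I → z ∈ I := fun {t z} ht hz => by
      have := I.smul_mem t⁻¹ hz
      rwa [smul_smul, inv_mul_cancel₀ ht, one_smul] at this
    have hvu : ⁅v, u⁆ = -(2 : ℝ) • w := by rw [← lie_skew, huv, neg_smul]
    have hwv : ⁅w, v⁆ = -(2 : ℝ) • u := by rw [← lie_skew, hvw, neg_smul]
    have huw : ⁅u, w⁆ = -(2 : ℝ) • v := by rw [← lie_skew, hwu, neg_smul]
    have h1 : u ∈ I := by
      obtain ⟨x, hx, hx0⟩ := I.toSubmodule.exists_mem_ne_zero_of_ne_bot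
        fun h => hI ((LieSubmodule.toSubmodule_eq_bot I).1 h)
      rw [LieSubmodule.mem_toSubmodule] at hx
      obtain ⟨b, c, d, rfl⟩ := hspan x
      have hlie : ∀ y z, ⁅y, ⁅z, b • u + c • v + d • w⁆⁆ ∈ I := fun y z => I.lie_mem (I.lie_mem hx)
      by_cases hc : c = 0
      · by_cases hd : d = 0
        · have hb : b ≠ 0 := fun hb => hx0 (by simp [hb, hc, hd])
          refine hmem hb ?_
          simpa [hc, hd] using hx
        · refine hmem (t := 4 * d) (by simpa using hd) ?_
          convert hlie w u using 1
          simp only [lie_add, lie_smul, lie_self, lie_zero, smul_zero, huv, huw, hwv, hc]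
          module
      · refine hmem (t := 4 * c) (by simpa using hc) ?_
        convert hlie v u using 1
        simp only [lie_add, lie_smul, lie_self, lie_zero, smul_zero, huv, huw, hvw]
        module
    have h2 : w ∈ I := hmem two_ne_zero (huv ▸ lie_mem_left ℝ a I _ _ h1)
    have h3 : v ∈ I := hmem two_ne_zero (hwu ▸ I.lie_mem h1)
    refine eq_top_iff.2 fun x _ => ?_
    obtain ⟨b, c, d, rfl⟩ := hspan x
    exact add_mem (add_mem (I.smul_mem b h1) (I.smul_mem c h3)) (I.smul_mem d h2)
  · have h1 : ⁅v, w⁆ = 0 := h.trivial v w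
    rw [hvw] at h1
    exact (smul_eq_zero.1 h1).resolve_left two_ne_zero

end Triple

section QuaternionMatrix

open Quaternion

/-- The representation of the quaternions by complex `2 × 2` matrices. The quaternion algebra is
written `ℍ[ℝ,-1,0,-1]`, the definition of `ℍ`, for which the product is given in coordinates. -/
noncomputable def quatMatrix : ℍ[ℝ,-1,0,-1] →ₗ[ℝ] Matrix (Fin 2) (Fin 2) ℂ where
  toFun q := !![⟨q.re, q.imI⟩, ⟨q.imJ, q.imK⟩; ⟨-q.imJ, q.imK⟩, ⟨q.re, -q.imI⟩]
  map_add' p q := by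
    ext i k
    fin_cases i <;> fin_cases k <;> apply Complex.ext <;> simp <;> ring
  map_smul' t q := by
    ext i k
    fin_cases i <;> fin_cases k <;> apply Complex.ext <;> simp

theorem quatMatrix_apply (q : ℍ[ℝ,-1,0,-1]) : quatMatrix q
    = !![⟨q.re, q.imI⟩, ⟨q.imJ, q.imK⟩; ⟨-q.imJ, q.imK⟩, ⟨q.re, -q.imI⟩] := rfl

theorem quatMatrix_mul (p q : ℍ[ℝ,-1,0,-1]) : quatMatrix (p * q) = quatMatrix p * quatMatrix q := by
  simp only [quatMatrix_apply, Matrix.mul_fin_two]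
  ext i k
  fin_cases i <;> fin_cases k <;> apply Complex.ext <;> simp <;> ring

theorem quatMatrix_mem_su2 {q : ℍ[ℝ,-1,0,-1]} (hq : q.re = 0) : quatMatrix q ∈ su2 := by
  refine ⟨?_, ?_⟩
  · ext i k
    fin_cases i <;> fin_cases k <;> apply Complex.ext <;> simp [quatMatrix_apply, hq]
  · apply Complex.ext <;> simp [quatMatrix_apply, Matrix.trace_fin_two, hq]

theorem quatMatrix_injective : Function.Injective quatMatrix := fun p q h => by
  have h0 := congrArg (fun A => A 0 0) h
  have h1 := congrArg (fun A => A 0 1) h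
  simp only [quatMatrix_apply, Matrix.of_apply, Matrix.cons_val', Matrix.cons_val_zero,
    Matrix.cons_val_one, Matrix.cons_val_fin_one, Complex.mk.injEq] at h0 h1
  exact QuaternionAlgebra.ext h0.1 h0.2 h1.1 h1.2

theorem exists_quatMatrix_eq {A : Matrix (Fin 2) (Fin 2) ℂ} (hA : A ∈ su2) :
    ∃ q : ℍ[ℝ,-1,0,-1], q.re = 0 ∧ quatMatrix q = A := by
  obtain ⟨hA, htr⟩ := hA
  have h00 := congrArg (fun B => B 0 0) hA
  have h01 := congrArg (fun B => B 1 0) hA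
  rw [Matrix.trace_fin_two] at htr
  simp only [Matrix.conjTranspose_apply, Matrix.neg_apply, Complex.ext_iff, Complex.star_def,
    Complex.conj_re, Complex.conj_im, Complex.neg_re, Complex.neg_im] at h00 h01
  simp only [Complex.ext_iff, Complex.add_re, Complex.add_im, Complex.zero_re,
    Complex.zero_im] at htr
  refine ⟨⟨0, (A 0 0).im, (A 0 1).re, (A 0 1).im⟩, rfl, ?_⟩
  rw [quatMatrix_apply]
  ext i k
  fin_cases i <;> fin_cases k <;> apply Complex.ext <;> simp <;> linarith

end QuaternionMatrix

section Splitting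

variable {s : Type*} [LieRing s] [LieAlgebra ℝ s]
variable {l : Type*} [AddCommGroup l] [Module ℝ l] [LieRingModule s l] [LieModule ℝ s l]
variable {g : Type*} [LieRing g] [LieAlgebra ℝ g]

namespace IsCommutantExtension

variable {G : GradedCRAlgebra g} {ι : AbelianExt s l →ₗ⁅ℝ⁆ g} {j : commutant s l →ₗ[ℝ] g}

/-- The subalgebra spanned by `s` and by a space of endomorphisms of the module `l` closed under
commutators. -/
def leviSubalgebra (h : IsCommutantExtension G ι j) (K : Submodule ℝ (commutant s l))
    (hK : ∀ φ ∈ K, ∀ ψ ∈ K, φ * ψ - ψ * φ ∈ K) : LieSubalgebra ℝ g :=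
  { LinearMap.range (algMap ι).toLinearMap ⊔ K.map j with
    lie_mem' := by
      intro x y hx hy
      obtain ⟨_, ⟨X, rfl⟩, _, ⟨φ, hφ, rfl⟩, rfl⟩ := Submodule.mem_sup.1 hx
      obtain ⟨_, ⟨Y, rfl⟩, _, ⟨ψ, hψ, rfl⟩, rfl⟩ := Submodule.mem_sup.1 hy
      change ⁅algMap ι X + j φ, algMap ι Y + j ψ⁆ ∈ _
      rw [add_lie, lie_add, lie_add, h.algMap_lie, h.lie_algMap, add_zero, zero_add,
        ← LieHom.map_lie, h.lie_map_map]
      exact Submodule.add_mem_sup ⟨_, rfl⟩ ⟨_, hK φ hφ ψ hψ, rfl⟩ }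

theorem mem_leviSubalgebra (h : IsCommutantExtension G ι j) {K : Submodule ℝ (commutant s l)}
    {hK : ∀ φ ∈ K, ∀ ψ ∈ K, φ * ψ - ψ * φ ∈ K} {x : g} :
    x ∈ h.leviSubalgebra K hK ↔ ∃ X, ∃ φ ∈ K, x = algMap ι X + j φ := by
  constructor
  · intro hx
    obtain ⟨_, ⟨X, rfl⟩, _, ⟨φ, hφ, rfl⟩, rfl⟩ := Submodule.mem_sup.1 hx
    exact ⟨X, φ, hφ, rfl⟩
  · rintro ⟨X, φ, hφ, rfl⟩
    exact Submodule.add_mem_sup ⟨X, rfl⟩ ⟨φ, hφ, rfl⟩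

/-- The ideal of `s ⊕ K` formed by the endomorphisms in `K`. -/
def leviIdeal (h : IsCommutantExtension G ι j) (K : Submodule ℝ (commutant s l))
    (hK : ∀ φ ∈ K, ∀ ψ ∈ K, φ * ψ - ψ * φ ∈ K) : LieIdeal ℝ (h.leviSubalgebra K hK) :=
  { (K.map j).comap (h.leviSubalgebra K hK).toSubmodule.subtype with
    lie_mem := by
      rintro ⟨x, hx⟩ ⟨y, hy⟩ ⟨ψ, hψ, hψy : j ψ = y⟩
      obtain ⟨X, φ, hφ, rfl⟩ := h.mem_leviSubalgebra.1 hx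
      refine ⟨φ * ψ - ψ * φ, hK φ hφ ψ hψ, ?_⟩
      change j _ = ⁅algMap ι X + j φ, y⁆
      rw [← hψy, add_lie, h.algMap_lie, h.lie_map_map, zero_add] }

theorem mem_leviIdeal (h : IsCommutantExtension G ι j) {K : Submodule ℝ (commutant s l)}
    {hK : ∀ φ ∈ K, ∀ ψ ∈ K, φ * ψ - ψ * φ ∈ K} {x : h.leviSubalgebra K hK} :
    x ∈ h.leviIdeal K hK ↔ ∃ φ ∈ K, j φ = x := Iff.rfl

theorem map_leviIdeal (h : IsCommutantExtension G ι j) {K : Submodule ℝ (commutant s l)}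
    {hK : ∀ φ ∈ K, ∀ ψ ∈ K, φ * ψ - ψ * φ ∈ K} :
    (h.leviIdeal K hK).toSubmodule.map (h.leviSubalgebra K hK).toSubmodule.subtype = K.map j := by
  refine le_antisymm ?_ ?_
  · rintro _ ⟨x, hx, rfl⟩
    exact hx
  · rintro _ ⟨φ, hφ, rfl⟩
    exact ⟨⟨j φ, h.mem_leviSubalgebra.2 ⟨0, φ, hφ, by simp⟩⟩, ⟨φ, hφ, rfl⟩, rfl⟩

/-- `s ⊕ K` has trivial radical if `K` has: an Abelian ideal projects to an Abelian ideal of `s`,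
that is, to zero. -/
theorem hasTrivialRadical_leviSubalgebra [FiniteDimensional ℝ s] [LieAlgebra.IsKilling ℝ s]
    [FiniteDimensional ℝ g] (h : IsCommutantExtension G ι j) {K : Submodule ℝ (commutant s l)}
    {hK : ∀ φ ∈ K, ∀ ψ ∈ K, φ * ψ - ψ * φ ∈ K}
    (ha : LieAlgebra.HasTrivialRadical ℝ (h.leviIdeal K hK)) :
    LieAlgebra.HasTrivialRadical ℝ (h.leviSubalgebra K hK) := by
  set L := h.leviSubalgebra K hK
  rw [LieAlgebra.hasTrivialRadical_iff_no_abelian_ideals]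
  intro I hI
  have hab : ∀ {x y : L}, x ∈ I → y ∈ I → ⁅(x : g), (y : g)⁆ = 0 := fun hx hy =>
    congrArg Subtype.val (lie_eq_zero_of_isLieAbelian hx hy)
  have hmem : ∀ X, algMap ι X ∈ L := fun X => h.mem_leviSubalgebra.2 ⟨X, 0, zero_mem _, by simp⟩
  let I' : LieIdeal ℝ s :=
    { carrier := {X | ∃ x ∈ I, ∃ φ, (x : g) = algMap ι X + j φ}
      add_mem' := by
        rintro X X' ⟨x, hx, φ, h1⟩ ⟨x', hx', φ', h1'⟩
        refine ⟨x + x', add_mem hx hx', φ + φ', ?_⟩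
        change (x : g) + (x' : g) = _
        rw [h1, h1', map_add, map_add, add_add_add_comm]
      zero_mem' := ⟨0, zero_mem _, 0, by simp⟩
      smul_mem' := by
        rintro t X ⟨x, hx, φ, h1⟩
        refine ⟨t • x, I.smul_mem t hx, t • φ, ?_⟩
        change t • (x : g) = _
        rw [h1, map_smul, map_smul, smul_add]
      lie_mem := by
        rintro X' X ⟨x, hx, φ, h1⟩
        refine ⟨⁅(⟨algMap ι X', hmem X'⟩ : L), x⁆, I.lie_mem hx, 0, ?_⟩
        rw [LieSubalgebra.coe_bracket, h1, lie_add, h.algMap_lie, ← LieHom.map_lie, map_zero] }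
  have hI' : ∀ X ∈ I', ∀ X' ∈ I', ⁅X, X'⁆ = 0 := by
    rintro X ⟨x, hx, φ, h1⟩ X' ⟨x', hx', φ', h1'⟩
    have h2 := hab hx hx'
    rw [h1, h1', add_lie, lie_add, lie_add, h.algMap_lie, h.lie_algMap, add_zero, zero_add,
      ← LieHom.map_lie, h.lie_map_map] at h2
    exact (h.eq_zero_of_add_eq_zero (Y := 0) (by rw [h2, map_zero, add_zero])).1
  have : IsLieAbelian I' := ⟨fun X X' => Subtype.ext (hI' X X.2 X' X'.2)⟩
  have hbot := LieAlgebra.IsKilling.ideal_eq_bot_of_isLieAbelian I'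
  have hIa : ∀ x ∈ I, x ∈ h.leviIdeal K hK := fun x hx => by
    obtain ⟨X, φ, hφ, h1⟩ := h.mem_leviSubalgebra.1 x.2
    have hX : X ∈ I' := ⟨x, hx, φ, h1⟩
    rw [hbot, LieSubmodule.mem_bot] at hX
    exact h.mem_leviIdeal.2 ⟨φ, hφ, by rw [h1, hX, map_zero, zero_add]⟩
  let N : LieIdeal ℝ (h.leviIdeal K hK) :=
    { I.toSubmodule.comap (h.leviIdeal K hK).toSubmodule.subtype with
      lie_mem := fun {x y} hy => I.lie_mem (x := (x : L)) hy }
  have hN : IsLieAbelian N := ⟨fun x y => Subtype.ext (Subtype.ext (Subtype.ext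
    (hab (x := x.1.1) (y := y.1.1) x.2 y.2)))⟩
  have hNbot := (LieAlgebra.hasTrivialRadical_iff_no_abelian_ideals ℝ _).1 ha N hN
  refine (LieSubmodule.eq_bot_iff _).2 fun x hx => ?_
  have hxN : (⟨x, hIa x hx⟩ : h.leviIdeal K hK) ∈ N := hx
  rw [hNbot, LieSubmodule.mem_bot] at hxN
  exact congrArg Subtype.val hxN

theorem hasTrivialRadical_range [FiniteDimensional ℝ s] [LieAlgebra.IsKilling ℝ s]
    [FiniteDimensional ℝ g] (h : IsCommutantExtension G ι j) :
    LieAlgebra.HasTrivialRadical ℝ (algMap ι).range := by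
  have : LieAlgebra.IsKilling ℝ (algMap ι).range :=
    LieAlgebra.isKilling_of_equiv (LieEquiv.ofInjective _ (algMap_injective h.injective))
  infer_instance

/-- If the endomorphisms of the module `l` commute, `s` is a Levi subalgebra and all of them are in
the radical. -/
theorem isCRLeviMalcev_range [FiniteDimensional ℝ s] [LieAlgebra.IsKilling ℝ s]
    [FiniteDimensional ℝ l] [FiniteDimensional ℝ g] {S : GradedCRAlgebra s}
    {M : GradedCRModule S l} (h : IsCommutantExtension G ι j) (hG : IsLeviTanakaExtension M G ι)
    (hirr : LieModule.IsIrreducible ℝ s l) (hcomm : ∀ φ ψ : commutant s l, φ * ψ = ψ * φ) :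
    IsCRLeviMalcev G (algMap ι).range (LinearMap.range (modMap ι)) (LinearMap.range j) := by
  have := h.isCRLeviMalcev hG hirr (T := ⊤) (K := ⊥) trivial (fun t _ φ => hcomm t φ) (bot_sup_eq _)
    (L := (algMap ι).range) (by rw [Submodule.map_bot, sup_bot_eq]; rfl) h.hasTrivialRadical_range
  rwa [Submodule.map_top] at this

section Quaternionic

open Quaternion

/-- The purely imaginary endomorphisms of a module of quaternionic type. -/
def imaginary (e : commutant s l ≃ₐ[ℝ] ℍ[ℝ,-1,0,-1]) : Submodule ℝ (commutant s l) where
  carrier := {φ | (e φ).re = 0}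
  zero_mem' := by simp
  add_mem' := by
    intro φ ψ hφ hψ
    simp only [Set.mem_ofPred_eq] at *
    rw [map_add, QuaternionAlgebra.re_add, hφ, hψ, add_zero]
  smul_mem' := by
    intro t φ hφ
    simp only [Set.mem_ofPred_eq] at *
    rw [map_smul, QuaternionAlgebra.re_smul, hφ, smul_zero]

theorem mem_imaginary {e : commutant s l ≃ₐ[ℝ] ℍ[ℝ,-1,0,-1]} {φ : commutant s l} :
    φ ∈ imaginary e ↔ (e φ).re = 0 := Iff.rfl

theorem commutator_mem_imaginary (e : commutant s l ≃ₐ[ℝ] ℍ[ℝ,-1,0,-1]) (φ ψ : commutant s l) :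
    φ * ψ - ψ * φ ∈ imaginary e := by
  rw [mem_imaginary, map_sub, map_mul, map_mul]
  simp only [QuaternionAlgebra.re_sub, QuaternionAlgebra.re_mul]
  ring

theorem imaginary_sup_span_one (e : commutant s l ≃ₐ[ℝ] ℍ[ℝ,-1,0,-1]) :
    imaginary e ⊔ Submodule.span ℝ {1} = ⊤ := by
  rw [eq_top_iff]
  intro φ _
  have h1 : φ = (φ - (e φ).re • 1) + (e φ).re • 1 := by abel
  rw [h1]
  refine Submodule.add_mem_sup ?_ (Submodule.smul_mem _ _ (Submodule.mem_span_singleton_self 1))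
  rw [mem_imaginary, map_sub, map_smul, map_one]
  simp

theorem isSimple_leviIdeal [LieAlgebra.HasTrivialRadical ℝ s] (h : IsCommutantExtension G ι j)
    (e : commutant s l ≃ₐ[ℝ] ℍ[ℝ,-1,0,-1]) : LieAlgebra.IsSimple ℝ
      (h.leviIdeal (imaginary e) fun φ _ ψ _ => commutator_mem_imaginary e φ ψ) := by
  set L := h.leviSubalgebra (imaginary e) fun φ _ ψ _ => commutator_mem_imaginary e φ ψ
  set a := h.leviIdeal (imaginary e) fun φ _ ψ _ => commutator_mem_imaginary e φ ψ
  -- the element of `a` defined by a quaternion without real part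
  have hmk : ∀ q : ℍ[ℝ,-1,0,-1], q.re = 0 → ∃ x : a, ((x : L) : g) = j (e.symm q) := fun q hq => by
    have hq' : e.symm q ∈ imaginary e := by rwa [mem_imaginary, AlgEquiv.apply_symm_apply]
    exact ⟨⟨⟨j (e.symm q), h.mem_leviSubalgebra.2 ⟨0, e.symm q, hq', by rw [map_zero, zero_add]⟩⟩,
      e.symm q, hq', rfl⟩, rfl⟩
  obtain ⟨u, hu⟩ := hmk ⟨0, 1, 0, 0⟩ rfl
  obtain ⟨v, hv⟩ := hmk ⟨0, 0, 1, 0⟩ rfl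
  obtain ⟨w, hw⟩ := hmk ⟨0, 0, 0, 1⟩ rfl
  have hlie : ∀ {x y z : a} {p q r : ℍ[ℝ,-1,0,-1]}, ((x : L) : g) = j (e.symm p) →
      ((y : L) : g) = j (e.symm q) → ((z : L) : g) = j (e.symm r) → p * q - q * p = (2 : ℝ) • r →
      ⁅x, y⁆ = (2 : ℝ) • z := fun {x y z p q r} hx hy hz hpq => by
    refine Subtype.ext (Subtype.ext ?_)
    change ⁅((x : L) : g), ((y : L) : g)⁆ = (2 : ℝ) • ((z : L) : g)
    rw [hx, hy, hz, h.lie_map_map, ← map_mul, ← map_mul, ← map_sub, hpq, map_smul, map_smul]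
  refine isSimple_of_triple (u := u) (v := v) (w := w) (fun h0 => ?_)
    (hlie hu hv hw ?_) (hlie hv hw hu ?_) (hlie hw hu hv ?_) fun x => ?_
  · rw [h0] at hu
    have h1 : e.symm (⟨0, 1, 0, 0⟩ : ℍ[ℝ,-1,0,-1]) = 0 :=
      h.injective_map (hu.symm.trans (map_zero j).symm)
    rw [map_eq_zero_iff _ e.symm.injective] at h1
    simpa using congrArg QuaternionAlgebra.imI h1
  · ext <;> norm_num
  · ext <;> norm_num
  · ext <;> norm_num
  · obtain ⟨φ, hφ, hx⟩ := h.mem_leviIdeal.1 x.2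
    refine ⟨(e φ).imI, (e φ).imJ, (e φ).imK, Subtype.ext (Subtype.ext ?_)⟩
    change ((x : L) : g) = (e φ).imI • ((u : L) : g) + (e φ).imJ • ((v : L) : g)
      + (e φ).imK • ((w : L) : g)
    rw [← hx, hu, hv, hw]
    simp only [← map_smul, ← map_add]
    congr 1
    rw [AlgEquiv.eq_symm_apply]
    have h0 : (e φ).re = 0 := hφ
    ext <;> simp [h0]

attribute [local instance 100] LieRing.ofAssociativeRing in
theorem nonempty_equiv_su2 [LieAlgebra.HasTrivialRadical ℝ s] (h : IsCommutantExtension G ι j)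
    (e : commutant s l ≃ₐ[ℝ] ℍ[ℝ,-1,0,-1]) : Nonempty
      (h.leviIdeal (imaginary e) (fun φ _ ψ _ => commutator_mem_imaginary e φ ψ) ≃ₗ⁅ℝ⁆ su2) := by
  obtain ⟨r, hr⟩ := LinearMap.exists_leftInverse_of_injective j
    (LinearMap.ker_eq_bot.2 h.injective_map)
  let F : g →ₗ[ℝ] Matrix (Fin 2) (Fin 2) ℂ := quatMatrix ∘ₗ e.toLinearMap ∘ₗ r
  have hF : ∀ φ, F (j φ) = quatMatrix (e φ) := fun φ =>
    congrArg (fun ψ => quatMatrix (e ψ)) (LinearMap.congr_fun hr φ)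
  have hlie : ∀ φ ψ, F ⁅j φ, j ψ⁆ = F (j φ) * F (j ψ) - F (j ψ) * F (j φ) := fun φ ψ => by
    rw [h.lie_map_map, hF, hF, hF, map_sub, map_mul, map_mul, map_sub, quatMatrix_mul,
      quatMatrix_mul]
  have hmem : ∀ φ ∈ imaginary e, F (j φ) ∈ su2 := fun φ hφ => by
    rw [hF]; exact quatMatrix_mem_su2 hφ
  have hinj : ∀ φ ψ, F (j φ) = F (j ψ) → φ = ψ := fun φ ψ hφψ => by
    rw [hF, hF] at hφψ
    exact e.injective (quatMatrix_injective hφψ)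
  have hsurj : ∀ A ∈ su2, ∃ φ ∈ imaginary e, F (j φ) = A := fun A hA => by
    obtain ⟨q, hq, hqA⟩ := exists_quatMatrix_eq hA
    refine ⟨e.symm q, by rwa [mem_imaginary, AlgEquiv.apply_symm_apply], ?_⟩
    rw [hF, AlgEquiv.apply_symm_apply, hqA]
  clear_value F
  let a := h.leviIdeal (imaginary e) (fun φ _ ψ _ => commutator_mem_imaginary e φ ψ)
  let c : a →ₗ[ℝ] g := (h.leviSubalgebra (imaginary e) _).toSubmodule.subtype ∘ₗ
    a.toSubmodule.subtype
  let f₀ : a →ₗ[ℝ] su2 := LinearMap.codRestrict su2.toSubmodule (F ∘ₗ c) fun x => by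
    obtain ⟨φ, hφ, hx⟩ := h.mem_leviIdeal.1 x.2
    change F (x.1 : g) ∈ su2
    rw [← hx]
    exact hmem φ hφ
  have hf₀ : ∀ x y : a, f₀ ⁅x, y⁆ = ⁅f₀ x, f₀ y⁆ := fun x y => by
    obtain ⟨φ, hφ, hx⟩ := h.mem_leviIdeal.1 x.2
    obtain ⟨ψ, hψ, hy⟩ := h.mem_leviIdeal.1 y.2
    refine Subtype.ext ?_
    change F ⁅x.1.1, y.1.1⁆ = F x.1.1 * F y.1.1 - F y.1.1 * F x.1.1
    rw [← hx, ← hy, hlie]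
  let f : a →ₗ⁅ℝ⁆ su2 := { f₀ with map_lie' := fun {x y} => hf₀ x y }
  refine ⟨LieEquiv.ofBijective f ⟨fun x y hxy => ?_, fun A => ?_⟩⟩
  · obtain ⟨φ, hφ, hx⟩ := h.mem_leviIdeal.1 x.2
    obtain ⟨ψ, hψ, hy⟩ := h.mem_leviIdeal.1 y.2
    have h1 : F x.1.1 = F y.1.1 := congrArg Subtype.val hxy
    rw [← hx, ← hy] at h1
    exact Subtype.ext (Subtype.ext (by rw [← hx, ← hy, hinj _ _ h1]))
  · obtain ⟨φ, hφ, hA⟩ := hsurj A.1 A.2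
    exact ⟨⟨⟨j φ, h.mem_leviSubalgebra.2 ⟨0, φ, hφ, by rw [map_zero, zero_add]⟩⟩, φ, hφ, rfl⟩,
      Subtype.ext hA⟩

end Quaternionic

end IsCommutantExtension

/-- A proper Levi–Tanaka extension is `s ⊕ C ⊕ l`, with `C` the algebra of endomorphisms of the
module `l`. -/
theorem IsLeviTanakaExtension.exists_isCommutantExtension {S : GradedCRAlgebra s}
    {M : GradedCRModule S l} {G : GradedCRAlgebra g} {ι : AbelianExt s l →ₗ⁅ℝ⁆ g}
    [FiniteDimensional ℝ s] [FiniteDimensional ℝ l] [LieAlgebra.IsKilling ℝ s]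
    (hG : IsLeviTanakaExtension M G ι) (hS : S.Transitive) (hirr : LieModule.IsIrreducible ℝ s l)
    (hnd : IsNondegenerate S.gr M.gr) (hproper : IsProper g) :
    ∃ j : commutant s l →ₗ[ℝ] g, IsCommutantExtension G ι j := by
  obtain ⟨j, hj, hj'⟩ := hG.exists_commutantMap hS hirr hnd
  exact ⟨j, hG.injective hS, hj, hj', fun A hA B hB => hG.eq_of_lie_eq hA hB,
    hG.exists_decomposition hS hirr hproper hj hj'⟩

end Splitting

end LeviTanaka

/-! ### Modules of real, complex and quaternionic type -/

theorem mainTheorem2 {s l g : Type*}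
    [LieRing s] [LieAlgebra ℝ s] [FiniteDimensional ℝ s] [LieAlgebra.IsSemisimple ℝ s]
    [AddCommGroup l] [Module ℝ l] [FiniteDimensional ℝ l] [LieRingModule s l] [LieModule ℝ s l]
    [LieRing g] [LieAlgebra ℝ g]
    (S : LeviTanaka.GradedCRAlgebra s) (hS : S.Transitive)
    (M : LeviTanaka.GradedCRModule S l) (hirr : LieModule.IsIrreducible ℝ s l)
    (hnd : LeviTanaka.IsNondegenerate S.gr M.gr)
    (G : LeviTanaka.GradedCRAlgebra g) (ι : LeviTanaka.AbelianExt s l →ₗ⁅ℝ⁆ g)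
    (hG : LeviTanaka.IsLeviTanakaExtension M G ι) (hproper : LeviTanaka.IsProper g) :
    FiniteDimensional ℝ g ∧ Function.Injective ι ∧
    ∃ π ∈ G.gr 0, (∀ x, ⁅π, ι x⁆ = ι (LeviTanaka.AbelianExt.inr x.2)) ∧
      -- real type
      (LeviTanaka.IsRealType s l →
        ∃ L : LieSubalgebra ℝ g,
          L.toSubmodule = LinearMap.range (ι.toLinearMap ∘ₗ LeviTanaka.AbelianExt.inl) ∧
          LeviTanaka.IsCRLeviMalcev G L
            (LinearMap.range (ι.toLinearMap ∘ₗ LeviTanaka.AbelianExt.inr))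
            (Submodule.span ℝ {π})) ∧
      -- complex type, with an identification `e` of the `s`-endomorphisms of `l` with `ℂ`
      (∀ e : LeviTanaka.commutant s l ≃ₐ[ℝ] ℂ,
        ∃ L : LieSubalgebra ℝ g, ∃ j : ℂ →ₗ[ℝ] g,
          L.toSubmodule = LinearMap.range (ι.toLinearMap ∘ₗ LeviTanaka.AbelianExt.inl) ∧
          Function.Injective j ∧ j 1 = π ∧ (∀ z, j z ∈ G.gr 0) ∧
          (∀ z x, ⁅j z, ι x⁆ =
            ι (LeviTanaka.AbelianExt.inr ((e.symm z : Module.End ℝ l) x.2))) ∧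
          LeviTanaka.IsCRLeviMalcev G L
            (LinearMap.range (ι.toLinearMap ∘ₗ LeviTanaka.AbelianExt.inr))
            (LinearMap.range j)) ∧
      -- quaternionic type
      (LeviTanaka.IsQuaternionicType s l →
        ∃ (L : LieSubalgebra ℝ g) (a : LieIdeal ℝ L),
          LieAlgebra.IsSimple ℝ a ∧ Nonempty (a ≃ₗ⁅ℝ⁆ LeviTanaka.su2) ∧
          (∀ x ∈ a, (x : g) ∈ G.gr 0) ∧
          (∀ X : s, ∀ x ∈ a, ⁅ι (LeviTanaka.AbelianExt.inl X), (x : g)⁆ = 0) ∧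
          Disjoint (LinearMap.range (ι.toLinearMap ∘ₗ LeviTanaka.AbelianExt.inl))
            (a.toSubmodule.map L.toSubmodule.subtype) ∧
          LinearMap.range (ι.toLinearMap ∘ₗ LeviTanaka.AbelianExt.inl) ⊔
            a.toSubmodule.map L.toSubmodule.subtype = L.toSubmodule ∧
          LeviTanaka.IsCRLeviMalcev G L
            (LinearMap.range (ι.toLinearMap ∘ₗ LeviTanaka.AbelianExt.inr))
            (Submodule.span ℝ {π})) := by
  have hcr : LieAlgebra.HasTrivialRadical ℝ s := inferInstance
  have hK : LieAlgebra.IsKilling ℝ s := inferInstance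
  obtain ⟨j, h⟩ := hG.exists_isCommutantExtension hS hirr hnd hproper
  have hfin : FiniteDimensional ℝ g := hG.finiteDimensional
  refine ⟨hfin, h.injective, j 1, h.mem_zero 1, fun x => h.lie_map 1 x, ?_, ?_, ?_⟩
  · rintro ⟨e⟩
    refine ⟨(LeviTanaka.algMap ι).range, rfl, ?_⟩
    have hrange : LinearMap.range j = Submodule.span ℝ {j 1} := by
      rw [← Submodule.map_top, ← Set.image_singleton, ← Submodule.map_span]
      congr 1
      refine (eq_top_iff.2 fun φ _ => Submodule.mem_span_singleton.2 ⟨e φ, e.injective ?_⟩).symm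
      rw [map_smul, map_one, smul_eq_mul, mul_one]
    rw [← hrange]
    exact h.isCRLeviMalcev_range hG hirr fun φ ψ =>
      e.injective (by rw [map_mul, map_mul, mul_comm])
  · intro e
    have hrange : LinearMap.range (j ∘ₗ e.symm.toLinearMap) = LinearMap.range j :=
      LinearMap.range_comp_of_range_eq_top j (LinearMap.range_eq_top.2 e.symm.surjective)
    refine ⟨(LeviTanaka.algMap ι).range, j ∘ₗ e.symm.toLinearMap, rfl,
      h.injective_map.comp e.symm.injective, congrArg j (map_one e.symm), fun z => h.mem_zero _,
      fun z x => h.lie_map _ x, ?_⟩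
    rw [hrange]
    exact h.isCRLeviMalcev_range hG hirr fun φ ψ =>
      e.injective (by rw [map_mul, map_mul, mul_comm])
  · rintro ⟨e'⟩
    -- `ℍ` unfolded to its definition as a quaternion algebra
    let e : LeviTanaka.commutant s l ≃ₐ[ℝ] QuaternionAlgebra ℝ (-1) 0 (-1) := e'
    have hK' : ∀ φ ∈ LeviTanaka.IsCommutantExtension.imaginary e,
        ∀ ψ ∈ LeviTanaka.IsCommutantExtension.imaginary e,
        φ * ψ - ψ * φ ∈ LeviTanaka.IsCommutantExtension.imaginary e := fun φ _ ψ _ =>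
      LeviTanaka.IsCommutantExtension.commutator_mem_imaginary e φ ψ
    have hsimple : LieAlgebra.IsSimple ℝ (h.leviIdeal _ hK') := h.isSimple_leviIdeal e
    refine ⟨h.leviSubalgebra _ hK', h.leviIdeal _ hK', hsimple, h.nonempty_equiv_su2 e,
      fun x hx => ?_, fun X x hx => ?_, ?_, ?_, ?_⟩
    · obtain ⟨φ, -, hφ⟩ := h.mem_leviIdeal.1 hx
      rw [← hφ]
      exact h.mem_zero φ
    · obtain ⟨φ, -, hφ⟩ := h.mem_leviIdeal.1 hx
      rw [← hφ]
      exact h.algMap_lie φ X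
    · rw [h.map_leviIdeal, Submodule.disjoint_def]
      rintro _ ⟨X, rfl⟩ ⟨φ, -, hφ⟩
      change j φ = LeviTanaka.algMap ι X at hφ
      have h1 := h.eq_zero_of_add_eq_zero (X := X) (φ := -φ) (Y := 0) (by
        rw [map_neg, hφ, map_zero, add_neg_cancel, add_zero])
      change LeviTanaka.algMap ι X = 0
      rw [h1.1, map_zero]
    · rw [h.map_leviIdeal]
      rfl
    · rw [← Set.image_singleton, ← Submodule.map_span]
      refine h.isCRLeviMalcev hG hirr (Submodule.mem_span_singleton_self 1) (fun t ht φ => ?_)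
        (LeviTanaka.IsCommutantExtension.imaginary_sup_span_one e) rfl
        (h.hasTrivialRadical_leviSubalgebra inferInstance)
      obtain ⟨c, rfl⟩ := Submodule.mem_span_singleton.1 ht
      rw [smul_mul_assoc, mul_smul_comm, one_mul, mul_one]
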